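/- Let $\mathcal X_0,\mathcal X_1,\mathcal X_2,\mathcal Y$ be finite sets, let $\rho$ be a probability distribution on $\mathcal X_0$, and let $\Gamma(y|x_1)$ be a channel, i.e. a probability distribution $\Gamma(\cdot|x_1)$ on $\mathcal Y$ for every $x_1\in\mathcal X_1$. The states $X_{0,1},X_{0,2},\dots$ are i.i.d. with law $\rho$. A pair of (deterministic) strategies consists, for every stage $i\ge 1$, of a measurable map $\sigma_i$ giving the action $X_{1,i}=\sigma_i\big((X_{0,j})_{j\ge1},X_{1,1},\dots,X_{1,i-1}\big)\in\mathcal X_1$ of decision-maker 1 (who knows the whole state sequence and its own past actions), and a map $\tau_i:\mathcal X_0^{i-1}\times\mathcal Y^{i-1}\times\mathcal X_2^{i-1}\to\mathcal X_2$ giving the action $X_{2,i}=\tau_i(X_{0,1},\dots,X_{0,i-1},Y_1,\dots,Y_{i-1},X_{2,1},\dots,X_{2,i-1})$ of decision-maker 2. Here the observations $Y_1,Y_2,\dots$ are the outputs of the memoryless channel $\Gamma$: given the state sequence, and hence the actions $X_{1,1},X_{1,2},\dots$, they are independent, and $Y_i$ has law $\Gamma(\cdot|X_{1,i})$. Let $P_{X_{0,i},X_{1,i},X_{2,i},Y_i}$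 be the induced joint distribution at stage $i$. A distribution $\overline Q$ on $\mathcal X_0\times\mathcal X_1\times\mathcal X_2$ is called implementable if there is a pair of strategies $(\sigma_i,\tau_i)_{i\ge1}$ such that for all $(x_0,x_1,x_2)$, $$\frac1t\sum_{i=1}^t\sum_{y\in\mathcal Y}P_{X_{0,i},X_{1,i},X_{2,i},Y_i}(x_0,x_1,x_2,y)\longrightarrow\overline Q(x_0,x_1,x_2)\qquad(t\to\infty).$$ Theorem. Let $\overline Q$ be a probability distribution on $\mathcal X_0\times\mathcal X_1\times\mathcal X_2$ with $\sum_{x_1,x_2}\overline Q(x_0,x_1,x_2)=\rho(x_0)$ for all $x_0$. Then $\overline Q$ is implementable if and only if the distribution $Q(x_0,x_1,x_2,y)=\overline Q(x_0,x_1,x_2)\,\Gamma(y|x_1)$ on $\mathcal X_0\times\mathcal X_1\times\mathcal X_2\times\mathcal Y$ satisfies $$I_Q(X_0;X_2)\le I_Q(X_1;Y\mid X_0,X_2).$$ The same equivalence holds if implementability is understood over finite horizons: for every total number $T$ of stages there is a pair of strategies, which may depend on $T$, with $\sigma_i:\mathcal X_0^T\times\mathcal X_1^{i-1}\to\mathcal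 X_1$ for $i\le T$ (decision-maker 1 knows the states of the $T$ stages only), such that the average of the stage distributions over $i=1,\dots,T$ converges to $\overline Q$ as $T\to\infty$. -/

import Mathlib

open MeasureTheory Filter Topology
open scoped ENNReal

/-! ### Entropy and mutual information of finitely-valued random variables -/

section Information

variable {Ω A B C : Type*} [Fintype A] [Fintype B] [Fintype C]

/-- Shannon entropy (natural logarithm, `0 log 0 = 0`) of a distribution on a finite set. -/
noncomputable def shannonEntropy (p : PMF A) : ℝ :=
  ∑ a, Real.negMulLog (p a).toReal

/-- `H_Q(U)`: the entropy of the random variable `U` under `Q`. -/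
noncomputable def entropy (Q : PMF Ω) (U : Ω → A) : ℝ :=
  shannonEntropy (Q.map U)

/-- `H_Q(U | V) = H_Q(U, V) - H_Q(V)`. -/
noncomputable def condEntropy (Q : PMF Ω) (U : Ω → A) (V : Ω → B) : ℝ :=
  entropy Q (fun ω => (U ω, V ω)) - entropy Q V

/-- `I_Q(U ; V) = H_Q(U) - H_Q(U | V)`. -/
noncomputable def mutualInfo (Q : PMF Ω) (U : Ω → A) (V : Ω → B) : ℝ :=
  entropy Q U - condEntropy Q U V

/-- `I_Q(U ; V | W) = H_Q(U | W) - H_Q(U | V, W)`. -/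
noncomputable def condMutualInfo (Q : PMF Ω) (U : Ω → A) (V : Ω → B) (W : Ω → C) : ℝ :=
  condEntropy Q U W - condEntropy Q U (fun ω => (V ω, W ω))

end Information

/-! ### Strategies, and the distributions they induce (stages are numbered from `0`) -/

/-- A pair of (deterministic) strategies. At stage `i`, decision-maker 1 knows the whole sequence
of states and its own past actions; decision-maker 2 knows the past states, its past observations
and its own past actions. -/
structure StrategyPair (X₀ X₁ X₂ Y : Type*) [MeasurableSpace X₀] [MeasurableSpace X₁] where
  /-- the strategy of decision-maker 1 -/
  σ : (i : ℕ) → (ℕ → X₀) → (Fin i → X₁) → X₁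
  /-- the strategy of decision-maker 2 -/
  τ : (i : ℕ) → (Fin i → X₀) → (Fin i → Y) → (Fin i → X₂) → X₂
  measurable_σ : ∀ (i : ℕ) (h : Fin i → X₁), Measurable fun x₀ : ℕ → X₀ => σ i x₀ h

namespace StrategyPair

variable {X₀ X₁ X₂ Y : Type*} [MeasurableSpace X₀] [MeasurableSpace X₁]

/-- The action `X_{1,i}` when the state sequence is `x₀`. -/
def action₁ (s : StrategyPair X₀ X₁ X₂ Y) (x₀ : ℕ → X₀) (i : ℕ) : X₁ :=
  s.σ i x₀ fun j : Fin i => s.action₁ x₀ j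
termination_by i
decreasing_by exact j.isLt

/-- The action `X_{2,i}` when the state sequence is `x₀` and the observation sequence is `y`. -/
def action₂ (s : StrategyPair X₀ X₁ X₂ Y) (x₀ : ℕ → X₀) (y : ℕ → Y) (i : ℕ) : X₂ :=
  s.τ i (fun j => x₀ j) (fun j => y j) fun j : Fin i => s.action₂ x₀ y j
termination_by i
decreasing_by exact j.isLt

/-- In the first `T` stages, decision-maker 1 only uses the states of these `T` stages, that is,
`σ_i` is a map `X₀^T × X₁^i → X₁` for `i < T`. -/
def HasHorizon (s : StrategyPair X₀ X₁ X₂ Y) (T : ℕ) : Prop :=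
  ∀ i < T, DependsOn (s.σ i) (Set.Iio T)

variable [MeasurableSpace Y]

/-- The law of the observation sequence given the state sequence `x₀`: the channel `Γ` is
memoryless, so that the observations are independent with laws `Γ(· | x_{1,i})`. -/
noncomputable def observationLaw (s : StrategyPair X₀ X₁ X₂ Y) (Γ : X₁ → PMF Y) (x₀ : ℕ → X₀) :
    Measure (ℕ → Y) :=
  Measure.infinitePi fun j => (Γ (s.action₁ x₀ j)).toMeasure

/-- `P_{X_{0,i}, X_{1,i}, X_{2,i}, Y_i}(v)`, the joint distribution of the state, the actions and
the observation at stage `i`, when the states are i.i.d. with law `ρ`. -/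
noncomputable def stageLaw (s : StrategyPair X₀ X₁ X₂ Y) (ρ : PMF X₀) (Γ : X₁ → PMF Y) (i : ℕ)
    (v : X₀ × X₁ × X₂ × Y) : ℝ≥0∞ :=
  ∫⁻ x₀, s.observationLaw Γ x₀ {y | (x₀ i, s.action₁ x₀ i, s.action₂ x₀ y i, y i) = v}
    ∂(Measure.infinitePi fun _ : ℕ => ρ.toMeasure)

/-- The average over the first `t` stages of the distributions of the state and the actions:
`(1/t) ∑_{i < t} ∑_y P_{X_{0,i}, X_{1,i}, X_{2,i}, Y_i}(x₀, x₁, x₂, y)`. -/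
noncomputable def averageLaw [Fintype Y] (s : StrategyPair X₀ X₁ X₂ Y) (ρ : PMF X₀)
    (Γ : X₁ → PMF Y) (t : ℕ) (x₀ : X₀) (x₁ : X₁) (x₂ : X₂) : ℝ :=
  (1 / (t : ℝ)) * ∑ i ∈ Finset.range t, ∑ y, (s.stageLaw ρ Γ i (x₀, x₁, x₂, y)).toReal

end StrategyPair

section Implementability

variable {X₀ X₁ X₂ Y : Type*} [MeasurableSpace X₀] [MeasurableSpace X₁] [MeasurableSpace Y]
  [Fintype Y]

/-- Implementability over an infinite horizon: one pair of strategies, whose averaged stage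
distributions converge to `Qbar`. -/
def Implementable (ρ : PMF X₀) (Γ : X₁ → PMF Y) (Qbar : PMF (X₀ × X₁ × X₂)) : Prop :=
  ∃ s : StrategyPair X₀ X₁ X₂ Y, ∀ x₀ x₁ x₂,
    Tendsto (fun t => s.averageLaw ρ Γ t x₀ x₁ x₂) atTop (𝓝 (Qbar (x₀, x₁, x₂)).toReal)

/-- Implementability over finite horizons: for every total number `T` of stages a pair of
strategies in which decision-maker 1 knows the `T` states, such that the stage distributions
averaged over the `T` stages converge to `Qbar` as `T → ∞`. -/
def FiniteHorizonImplementable (ρ : PMF X₀) (Γ : X₁ → PMF Y) (Qbar : PMF (X₀ × X₁ × X₂)) : Prop :=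
  ∃ s : ℕ → StrategyPair X₀ X₁ X₂ Y, (∀ T, (s T).HasHorizon T) ∧ ∀ x₀ x₁ x₂,
    Tendsto (fun T => (s T).averageLaw ρ Γ T x₀ x₁ x₂) atTop (𝓝 (Qbar (x₀, x₁, x₂)).toReal)

end Implementability

/-- The information constraint: `I_Q(X₀ ; X₂) ≤ I_Q(X₁ ; Y | X₀, X₂)` for the distribution
`Q(x₀, x₁, x₂, y) = Qbar(x₀, x₁, x₂) Γ(y | x₁)`. -/
def InformationConstraint {X₀ X₁ X₂ Y : Type*} [Fintype X₀] [Fintype X₁] [Fintype X₂] [Fintype Y]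
    (Γ : X₁ → PMF Y) (Qbar : PMF (X₀ × X₁ × X₂)) : Prop :=
  ∃ Q : PMF (X₀ × X₁ × X₂ × Y),
    (∀ x₀ x₁ x₂ y, Q (x₀, x₁, x₂, y) = Qbar (x₀, x₁, x₂) * Γ x₁ y) ∧
    mutualInfo Q (fun v => v.1) (fun v => v.2.2.1) ≤
      condMutualInfo Q (fun v => v.2.1) (fun v => v.2.2.2) (fun v => (v.1, v.2.2.1))

/-! Since `Y` depends on the other variables through `X₁` only, the difference `I(X₁;Y|X₀,X₂) -
I(X₀;X₂)` equals `H(X₀,Y|X₂) - H(X₀) - H(Y|X₁)`, here called the slack (`informationSlack`). It is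
continuous in the law of `(X₀,X₁,X₂)`, and concave on laws with a fixed state marginal: the first
term is a concave conditional entropy, the second is constant, the third is linear.

Converse. Over `T` stages, the entropy of all states and outputs is at least `T H(ρ) + ∑
H(Y_i|X_{1,i})`, because the states are i.i.d. and the channel is memoryless. By the chain rule it
is at most `∑ H(X_{0,i},Y_i|X_{2,i})`, because `X_{2,i}` is a function of past states and outputs.
So the slacks of the stages have nonnegative sum. Concavity gives nonnegative slack for the averaged
law (`informationSlack_average_nonneg`), and continuity gives it for the limit.

Achievability. Time is cut into blocks. During a block, decision-maker 1 transmits the index of a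
codeword `x₂ⁿ` that is jointly typical with the states of the next block, and decision-maker 2 plays
the decoded codeword there. A codebook of rate above `I(X₀;X₂)` covers most state sequences
(`exists_covering`). Once a block is over, its states, hence the intended `x₂ⁿ`, are known to the
decoder; conditionally on them, Feinstein's lemma (`exists_channelCode`) transmits at any rate below
`I(X₁;Y|X₀,X₂)`, with inputs that are themselves jointly typical. As the decoder uses the revealed
states and not its own past actions, errors do not propagate.

Strictly positive slack leaves room for a rate between the two informations. If `I(X₀;X₂) = 0`, a
single codeword suffices and nothing needs to be transmitted. Otherwise the product of the marginals
has slack `I(X₁;Y) > 0`, and by concavity mixing in a little of it makes the slack positive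
(`eventually_hasBlockCode`).

Block lengths grow logarithmically, so that the code errors vanish while incomplete blocks and
changes of code cost a vanishing fraction of the stages. The bounds are uniform over what
decision-maker 1 believes about states beyond the horizon, so one construction serves both notions
of implementability. -/

/-! ### Entropy of random variables on a finite weighted space -/

section FiniteEntropy

open scoped Classical

variable {Ω A B C : Type*} [Fintype Ω]

/-- The law of `U` under the weights `q`. -/
noncomputable def marginal (q : Ω → ℝ) (U : Ω → A) (a : A) : ℝ :=
  ∑ ω, if U ω = a then q ω else 0

/-- The entropy of `U` under the weights `q`. -/
noncomputable def weightEntropy (q : Ω → ℝ) (U : Ω → A) : ℝ :=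
  -∑ ω, q ω * Real.log (marginal q U (U ω))

lemma marginal_nonneg {q : Ω → ℝ} (hq : ∀ ω, 0 ≤ q ω) (U : Ω → A) (a : A) :
    0 ≤ marginal q U a :=
  Finset.sum_nonneg fun ω _ => by split_ifs <;> simp [hq]

lemma le_marginal {q : Ω → ℝ} (hq : ∀ ω, 0 ≤ q ω) (U : Ω → A) (ω : Ω) :
    q ω ≤ marginal q U (U ω) := by
  have := Finset.single_le_sum (f := fun ω' => if U ω' = U ω then q ω' else 0)
    (fun ω' _ => by split_ifs <;> simp [hq]) (Finset.mem_univ ω)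
  simpa [marginal] using this

lemma marginal_pos {q : Ω → ℝ} (hq : ∀ ω, 0 ≤ q ω) (U : Ω → A) {ω : Ω} (h : 0 < q ω) :
    0 < marginal q U (U ω) := h.trans_le (le_marginal hq U ω)

lemma sum_marginal_mul [Fintype A] (q : Ω → ℝ) (U : Ω → A) (f : A → ℝ) :
    ∑ a, marginal q U a * f a = ∑ ω, q ω * f (U ω) := by
  simp only [marginal, Finset.sum_mul, ite_mul, zero_mul]
  rw [Finset.sum_comm]
  simp

lemma sum_marginal [Fintype A] (q : Ω → ℝ) (U : Ω → A) :
    ∑ a, marginal q U a = ∑ ω, q ω := by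
  simpa using sum_marginal_mul q U fun _ => 1

lemma marginal_comp [Fintype A] (q : Ω → ℝ) (U : Ω → A) (f : A → B) :
    marginal (marginal q U) f = marginal q (fun ω => f (U ω)) := by
  funext b
  have := sum_marginal_mul q U fun a => if f a = b then 1 else 0
  simpa [marginal] using this

lemma marginal_id (q : Ω → ℝ) : marginal q (fun ω => ω) = q := by
  funext ω; simp [marginal]

lemma weightEntropy_eq_sum_negMulLog [Fintype A] (q : Ω → ℝ) (U : Ω → A) :
    weightEntropy q U = ∑ a, Real.negMulLog (marginal q U a) := by
  have := sum_marginal_mul q U fun a => Real.log (marginal q U a)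
  simp only [weightEntropy, Real.negMulLog, neg_mul, Finset.sum_neg_distrib]
  rw [this]

/-- Entropy depends only on the partition generated by the variable. This replaces all explicit
relabellings of tuples below. -/
lemma weightEntropy_congr (q : Ω → ℝ) {U : Ω → A} {V : Ω → B}
    (h : ∀ ω ω', U ω = U ω' ↔ V ω = V ω') : weightEntropy q U = weightEntropy q V := by
  simp [weightEntropy, marginal, h]

lemma weightEntropy_marginal [Fintype A] (q : Ω → ℝ) (U : Ω → A) (f : A → B) :
    weightEntropy (marginal q U) f = weightEntropy q (fun ω => f (U ω)) := by
  simp only [weightEntropy, marginal_comp]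
  rw [sum_marginal_mul q U fun a => Real.log (marginal q (fun ω => f (U ω)) (f a))]

/-- This is `I(U;V|W) ≥ 0`: apply `log r ≤ r - 1` to the ratio `r` of `q(u,w) q(v,w)` to `q(u,v,w)
q(w)`, whose mean is at most the total mass. The weights need not sum to one. -/
lemma weightEntropy_submodular [Fintype A] [Fintype B] [Fintype C] {q : Ω → ℝ}
    (hq : ∀ ω, 0 ≤ q ω) (U : Ω → A) (V : Ω → B) (W : Ω → C) :
    weightEntropy q (fun ω => (U ω, V ω, W ω)) + weightEntropy q W ≤
      weightEntropy q (fun ω => (U ω, W ω)) + weightEntropy q (fun ω => (V ω, W ω)) := by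
  set UVW : Ω → A × B × C := fun ω => (U ω, V ω, W ω) with hUVW
  set UW : Ω → A × C := fun ω => (U ω, W ω) with hUW
  set VW : Ω → B × C := fun ω => (V ω, W ω) with hVW
  have key : ∑ ω, q ω * (marginal q UW (UW ω) * marginal q VW (VW ω) /
      (marginal q UVW (UVW ω) * marginal q W (W ω))) ≤ ∑ ω, q ω := by
    have h1 := sum_marginal_mul q UVW fun t =>
      marginal q UW (t.1, t.2.2) * marginal q VW t.2 /
        (marginal q UVW t * marginal q W t.2.2)
    rw [← h1]
    calc _ ≤ ∑ t : A × B × C, marginal q UW (t.1, t.2.2) * marginal q VW t.2 /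
          marginal q W t.2.2 := by
          refine Finset.sum_le_sum fun t _ => ?_
          rcases (marginal_nonneg hq UVW t).eq_or_lt with h | h
          · rw [← h, zero_mul]
            exact div_nonneg (mul_nonneg (marginal_nonneg hq _ _) (marginal_nonneg hq _ _))
              (marginal_nonneg hq _ _)
          · apply le_of_eq
            rw [mul_div_assoc', mul_div_mul_left _ _ h.ne']
      _ = ∑ c, marginal q W c * marginal q W c / marginal q W c := by
          have e1 : ∀ c, ∑ a, marginal q UW (a, c) = marginal q W c := fun c => by
            simp only [marginal, hUW, Prod.mk.injEq]
            rw [Finset.sum_comm]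
            refine Finset.sum_congr rfl fun ω _ => ?_
            by_cases h : W ω = c <;> simp [h]
          have e2 : ∀ c, ∑ b, marginal q VW (b, c) = marginal q W c := fun c => by
            simp only [marginal, hVW, Prod.mk.injEq]
            rw [Finset.sum_comm]
            refine Finset.sum_congr rfl fun ω _ => ?_
            by_cases h : W ω = c <;> simp [h]
          rw [Fintype.sum_prod_type]
          simp only [Fintype.sum_prod_type]
          rw [Finset.sum_comm]
          simp_rw [Finset.sum_comm (s := (Finset.univ : Finset A))]
          rw [Finset.sum_comm]
          refine Finset.sum_congr rfl fun c _ => ?_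
          simp_rw [← Finset.sum_div]
          congr 1
          nth_rw 1 [← e1 c]
          rw [← e2 c, Finset.sum_mul_sum, Finset.sum_comm]
      _ = ∑ c, marginal q W c := by
          refine Finset.sum_congr rfl fun c _ => ?_
          exact mul_self_div_self _
      _ = ∑ ω, q ω := sum_marginal q W
  have hterm : ∀ ω, q ω - q ω * (marginal q UW (UW ω) * marginal q VW (VW ω) /
      (marginal q UVW (UVW ω) * marginal q W (W ω))) ≤
      q ω * Real.log (marginal q UVW (UVW ω)) + q ω * Real.log (marginal q W (W ω)) -
      q ω * Real.log (marginal q UW (UW ω)) - q ω * Real.log (marginal q VW (VW ω)) := by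
    intro ω
    rcases (hq ω).eq_or_lt with h | h
    · simp [← h]
    · have p1 := marginal_pos hq UVW h
      have p2 := marginal_pos hq W h
      have p3 := marginal_pos hq UW h
      have p4 := marginal_pos hq VW h
      have hl := Real.log_le_sub_one_of_pos
        (x := marginal q UW (UW ω) * marginal q VW (VW ω) /
          (marginal q UVW (UVW ω) * marginal q W (W ω))) (by positivity)
      rw [Real.log_div (by positivity) (by positivity), Real.log_mul p3.ne' p4.ne',
        Real.log_mul p1.ne' p2.ne'] at hl
      nlinarith
  have := Finset.sum_le_sum fun ω (_ : ω ∈ Finset.univ) => hterm ω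
  simp only [Finset.sum_sub_distrib, Finset.sum_add_distrib] at this
  simp only [weightEntropy]
  linarith

/-- `H(U | V)` for weights. -/
noncomputable def condWeightEntropy (q : Ω → ℝ) (U : Ω → A) (V : Ω → B) : ℝ :=
  weightEntropy q (fun ω => (U ω, V ω)) - weightEntropy q V

/-- Conditioning on finer information lowers entropy: submodularity in the case where `W` is a
function of `V`, so that adjoining `W` to `V` changes nothing. -/
lemma condWeightEntropy_le_of_determines [Fintype A] [Fintype B] [Fintype C] {q : Ω → ℝ}
    (hq : ∀ ω, 0 ≤ q ω) (U : Ω → A) (V : Ω → B) (W : Ω → C)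
        (hVW : ∀ ω ω', V ω = V ω' → W ω = W ω') :
    condWeightEntropy q U V ≤ condWeightEntropy q U W := by
  have h := weightEntropy_submodular hq U V W
  have h1 : weightEntropy q (fun ω => (U ω, V ω, W ω)) = weightEntropy q (fun ω => (U ω, V ω)) :=
    weightEntropy_congr q fun ω ω' => by
      simp only [Prod.mk.injEq]
      exact ⟨fun h => ⟨h.1, h.2.1⟩, fun h => ⟨h.1, h.2, hVW _ _ h.2⟩⟩
  have h2 : weightEntropy q (fun ω => (V ω, W ω)) = weightEntropy q V :=
    weightEntropy_congr q fun ω ω' => by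
      simp only [Prod.mk.injEq]
      exact ⟨fun h => h.1, fun h => ⟨h, hVW _ _ h⟩⟩
  simp only [condWeightEntropy]
  linarith

lemma marginal_const_mul (c : ℝ) (q : Ω → ℝ) (U : Ω → A) (a : A) :
    marginal (fun ω => c * q ω) U a = c * marginal q U a := by
  simp [marginal, Finset.mul_sum]

lemma marginal_sum {ι : Type*} [Fintype ι] (q : ι → Ω → ℝ) (U : Ω → A) (a : A) :
    marginal (fun ω => ∑ i, q i ω) U a = ∑ i, marginal (q i) U a := by
  simp only [marginal]
  rw [Finset.sum_comm]
  refine Finset.sum_congr rfl fun ω _ => ?_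
  split_ifs <;> simp

lemma weightEntropy_mixture_index {ι : Type*} [Fintype ι] [Fintype A]
    (w : ι → ℝ) (q : ι → Ω → ℝ) (U : Ω → A) :
    weightEntropy (fun t : ι × Ω => w t.1 * q t.1 t.2) (fun t => (t.1, U t.2)) =
      ∑ i, (Real.negMulLog (w i) * (∑ ω, q i ω) + w i * weightEntropy (q i) U) := by
  have h : ∀ i a, marginal (fun t : ι × Ω => w t.1 * q t.1 t.2) (fun t => (t.1, U t.2)) (i, a) =
      w i * marginal (q i) U a := by
    intro i a
    rw [← marginal_const_mul]
    simp only [marginal, Fintype.sum_prod_type, Prod.mk.injEq]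
    rw [Finset.sum_eq_single i] <;> simp +contextual
  rw [weightEntropy_eq_sum_negMulLog, Fintype.sum_prod_type]
  refine Finset.sum_congr rfl fun i _ => ?_
  simp only [h, Real.negMulLog_mul]
  rw [Finset.sum_add_distrib, weightEntropy_eq_sum_negMulLog, ← Finset.sum_mul, sum_marginal,
    ← Finset.mul_sum, mul_comm]

lemma weightEntropy_mixture {ι : Type*} [Fintype ι] [Fintype A]
    (w : ι → ℝ) (q : ι → Ω → ℝ) (U : Ω → A) :
    weightEntropy (fun t : ι × Ω => w t.1 * q t.1 t.2) (fun t => U t.2) =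
      weightEntropy (fun ω => ∑ i, w i * q i ω) U := by
  have h : marginal (fun t : ι × Ω => w t.1 * q t.1 t.2) (fun t => U t.2) =
      marginal (fun ω => ∑ i, w i * q i ω) U := by
    funext a
    rw [marginal_sum]
    simp only [marginal, Fintype.sum_prod_type]
  rw [weightEntropy_eq_sum_negMulLog, weightEntropy_eq_sum_negMulLog, h]

/-- Concavity of the conditional entropy. -/
lemma sum_mul_condWeightEntropy_le {ι : Type*} [Fintype ι] [Fintype A] [Fintype B]
    (w : ι → ℝ) (hw : ∀ i, 0 ≤ w i) (q : ι → Ω → ℝ) (hq : ∀ i ω, 0 ≤ q i ω)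
    (U : Ω → A) (V : Ω → B) :
    ∑ i, w i * condWeightEntropy (q i) U V ≤
      condWeightEntropy (fun ω => ∑ i, w i * q i ω) U V := by
  let q' : ι × Ω → ℝ := fun t => w t.1 * q t.1 t.2
  have hq' : ∀ t, 0 ≤ q' t := fun t => mul_nonneg (hw _) (hq _ _)
  -- On the space of pairs (index, outcome), the average of the conditional entropies is the entropy
  -- given `V` and the index; forgetting the index can only increase it.
  have h := condWeightEntropy_le_of_determines hq' (fun t => U t.2) (fun t => (t.1, V t.2))
    (fun t => V t.2) fun t t' h => (Prod.mk.inj h).2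
  have e3 : weightEntropy q' (fun t => (U t.2, t.1, V t.2)) =
      weightEntropy q' (fun t => (t.1, (U t.2, V t.2))) :=
    weightEntropy_congr q' fun t t' => by simp only [Prod.mk.injEq]; tauto
  simp only [condWeightEntropy] at h ⊢
  rw [e3, weightEntropy_mixture_index w q (fun ω => (U ω, V ω)), weightEntropy_mixture_index w q V,
    weightEntropy_mixture w q (fun ω => (U ω, V ω)), weightEntropy_mixture w q V] at h
  refine le_trans (le_of_eq ?_) h
  rw [← Finset.sum_sub_distrib]
  exact Finset.sum_congr rfl fun i _ => by ring

end FiniteEntropy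

/-! ### The slack: another form of the information constraint, continuity, concavity -/

section Slack

open scoped Classical

lemma PMF.sum_toReal {A : Type*} [Fintype A] (p : PMF A) : ∑ a, (p a).toReal = 1 := by
  rw [← ENNReal.toReal_sum fun a _ => p.apply_ne_top a, ← tsum_fintype (L := .unconditional _),
    p.tsum_coe, ENNReal.toReal_one]

lemma entropy_eq_weightEntropy {Ω A : Type*} [Fintype Ω] [Fintype A] (Q : PMF Ω) (U : Ω → A) :
    entropy Q U = weightEntropy (fun ω => (Q ω).toReal) U := by
  rw [weightEntropy_eq_sum_negMulLog]
  refine Finset.sum_congr rfl fun a _ => ?_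
  congr 1
  rw [PMF.map_apply, tsum_fintype, ENNReal.toReal_sum]
  · refine Finset.sum_congr rfl fun ω _ => ?_
    by_cases h : U ω = a
    · simp [h]
    · simp [h, Ne.symm h]
  · intro ω _
    split_ifs <;> simp [Q.apply_ne_top]

variable {A B C D : Type*}

/-- The weights `p(x₀, x₁, x₂) Γ(y | x₁)`. -/
noncomputable def jointWeight (Γ : B → PMF D) (p : A × B × C → ℝ) (v : A × B × C × D) : ℝ :=
  p (v.1, v.2.1, v.2.2.1) * (Γ v.2.1 v.2.2.2).toReal

lemma jointWeight_nonneg (Γ : B → PMF D) {p : A × B × C → ℝ} (hp : ∀ a, 0 ≤ p a)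
    (v : A × B × C × D) : 0 ≤ jointWeight Γ p v :=
  mul_nonneg (hp _) ENNReal.toReal_nonneg

lemma jointWeight_sum {ι : Type*} [Fintype ι] (Γ : B → PMF D) (w : ι → ℝ) (p : ι → A × B × C → ℝ) :
    jointWeight Γ (fun a => ∑ i, w i * p i a) = fun v => ∑ i, w i * jointWeight Γ (p i) v := by
  funext v
  simp [jointWeight, Finset.sum_mul, mul_assoc]

variable [Fintype A] [Fintype B] [Fintype C] [Fintype D]

/-- The entropy of the output of the channel for a given input. -/
noncomputable def channelEntropy (Γ : B → PMF D) (b : B) : ℝ :=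
  ∑ y, Real.negMulLog (Γ b y).toReal

/-- `H(X₀, Y | X₂) - H(X₀) - H(Y | X₁)`, which equals `I(X₁ ; Y | X₀, X₂) - I(X₀ ; X₂)`. -/
noncomputable def informationSlack (Γ : B → PMF D) (p : A × B × C → ℝ) : ℝ :=
  condWeightEntropy (jointWeight Γ p) (fun v => (v.1, v.2.2.2)) (fun v => v.2.2.1) -
    weightEntropy p (fun a => a.1) - ∑ a, p a * channelEntropy Γ a.2.1

lemma marginal_jointWeight (Γ : B → PMF D) (p : A × B × C → ℝ) :
    marginal (jointWeight Γ p) (fun v => (v.1, v.2.1, v.2.2.1)) = p := by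
  funext ⟨a, b, c⟩
  simp only [marginal, jointWeight, Fintype.sum_prod_type, Prod.mk.injEq]
  rw [Finset.sum_eq_single a (by simp +contextual) (by simp),
    Finset.sum_eq_single b (by simp +contextual) (by simp),
    Finset.sum_eq_single c (by simp +contextual) (by simp)]
  simp [← Finset.mul_sum, PMF.sum_toReal]

lemma weightEntropy_jointWeight_comp {E : Type*} (Γ : B → PMF D) (p : A × B × C → ℝ)
    (f : A × B × C → E) :
    weightEntropy (jointWeight Γ p) (fun v => f (v.1, v.2.1, v.2.2.1)) = weightEntropy p f := by
  rw [← weightEntropy_marginal (jointWeight Γ p) (fun v => (v.1, v.2.1, v.2.2.1)) f,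
    marginal_jointWeight]

lemma weightEntropy_jointWeight_id (Γ : B → PMF D) (p : A × B × C → ℝ) :
    weightEntropy (jointWeight Γ p) (fun v => v) =
      weightEntropy p (fun a => a) + ∑ a, p a * channelEntropy Γ a.2.1 := by
  simp only [weightEntropy_eq_sum_negMulLog, marginal_id, jointWeight, Fintype.sum_prod_type,
    Real.negMulLog_mul, channelEntropy, ← Finset.sum_add_distrib]
  refine Finset.sum_congr rfl fun a _ => Finset.sum_congr rfl fun b _ =>
    Finset.sum_congr rfl fun c _ => ?_
  rw [Finset.sum_add_distrib, ← Finset.sum_mul, PMF.sum_toReal, one_mul, Finset.mul_sum]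

/-- Expanding into joint entropies, the two occurrences of `H(X₀,X₂)` cancel, and `H(X₀,X₁,X₂,Y) -
H(X₀,X₁,X₂)` is the average channel entropy, because the output law depends on `X₁` alone. -/
lemma condMutualInfo_sub_mutualInfo (Γ : B → PMF D) (p : A × B × C → ℝ) (Q : PMF (A × B × C × D))
    (hQ : ∀ v, (Q v).toReal = jointWeight Γ p v) :
    condMutualInfo Q (fun v => v.2.1) (fun v => v.2.2.2) (fun v => (v.1, v.2.2.1)) -
      mutualInfo Q (fun v => v.1) (fun v => v.2.2.1) = informationSlack Γ p := by
  simp only [condMutualInfo, mutualInfo, condEntropy, entropy_eq_weightEntropy, informationSlack,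
    condWeightEntropy]
  have hQ' : (fun v => (Q v).toReal) = jointWeight Γ p := funext hQ
  rw [hQ']
  have h1 := weightEntropy_jointWeight_comp Γ p (fun a => a.1)
  have h2 : weightEntropy (jointWeight Γ p) (fun ω => (ω.2.1, ω.2.2.2, ω.1, ω.2.2.1)) =
      weightEntropy (jointWeight Γ p) (fun v => v) :=
    weightEntropy_congr _ fun v w => by simp only [Prod.ext_iff]; tauto
  have h3 : weightEntropy (jointWeight Γ p) (fun ω => (ω.2.1, ω.1, ω.2.2.1)) =
      weightEntropy (jointWeight Γ p) (fun v => (v.1, v.2.1, v.2.2.1)) :=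
    weightEntropy_congr _ fun v w => by simp only [Prod.ext_iff]; tauto
  have h4 : weightEntropy (jointWeight Γ p) (fun ω => (ω.2.2.2, ω.1, ω.2.2.1)) =
      weightEntropy (jointWeight Γ p) (fun ω => ((ω.1, ω.2.2.2), ω.2.2.1)) :=
    weightEntropy_congr _ fun v w => by simp only [Prod.ext_iff]; tauto
  have h5 := weightEntropy_jointWeight_comp Γ p (fun a => a)
  rw [h2, h3, h4, weightEntropy_jointWeight_id, h5, h1]
  ring

lemma informationConstraint_iff (Γ : B → PMF D) (Qbar : PMF (A × B × C)) :
    InformationConstraint Γ Qbar ↔ 0 ≤ informationSlack Γ (fun a => (Qbar a).toReal) := by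
  constructor
  · rintro ⟨Q, hQ, h⟩
    rw [← condMutualInfo_sub_mutualInfo Γ _ Q]
    · linarith
    · rintro ⟨a, b, c, d⟩
      simp [hQ, jointWeight]
  · intro h
    have hsum : ∑ v : A × B × C × D, Qbar (v.1, v.2.1, v.2.2.1) * Γ v.2.1 v.2.2.2 = 1 := by
      simp only [Fintype.sum_prod_type, ← Finset.mul_sum]
      have h1 : ∀ b, ∑ d, Γ b d = 1 := fun b => by
        rw [← tsum_fintype (L := .unconditional _), (Γ b).tsum_coe]
      have h2 : ∑ a, Qbar a = 1 := by
        rw [← tsum_fintype (L := .unconditional _), Qbar.tsum_coe]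
      simpa [h1, Fintype.sum_prod_type] using h2
    refine ⟨PMF.ofFintype _ hsum, fun x₀ x₁ x₂ y => by simp, ?_⟩
    rw [← condMutualInfo_sub_mutualInfo Γ _ (PMF.ofFintype _ hsum)] at h
    · linarith
    · rintro ⟨a, b, c, d⟩
      simp [jointWeight]

/-- The form used for continuity: `Real.negMulLog` is continuous at `0`, unlike the logarithms in
`weightEntropy`. -/
lemma informationSlack_eq_negMulLog (Γ : B → PMF D) (p : A × B × C → ℝ) :
    informationSlack Γ p =
      ∑ z, Real.negMulLog (marginal (jointWeight Γ p) (fun v => ((v.1, v.2.2.2), v.2.2.1)) z) -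
      ∑ c, Real.negMulLog (marginal (jointWeight Γ p) (fun v => v.2.2.1) c) -
      ∑ a, Real.negMulLog (marginal p (fun a => a.1) a) - ∑ a, p a * channelEntropy Γ a.2.1 := by
  simp only [informationSlack, condWeightEntropy, weightEntropy_eq_sum_negMulLog]

lemma continuous_marginal {X Ω E : Type*} [Fintype Ω] [TopologicalSpace X] {q : X → Ω → ℝ}
    (hq : ∀ ω, Continuous fun x => q x ω) (U : Ω → E) (e : E) :
    Continuous fun x => marginal (q x) U e := by
  unfold marginal
  refine continuous_finsetSum _ fun ω _ => ?_
  split_ifs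
  · exact hq ω
  · exact continuous_const

lemma continuous_informationSlack (Γ : B → PMF D) :
    Continuous (informationSlack (A := A) (C := C) Γ) := by
  have hj : ∀ v, Continuous fun p : A × B × C → ℝ => jointWeight Γ p v := fun v =>
    (continuous_apply _).mul continuous_const
  rw [funext (informationSlack_eq_negMulLog Γ)]
  refine ((Continuous.sub ?_ ?_).sub ?_).sub ?_
  · exact continuous_finsetSum _ fun z _ =>
      Real.continuous_negMulLog.comp (continuous_marginal hj _ z)
  · exact continuous_finsetSum _ fun z _ =>
      Real.continuous_negMulLog.comp (continuous_marginal hj _ z)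
  · exact continuous_finsetSum _ fun z _ =>
      Real.continuous_negMulLog.comp (continuous_marginal (fun ω => continuous_apply ω) _ z)
  · exact continuous_finsetSum _ fun z _ => (continuous_apply z).mul continuous_const

/-- The common state marginal is essential: `-H(X₀)` is convex, and is harmless only because it is
the same for all components and for the mixture. -/
lemma sum_mul_informationSlack_le {ι : Type*} [Fintype ι] (Γ : B → PMF D) (w : ι → ℝ)
    (hw : ∀ i, 0 ≤ w i) (hw1 : ∑ i, w i = 1) (p : ι → A × B × C → ℝ) (hp : ∀ i a, 0 ≤ p i a)
    (ρ : A → ℝ) (hρ : ∀ i, marginal (p i) (fun a => a.1) = ρ) :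
    ∑ i, w i * informationSlack Γ (p i) ≤ informationSlack Γ (fun a => ∑ i, w i * p i a) := by
  have h := sum_mul_condWeightEntropy_le w hw (fun i => jointWeight Γ (p i))
    (fun i => jointWeight_nonneg Γ (hp i)) (fun v => (v.1, v.2.2.2)) (fun v => v.2.2.1)
  have h1 : marginal (fun a => ∑ i, w i * p i a) (fun a => a.1) = ρ := by
    funext a
    rw [marginal_sum]
    simp_rw [marginal_const_mul, hρ, ← Finset.sum_mul, hw1, one_mul]
  have h2 : ∑ a, (∑ i, w i * p i a) * channelEntropy Γ a.2.1 =
      ∑ i, w i * ∑ a, p i a * channelEntropy Γ a.2.1 := by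
    simp_rw [Finset.sum_mul, Finset.mul_sum, mul_assoc]
    exact Finset.sum_comm
  simp only [informationSlack, weightEntropy_eq_sum_negMulLog (A := A), h1, hρ, jointWeight_sum, h2,
    mul_sub, Finset.sum_sub_distrib, ← Finset.sum_mul, hw1, one_mul]
  linarith

end Slack

/-! ### Independence of coordinates under product weights -/

section ProductWeights

open scoped Classical

variable {ι E : Type*} [Fintype ι] [DecidableEq ι] [Fintype E]

lemma sum_prod_weight_eq_one {w : ι → E → ℝ} (hw : ∀ i, ∑ e, w i e = 1) :
    ∑ y : ι → E, ∏ i, w i (y i) = 1 := by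
  have := Finset.prod_univ_sum (fun _ : ι => (Finset.univ : Finset E)) w
  simp only [Fintype.piFinset_univ] at this
  rw [← this]
  simp [hw]

/-- Under product weights, a coordinate is independent of the functions of the other ones. -/
lemma sum_prod_weight_ite {w : ι → E → ℝ} (i : ι) (hw : ∑ e, w i e = 1) (g : (ι → E) → ℝ)
    (hg : ∀ y e, g (Function.update y i e) = g y) (d : E) :
    ∑ y : ι → E, (if y i = d then (∏ j, w j (y j)) * g y else 0) =
      w i d * ∑ y : ι → E, (∏ j, w j (y j)) * g y := by
  have hu : ∀ (y : ι → E) e, (∏ j, w j (Function.update y i e j)) * w i (y i) =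
      (∏ j, w j (y j)) * w i e := by
    intro y e
    rw [← Finset.mul_prod_erase Finset.univ (fun j => w j (y j)) (Finset.mem_univ i),
      ← Finset.mul_prod_erase Finset.univ (fun j => w j (Function.update y i e j))
        (Finset.mem_univ i)]
    have : ∏ j ∈ Finset.univ.erase i, w j (Function.update y i e j) =
        ∏ j ∈ Finset.univ.erase i, w j (y j) :=
      Finset.prod_congr rfl fun j hj => by
        rw [Function.update_of_ne (Finset.ne_of_mem_erase hj)]
    rw [this, Function.update_self]
    ring
  -- Adjoin an independent copy of coordinate `i` and exchange it with the original one: the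
  -- exchange preserves the product weight and, by `hg`, the value of `g`.
  let σ : (ι → E) × E → (ι → E) × E := fun t => (Function.update t.1 i t.2, t.1 i)
  have hσ : Function.Involutive σ := by
    rintro ⟨y, e⟩
    simp [σ]
  calc _ = ∑ t : (ι → E) × E, (if t.1 i = d then (∏ j, w j (t.1 j)) * w i t.2 * g t.1 else 0) := by
        rw [Fintype.sum_prod_type]
        refine Finset.sum_congr rfl fun y _ => ?_
        split_ifs
        · simp only
          rw [← Finset.sum_mul, ← Finset.mul_sum, hw, mul_one]
        · simp
    _ = ∑ t : (ι → E) × E, (if t.2 = d then (∏ j, w j (t.1 j)) * w i t.2 * g t.1 else 0) := by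
        rw [← Equiv.sum_comp hσ.toPerm]
        refine Finset.sum_congr rfl fun t _ => ?_
        simp only [Function.Involutive.coe_toPerm, σ, Function.update_self, hu, hg]
    _ = _ := by
        rw [Fintype.sum_prod_type, Finset.mul_sum]
        refine Finset.sum_congr rfl fun y _ => ?_
        simp
        ring

end ProductWeights

/-! ### The converse over a finite horizon -/

section Converse

open scoped Classical

variable {A B C D : Type*} [Fintype A] [Fintype B] [Fintype C] [Fintype D] {T : ℕ}

/-- The weights of the states, the inputs and the outputs of a memoryless channel. -/
noncomputable def historyWeight (Γ : B → PMF D) (u : (Fin T → A) × (Fin T → B) → ℝ)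
    (ω : (Fin T → A) × (Fin T → B) × (Fin T → D)) : ℝ :=
  u (ω.1, ω.2.1) * ∏ j, (Γ (ω.2.1 j) (ω.2.2 j)).toReal

lemma historyWeight_nonneg {A B D : Type*} {T : ℕ} (Γ : B → PMF D)
    {u : (Fin T → A) × (Fin T → B) → ℝ}
    (hu : ∀ t, 0 ≤ u t) (ω : (Fin T → A) × (Fin T → B) × (Fin T → D)) :
    0 ≤ historyWeight Γ u ω :=
  mul_nonneg (hu _) (Finset.prod_nonneg fun _ _ => ENNReal.toReal_nonneg)

lemma marginal_historyWeight (Γ : B → PMF D) (u : (Fin T → A) × (Fin T → B) → ℝ) :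
    marginal (historyWeight Γ u) (fun ω => (ω.1, ω.2.1)) = u := by
  funext ⟨x, b⟩
  simp only [marginal, historyWeight, Fintype.sum_prod_type, Prod.mk.injEq]
  rw [Finset.sum_eq_single x (by simp +contextual) (by simp),
    Finset.sum_eq_single b (by simp +contextual) (by simp)]
  simp only [and_self, if_true]
  rw [← Finset.mul_sum, sum_prod_weight_eq_one (w := fun j e => (Γ (b j) e).toReal)
    fun j => PMF.sum_toReal (Γ (b j)), mul_one]

/-- The state and the actions at stage `i`. -/
def stageTriple (act : (Fin T → A) → (Fin T → D) → Fin T → C) (i : Fin T)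
    (ω : (Fin T → A) × (Fin T → B) × (Fin T → D)) : A × B × C :=
  (ω.1 i, ω.2.1 i, act ω.1 ω.2.2 i)

/-- The action of decision-maker 2 at stage `i` is decided before `y i` is observed, so `y i` is
drawn from `Γ` independently of the rest of the triple, given the input. -/
lemma marginal_historyWeight_stage {C : Type*} (Γ : B → PMF D) (u : (Fin T → A) × (Fin T → B) → ℝ)
    (act : (Fin T → A) → (Fin T → D) → Fin T → C) (i : Fin T)
    (hact : ∀ x y y', (∀ j < i, y j = y' j) → act x y i = act x y' i) :
    marginal (historyWeight Γ u) (fun ω => (ω.1 i, ω.2.1 i, act ω.1 ω.2.2 i, ω.2.2 i)) =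
      jointWeight Γ (marginal (historyWeight Γ u) (stageTriple act i)) := by
  funext ⟨a, b, c, d⟩
  simp only [marginal, jointWeight, historyWeight, Fintype.sum_prod_type, Prod.mk.injEq,
    stageTriple, Finset.sum_mul]
  refine Finset.sum_congr rfl fun x _ => Finset.sum_congr rfl fun b' _ => ?_
  by_cases hb : x i = a ∧ b' i = b
  · obtain ⟨rfl, rfl⟩ := hb
    have h := sum_prod_weight_ite (w := fun j e => (Γ (b' j) e).toReal) i (PMF.sum_toReal _)
      (fun y => if act x y i = c then u (x, b') else 0) (fun y e => by
        simp only [hact x (Function.update y i e) y fun j hj =>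
          Function.update_of_ne hj.ne _ _]) d
    rw [Finset.mul_sum] at h
    refine Eq.trans (Finset.sum_congr rfl fun y _ => ?_)
      (h.trans (Finset.sum_congr rfl fun y _ => ?_))
    · by_cases h1 : act x y i = c <;> by_cases h2 : y i = d <;> simp [h1, h2, mul_comm]
    · by_cases h1 : act x y i = c
      · simp [h1]; ring
      · simp [h1]
  · refine Finset.sum_congr rfl fun y _ => ?_
    rw [if_neg (by tauto), if_neg (by tauto), zero_mul]

/-- The first `k` entries of a finite sequence. -/
def truncate {E : Type*} (k : ℕ) (x : Fin T → E) (j : Fin T) : Option E :=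
  if (j : ℕ) < k then some (x j) else none

/-- Prefixes are encoded with `Option` so that those of all lengths have one type, which lets the
chain rule run over `k`. -/
lemma truncate_eq_iff {E : Type*} {k : ℕ} {x x' : Fin T → E} :
    truncate k x = truncate k x' ↔ ∀ j : Fin T, (j : ℕ) < k → x j = x' j := by
  rw [funext_iff]
  refine forall_congr' fun j => ?_
  by_cases h : (j : ℕ) < k <;> simp [truncate, h]

lemma truncate_succ_eq_iff {E : Type*} {i : Fin T} {x x' : Fin T → E} :
    truncate (i + 1) x = truncate (i + 1) x' ↔ x i = x' i ∧ truncate i x = truncate i x' := by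
  simp only [truncate_eq_iff]
  refine ⟨fun h => ⟨h i (Nat.lt_succ_self _), fun j hj => h j (Nat.lt_succ_of_lt hj)⟩,
    fun h j hj => ?_⟩
  rcases Nat.lt_succ_iff_lt_or_eq.1 hj with h' | h'
  · exact h.2 j h'
  · rw [Fin.ext h']; exact h.1

/-- Chain rule over the stages: each increment of entropy is conditioned on the whole past, which
determines the action of decision-maker 2, so conditioning on that action alone gives a larger
value. -/
lemma weightEntropy_history_le (q : (Fin T → A) × (Fin T → B) × (Fin T → D) → ℝ)
    (hq : ∀ ω, 0 ≤ q ω) (hq1 : ∑ ω, q ω = 1)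
    (act : (Fin T → A) → (Fin T → D) → Fin T → C)
    (hact : ∀ i x x' y y', (∀ j < i, x j = x' j) → (∀ j < i, y j = y' j) →
      act x y i = act x' y' i) :
    weightEntropy q (fun ω => (ω.1, ω.2.2)) ≤
      ∑ i, condWeightEntropy q (fun ω => (ω.1 i, ω.2.2 i)) (fun ω => act ω.1 ω.2.2 i) := by
  let H : ℕ → ℝ := fun k => weightEntropy q (fun ω => (truncate k ω.1, truncate k ω.2.2))
  have h0 : H 0 = 0 := by
    simp only [H, weightEntropy, marginal]
    have : ∀ ω ω' : (Fin T → A) × (Fin T → B) × (Fin T → D),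
        ((truncate 0 ω'.1, truncate 0 ω'.2.2) = (truncate 0 ω.1, truncate 0 ω.2.2)) ↔ True := by
      intro ω ω'
      simp [Prod.mk.injEq, truncate_eq_iff]
    simp [this, hq1]
  have hT : H T = weightEntropy q (fun ω => (ω.1, ω.2.2)) :=
    weightEntropy_congr q fun ω ω' => by
      simp only [Prod.mk.injEq, truncate_eq_iff, Fin.is_lt, true_imp_iff]
      rw [← funext_iff, ← funext_iff]
  have hstep : ∀ i : Fin T, H (i + 1) - H i ≤
      condWeightEntropy q (fun ω => (ω.1 i, ω.2.2 i)) (fun ω => act ω.1 ω.2.2 i) := by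
    intro i
    refine le_trans (le_of_eq ?_) (condWeightEntropy_le_of_determines hq _
      (fun ω => (truncate i ω.1, truncate i ω.2.2)) _ ?_)
    · simp only [H, condWeightEntropy]
      congr 1
      refine weightEntropy_congr q fun ω ω' => ?_
      simp only [Prod.mk.injEq, truncate_succ_eq_iff, truncate_eq_iff]
      tauto
    · intro ω ω' h
      simp only [Prod.mk.injEq, truncate_eq_iff] at h
      exact hact i _ _ _ _ (fun j hj => h.1 j hj) (fun j hj => h.2 j hj)
  rw [← hT, ← sub_zero (H T), ← h0, ← Finset.sum_range_sub H T, Finset.sum_range]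
  exact Finset.sum_le_sum fun i _ => hstep i

/-- The logarithm of the weight splits into the part of states and inputs and one term for each use
of the channel; the mean of the latter is a channel entropy. -/
lemma weightEntropy_historyWeight_all (Γ : B → PMF D) {u : (Fin T → A) × (Fin T → B) → ℝ}
    (hu : ∀ t, 0 ≤ u t) :
    weightEntropy (historyWeight Γ u) (fun ω => ω) =
      weightEntropy (historyWeight Γ u) (fun ω => (ω.1, ω.2.1)) +
        ∑ i, ∑ b, marginal (historyWeight Γ u) (fun ω => ω.2.1 i) b * channelEntropy Γ b := by
  have hi : ∀ i : Fin T, ∑ b, marginal (historyWeight Γ u) (fun ω => ω.2.1 i) b *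
      channelEntropy Γ b = -∑ ω, historyWeight Γ u ω *
        Real.log (Γ (ω.2.1 i) (ω.2.2 i)).toReal := by
    intro i
    -- With a one-point action set, the stage law reduces to the state, the input and the output.
    have h := marginal_historyWeight_stage Γ u (fun _ _ _ => ()) i (by simp)
    rw [← sum_marginal_mul (historyWeight Γ u) (fun ω => (ω.1 i, ω.2.1 i, (), ω.2.2 i))
      (fun t => Real.log (Γ t.2.1 t.2.2.2).toReal), h,
      sum_marginal_mul (historyWeight Γ u) (fun ω => ω.2.1 i) (channelEntropy Γ)]
    have h' := sum_marginal_mul (historyWeight Γ u) (stageTriple (fun _ _ _ => ()) i)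
        (fun t => channelEntropy Γ t.2.1)
    refine h'.symm.trans ?_
    simp only [Fintype.sum_prod_type, jointWeight, channelEntropy, Real.negMulLog,
      Finset.mul_sum, ← Finset.sum_neg_distrib]
    refine Finset.sum_congr rfl fun a _ => Finset.sum_congr rfl fun b _ =>
      Finset.sum_congr rfl fun c _ => Finset.sum_congr rfl fun d _ => by ring
  simp_rw [hi]
  rw [Finset.sum_neg_distrib, Finset.sum_comm]
  simp only [weightEntropy, marginal_id, marginal_historyWeight, ← Finset.mul_sum]
  rw [← neg_add, ← Finset.sum_add_distrib]
  congr 1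
  refine Finset.sum_congr rfl fun ω _ => ?_
  rcases (historyWeight_nonneg Γ hu ω).eq_or_lt with h | h
  · simp [← h]
  · have h' : u (ω.1, ω.2.1) * ∏ j, (Γ (ω.2.1 j) (ω.2.2 j)).toReal ≠ 0 := h.ne'
    rw [← mul_add, ← Real.log_prod fun j _ => (Finset.prod_ne_zero_iff.1 (right_ne_zero_of_mul h'))
      j (Finset.mem_univ _), ← Real.log_mul (left_ne_zero_of_mul h') (right_ne_zero_of_mul h')]
    rfl

/-- Over a finite horizon, the averaged stage distribution has nonnegative slack. -/
lemma informationSlack_average_nonneg (Γ : B → PMF D) (hT : 0 < T) (ρ : PMF A)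
    {u : (Fin T → A) × (Fin T → B) → ℝ} (hu : ∀ t, 0 ≤ u t)
    (huρ : ∀ x, ∑ b, u (x, b) = ∏ j, (ρ (x j)).toReal)
    (act : (Fin T → A) → (Fin T → D) → Fin T → C)
    (hact : ∀ i x x' y y', (∀ j < i, x j = x' j) → (∀ j < i, y j = y' j) →
      act x y i = act x' y' i) :
    0 ≤ informationSlack Γ (fun a => ∑ i : Fin T, (1 / (T : ℝ)) *
      marginal (historyWeight Γ u) (stageTriple act i) a) := by
  set q := historyWeight Γ u with hq_def
  have hq : ∀ ω, 0 ≤ q ω := historyWeight_nonneg Γ hu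
  have hx : marginal q (fun ω => ω.1) = fun x => ∏ j, (ρ (x j)).toReal := by
    have h := marginal_comp q (fun ω => (ω.1, ω.2.1)) Prod.fst
    rw [marginal_historyWeight] at h
    rw [← h]
    funext x
    rw [← huρ x]
    simp only [marginal, Fintype.sum_prod_type]
    rw [Finset.sum_eq_single x] <;> simp +contextual
  have hq1 : ∑ ω, q ω = 1 := by
    rw [← sum_marginal q (fun ω => ω.1), hx]
    exact sum_prod_weight_eq_one (w := fun _ a => (ρ a).toReal) fun _ => PMF.sum_toReal ρ
  have hxi : ∀ i : Fin T, marginal q (fun ω => ω.1 i) = fun a => (ρ a).toReal := by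
    intro i
    rw [← marginal_comp q (fun ω => ω.1) (fun x => x i), hx]
    funext a
    have h := sum_prod_weight_ite (w := fun (_ : Fin T) a => (ρ a).toReal) i (PMF.sum_toReal ρ)
      (fun _ => 1) (fun _ _ => rfl) a
    simp only [mul_one] at h
    rw [sum_prod_weight_eq_one (w := fun (_ : Fin T) a => (ρ a).toReal)
      fun _ => PMF.sum_toReal ρ, mul_one] at h
    exact h
  have hact' : ∀ (i : Fin T) x y y', (∀ j < i, y j = y' j) → act x y i = act x y' i :=
    fun i x y y' h => hact i x x y y' (fun _ _ => rfl) h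
  -- the slack of a stage, in terms of the whole history
  have hslack : ∀ i, informationSlack Γ (marginal q (stageTriple act i)) =
      condWeightEntropy q (fun ω => (ω.1 i, ω.2.2 i)) (fun ω => act ω.1 ω.2.2 i) -
        ∑ a, Real.negMulLog (ρ a).toReal -
        ∑ b, marginal q (fun ω => ω.2.1 i) b * channelEntropy Γ b := by
    intro i
    have h1 := marginal_historyWeight_stage Γ u act i (hact' i)
    rw [informationSlack, condWeightEntropy, hq_def, ← h1, ← hq_def]
    simp only [weightEntropy_marginal]
    rw [weightEntropy_eq_sum_negMulLog q (fun ω => (stageTriple act i ω).1)]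
    have h2 : marginal q (fun ω => (stageTriple act i ω).1) = fun a => (ρ a).toReal := hxi i
    rw [h2, sum_marginal_mul, sum_marginal_mul]
    rfl
  have hrho : weightEntropy q (fun ω => ω.1) = T * ∑ a, Real.negMulLog (ρ a).toReal := by
    have h1 : ∀ i : Fin T, ∑ a, Real.negMulLog (ρ a).toReal =
        -∑ ω, q ω * Real.log (ρ (ω.1 i)).toReal := by
      intro i
      rw [← sum_marginal_mul q (fun ω => ω.1 i) fun a => Real.log (ρ a).toReal, hxi i]
      simp [Real.negMulLog]
    have h2 : (T : ℝ) * ∑ a, Real.negMulLog (ρ a).toReal =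
        ∑ _i : Fin T, ∑ a, Real.negMulLog (ρ a).toReal := by simp
    rw [h2, Finset.sum_congr rfl fun i _ => h1 i, Finset.sum_neg_distrib, Finset.sum_comm,
      weightEntropy]
    congr 1
    refine Finset.sum_congr rfl fun ω _ => ?_
    rw [← Finset.mul_sum]
    rcases (hq ω).eq_or_lt with h | h
    · simp [← h]
    · have h3 := marginal_pos hq (fun ω => ω.1) h
      rw [hx] at h3 ⊢
      rw [Real.log_prod fun j _ => (Finset.prod_ne_zero_iff.1 h3.ne') j (Finset.mem_univ _)]
  -- `H(Y|X₀) ≥ H(Y|X₀,X₁)` for whole sequences. With `weightEntropy_historyWeight_all` this bounds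
  -- the entropy of states and outputs below by `T H(ρ)` plus the channel entropies.
  have hlow := weightEntropy_submodular hq (fun ω => ω.2.2) (fun ω => ω.2.1) (fun ω => ω.1)
  have e1 : weightEntropy q (fun ω => (ω.2.2, ω.2.1, ω.1)) = weightEntropy q (fun ω => ω) :=
    weightEntropy_congr q fun ω ω' => by simp only [Prod.ext_iff]; tauto
  have e2 : weightEntropy q (fun ω => (ω.2.1, ω.1)) = weightEntropy q (fun ω => (ω.1, ω.2.1)) :=
    weightEntropy_congr q fun ω ω' => by simp only [Prod.ext_iff]; tauto
  have e3 : weightEntropy q (fun ω => (ω.2.2, ω.1)) = weightEntropy q (fun ω => (ω.1, ω.2.2)) :=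
    weightEntropy_congr q fun ω ω' => by simp only [Prod.ext_iff]; tauto
  rw [e1, e2, e3, hrho, hq_def, weightEntropy_historyWeight_all Γ hu, ← hq_def] at hlow
  have hup := weightEntropy_history_le q hq hq1 act hact
  have hsum : 0 ≤ ∑ i, informationSlack Γ (marginal q (stageTriple act i)) := by
    simp only [hslack, Finset.sum_sub_distrib, Finset.sum_const, Finset.card_univ,
      Fintype.card_fin, nsmul_eq_mul]
    linarith
  -- Every stage has state marginal `ρ`, so concavity passes from the mean of the slacks to the
  -- slack of the averaged law.
  refine le_trans ?_ (sum_mul_informationSlack_le Γ (fun _ : Fin T => 1 / (T : ℝ))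
    (fun _ => by positivity) ?_ _ (fun i => marginal_nonneg hq _) (fun a => (ρ a).toReal) ?_)
  · rw [← Finset.mul_sum]
    positivity
  · have : (T : ℝ) ≠ 0 := by positivity
    simp [this]
  · intro i
    rw [marginal_comp]
    exact hxi i

end Converse

/-! ### From infinite product measures to finite sums; the converse -/

section FiniteDimensional

open scoped Classical

/-- Serves both for the first `T` stages and, with a shifted `f`, for a single block. -/
lemma infinitePi_window {E : Type*} [Fintype E] [MeasurableSpace E] [DiscreteMeasurableSpace E]
    (P : ℕ → PMF E) {ι : Type*} [Fintype ι] [DecidableEq ι] {f : ι → ℕ} (hf : Function.Injective f)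
    (S : Set (ι → E)) :
    Measure.infinitePi (fun i => (P i).toMeasure) {y | (fun j => y (f j)) ∈ S} =
      ∑ w : ι → E, if w ∈ S then ∏ j, P (f j) (w j) else 0 := by
  have hS : MeasurableSet S := S.toFinite.measurableSet
  have hm : Measurable fun (y : ℕ → E) (j : ι) => y (f j) := by fun_prop
  have h1 : {y : ℕ → E | (fun j => y (f j)) ∈ S} = (fun (y : ℕ → E) (j : ι) => y (f j)) ⁻¹' S := rfl
  rw [h1, ← Measure.map_apply hm hS, Measure.map_infinitePi_infinitePi_of_inj hf,
    ← Set.coe_toFinset S, ← sum_measure_singleton, Set.coe_toFinset, ← Finset.sum_filter]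
  refine Finset.sum_congr (by ext; simp) fun w _ => ?_
  rw [Measure.infinitePi_singleton_of_fintype]
  refine Finset.prod_congr rfl fun j _ => ?_
  rw [PMF.toMeasure_apply_singleton _ _ (measurableSet_singleton _)]

lemma lintegral_comp_fintype {Ω G : Type*} [MeasurableSpace Ω] [Fintype G] [MeasurableSpace G]
    [MeasurableSingletonClass G] (μ : Measure Ω) {g : Ω → G} (hg : Measurable g) (Φ : G → ℝ≥0∞) :
    ∫⁻ x, Φ (g x) ∂μ = ∑ t, Φ t * μ {x | g x = t} := by
  rw [← lintegral_map (f := Φ) (measurable_of_finite Φ) hg, lintegral_fintype]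
  refine Finset.sum_congr rfl fun t _ => ?_
  rw [Measure.map_apply hg (measurableSet_singleton t)]
  rfl

end FiniteDimensional

namespace StrategyPair

variable {X₀ X₁ X₂ Y : Type*} [MeasurableSpace X₀] [MeasurableSpace X₁]

lemma measurable_action₁ [Fintype X₁] [DiscreteMeasurableSpace X₁] (s : StrategyPair X₀ X₁ X₂ Y)
    (i : ℕ) : Measurable fun x₀ => s.action₁ x₀ i := by
  induction i using Nat.strong_induction_on with
  | _ i ih =>
    have h1 : Measurable fun x₀ : ℕ → X₀ => fun j : Fin i => s.action₁ x₀ j :=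
      measurable_pi_lambda _ fun j => ih j j.isLt
    have h2 : Measurable fun t : (ℕ → X₀) × (Fin i → X₁) => s.σ i t.1 t.2 :=
      measurable_from_prod_countable_left fun h => s.measurable_σ i h
    have h3 : (fun x₀ => s.action₁ x₀ i) =
        fun x₀ => s.σ i x₀ fun j : Fin i => s.action₁ x₀ j := by
      funext x₀; rw [action₁]
    rw [h3]
    exact h2.comp (measurable_id.prodMk h1)

lemma action₂_congr (s : StrategyPair X₀ X₁ X₂ Y) (i : ℕ) {x x' : ℕ → X₀} {y y' : ℕ → Y}
    (hx : ∀ j < i, x j = x' j) (hy : ∀ j < i, y j = y' j) :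
    s.action₂ x y i = s.action₂ x' y' i := by
  induction i using Nat.strong_induction_on with
  | _ i ih =>
    rw [action₂, action₂]
    congr 1
    · exact funext fun j => hx j j.isLt
    · exact funext fun j => hy j j.isLt
    · exact funext fun j => ih j j.isLt (fun k hk => hx k (hk.trans j.isLt))
        (fun k hk => hy k (hk.trans j.isLt))

end StrategyPair

lemma marginal_forget_last {A B C D : Type*} [Fintype A] [Fintype B] [Fintype C] [Fintype D]
    (g : A × B × C × D → ℝ) (a : A) (b : B) (c : C) :
    marginal g (fun v => (v.1, v.2.1, v.2.2.1)) (a, b, c) = ∑ d, g (a, b, c, d) := by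
  simp only [marginal, Fintype.sum_prod_type, Prod.mk.injEq]
  rw [Finset.sum_eq_single a (by simp +contextual) (by simp),
    Finset.sum_eq_single b (by simp +contextual) (by simp),
    Finset.sum_eq_single c (by simp +contextual) (by simp)]
  simp

section StageLaw

open scoped Classical

/-- Extension of a finite sequence by an arbitrary value. -/
noncomputable def extendSeq {E : Type*} [Nonempty E] {T : ℕ} (x : Fin T → E) (j : ℕ) : E :=
  if h : j < T then x ⟨j, h⟩ else Classical.arbitrary E

lemma extendSeq_apply {E : Type*} [Nonempty E] {T : ℕ} (x : Fin T → E) {j : ℕ} (h : j < T) :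
    extendSeq x j = x ⟨j, h⟩ := dif_pos h

variable {A B C D : Type*} [Fintype A] [Fintype B] [Fintype C] [Fintype D]
  [MeasurableSpace A] [DiscreteMeasurableSpace A] [MeasurableSpace B] [DiscreteMeasurableSpace B]
  [MeasurableSpace D] [DiscreteMeasurableSpace D]

/-- The law of the states and the actions of decision-maker 1 in the first `T` stages. -/
noncomputable def StrategyPair.initialLaw (s : StrategyPair A B C D) (ρ : PMF A) (T : ℕ)
    (t : (Fin T → A) × (Fin T → B)) : ℝ≥0∞ :=
  Measure.infinitePi (fun _ : ℕ => ρ.toMeasure)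
    {x₀ | ((fun j : Fin T => x₀ j, fun j : Fin T => s.action₁ x₀ j) :
      (Fin T → A) × (Fin T → B)) = t}

/-- The actions of decision-maker 2 as functions of finite sequences. -/
noncomputable def StrategyPair.finiteAction₂ [Nonempty A] [Nonempty D]
    (s : StrategyPair A B C D) (T : ℕ) (x : Fin T → A) (y : Fin T → D) (i : Fin T) : C :=
  s.action₂ (extendSeq x) (extendSeq y) i

/-- The output event at stage `i` involves the observations up to `i` only, and the states and
inputs enter through their first `T` entries, which take finitely many values. The integral thus
becomes a sum over finite histories. -/
lemma StrategyPair.stageLaw_eq_sum {C : Type*} [Nonempty A] [Nonempty D] (s : StrategyPair A B C D)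
    (ρ : PMF A) (Γ : B → PMF D) {T : ℕ} (i : Fin T) (v : A × B × C × D) :
    s.stageLaw ρ Γ i v = ∑ t : (Fin T → A) × (Fin T → B), (∑ y : Fin T → D,
      if (t.1 i, t.2 i, s.finiteAction₂ T t.1 y i, y i) = v then ∏ j, Γ (t.2 j) (y j) else 0) *
        s.initialLaw ρ T t := by
  have hg : Measurable fun x₀ : ℕ → A =>
      ((fun j : Fin T => x₀ j, fun j : Fin T => s.action₁ x₀ j) : (Fin T → A) × (Fin T → B)) := by
    refine Measurable.prodMk (by fun_prop) (measurable_pi_lambda _ fun j => s.measurable_action₁ j)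
  unfold initialLaw
  rw [← lintegral_comp_fintype _ hg, stageLaw]
  refine lintegral_congr fun x₀ => ?_
  have h := infinitePi_window (fun j => Γ (s.action₁ x₀ j)) (Fin.val_injective (n := T))
    {y | (x₀ i, s.action₁ x₀ i, s.finiteAction₂ T (fun j => x₀ j) y i, y i) = v}
  rw [observationLaw]
  simp only [Set.mem_ofPred_eq] at h
  refine Eq.trans ?_ (h.trans (Finset.sum_congr rfl fun y _ => by congr))
  congr 1
  ext y
  have : s.finiteAction₂ T (fun j => x₀ j) (fun j => y j) i = s.action₂ x₀ y i :=
    s.action₂_congr i (fun j hj => extendSeq_apply _ (hj.trans i.isLt))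
      (fun j hj => extendSeq_apply _ (hj.trans i.isLt))
  simp only [Set.mem_ofPred_eq, this]

lemma StrategyPair.initialLaw_ne_top {A B C D : Type*} [MeasurableSpace A] [MeasurableSpace B]
    (s : StrategyPair A B C D) (ρ : PMF A) (T : ℕ) (t : (Fin T → A) × (Fin T → B)) :
    s.initialLaw ρ T t ≠ ∞ := measure_ne_top _ _

lemma StrategyPair.toReal_stageLaw {C : Type*} [Nonempty A] [Nonempty D] (s : StrategyPair A B C D)
    (ρ : PMF A) (Γ : B → PMF D) {T : ℕ} (i : Fin T) (v : A × B × C × D) :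
    (s.stageLaw ρ Γ i v).toReal = marginal (historyWeight Γ fun t => (s.initialLaw ρ T t).toReal)
      (fun ω => (ω.1 i, ω.2.1 i, s.finiteAction₂ T ω.1 ω.2.2 i, ω.2.2 i)) v := by
  have hprod : ∀ (b : Fin T → B) (y : Fin T → D), ∏ j, Γ (b j) (y j) ≠ ∞ := fun b y =>
    ENNReal.prod_ne_top fun j _ => PMF.apply_ne_top _ _
  have hfin : ∀ (t : (Fin T → A) × (Fin T → B)) (y : Fin T → D),
      (if (t.1 i, t.2 i, s.finiteAction₂ T t.1 y i, y i) = v then ∏ j, Γ (t.2 j) (y j) else 0) ≠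
        ∞ := fun t y => by split_ifs <;> simp [hprod]
  rw [s.stageLaw_eq_sum, ENNReal.toReal_sum fun t _ => ENNReal.mul_ne_top
    (ENNReal.sum_ne_top.2 fun y _ => hfin t y) (s.initialLaw_ne_top ρ T t)]
  simp only [marginal, historyWeight, Fintype.sum_prod_type]
  refine Finset.sum_congr rfl fun x _ => Finset.sum_congr rfl fun b _ => ?_
  rw [ENNReal.toReal_mul, ENNReal.toReal_sum fun y _ => hfin (x, b) y, Finset.sum_mul]
  refine Finset.sum_congr rfl fun y _ => ?_
  split_ifs
  · rw [ENNReal.toReal_prod, mul_comm]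
  · simp

lemma StrategyPair.sum_initialLaw {A B C D : Type*} [Fintype A] [MeasurableSpace A]
    [DiscreteMeasurableSpace A] [Fintype B] [MeasurableSpace B] [DiscreteMeasurableSpace B]
        (s : StrategyPair A B C D) (ρ : PMF A) {T : ℕ} (x : Fin T → A) :
    ∑ b, (s.initialLaw ρ T (x, b)).toReal = ∏ j, (ρ (x j)).toReal := by
  have h := infinitePi_window (fun _ => ρ) (Fin.val_injective (n := T)) {x}
  simp only [Set.mem_singleton_iff, Finset.sum_ite_eq', Finset.mem_univ, if_true] at h
  rw [← ENNReal.toReal_sum fun b _ => s.initialLaw_ne_top ρ T _, ← ENNReal.toReal_prod, ← h]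
  congr 1
  have hm : Measurable fun x₀ : ℕ → A => fun j : Fin T => s.action₁ x₀ j :=
    measurable_pi_lambda _ fun j => s.measurable_action₁ j
  have hx : MeasurableSet {x₀ : ℕ → A | (fun j : Fin T => x₀ j) = x} :=
    measurableSet_eq_fun (by fun_prop) measurable_const
  have h2 := measure_biUnion_finset (μ := Measure.infinitePi fun _ : ℕ => ρ.toMeasure)
    (s := (Finset.univ : Finset (Fin T → B)))
    (f := fun b => {x₀ | ((fun j : Fin T => x₀ j, fun j : Fin T => s.action₁ x₀ j) :
      (Fin T → A) × (Fin T → B)) = (x, b)}) ?_ ?_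
  · unfold initialLaw
    rw [← h2]
    congr 1
    ext x₀
    simp
  · intro b _ b' _ hbb'
    rw [Function.onFun, Set.disjoint_left]
    intro x₀ h1 h2
    simp only [Set.mem_ofPred_eq, Prod.mk.injEq] at h1 h2
    exact hbb' (h1.2.symm.trans h2.2)
  · intro b _
    have : {x₀ : ℕ → A | ((fun j : Fin T => x₀ j, fun j : Fin T => s.action₁ x₀ j) :
      (Fin T → A) × (Fin T → B)) = (x, b)} = {x₀ : ℕ → A | (fun j : Fin T => x₀ j) = x} ∩
        (fun x₀ : ℕ → A => fun j : Fin T => s.action₁ x₀ j) ⁻¹' {b} := by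
      ext; simp
    rw [this]
    exact hx.inter (hm (measurableSet_singleton b))

/-- The converse bound: every averaged stage distribution has nonnegative slack. -/
lemma StrategyPair.informationSlack_averageLaw_nonneg (s : StrategyPair A B C D)
    (ρ : PMF A) (Γ : B → PMF D) [Nonempty D] {T : ℕ} (hT : 0 < T) :
    0 ≤ informationSlack Γ (fun a : A × B × C => s.averageLaw ρ Γ T a.1 a.2.1 a.2.2) := by
  have : Nonempty A := ρ.support_nonempty.to_type
  have h := informationSlack_average_nonneg Γ hT ρ
    (u := fun t => (s.initialLaw ρ T t).toReal) (fun _ => ENNReal.toReal_nonneg)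
    (s.sum_initialLaw ρ) (s.finiteAction₂ T) (fun i x x' y y' hx hy => by
      refine s.action₂_congr i (fun j hj => ?_) fun j hj => ?_
      · rw [extendSeq_apply _ (hj.trans i.isLt), extendSeq_apply _ (hj.trans i.isLt)]
        exact hx _ hj
      · rw [extendSeq_apply _ (hj.trans i.isLt), extendSeq_apply _ (hj.trans i.isLt)]
        exact hy _ hj)
  convert h using 2
  funext ⟨a, b, c⟩
  rw [averageLaw, Finset.sum_range, Finset.mul_sum]
  refine Finset.sum_congr rfl fun i _ => ?_
  congr 1
  have h1 := marginal_comp (historyWeight Γ fun t => (s.initialLaw ρ T t).toReal)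
    (fun ω => (ω.1 i, ω.2.1 i, s.finiteAction₂ T ω.1 ω.2.2 i, ω.2.2 i))
    (fun v => (v.1, v.2.1, v.2.2.1))
  have h2 := congrFun h1 (a, b, c)
  refine Eq.trans ?_ h2
  simp only [s.toReal_stageLaw]
  exact (marginal_forget_last _ a b c).symm

/-- The averaged laws have nonnegative slack for every `T > 0`, and the slack is continuous, so the
limit inherits the sign. -/
lemma Implementable.informationConstraint {ρ : PMF A} {Γ : B → PMF D} {Qbar : PMF (A × B × C)}
    (h : Implementable ρ Γ Qbar) : InformationConstraint Γ Qbar := by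
  obtain ⟨s, hs⟩ := h
  have : Nonempty D := (Γ (Qbar.support_nonempty.choose).2.1).support_nonempty.to_type
  rw [informationConstraint_iff]
  have hlim : Tendsto (fun T : ℕ => fun a : A × B × C => s.averageLaw ρ Γ T a.1 a.2.1 a.2.2) atTop
      (𝓝 fun a => (Qbar a).toReal) := tendsto_pi_nhds.2 fun a => hs a.1 a.2.1 a.2.2
  refine ge_of_tendsto (((continuous_informationSlack Γ).tendsto _).comp hlim) ?_
  filter_upwards [eventually_gt_atTop 0] with T hT
  exact s.informationSlack_averageLaw_nonneg ρ Γ hT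

lemma FiniteHorizonImplementable.informationConstraint {ρ : PMF A} {Γ : B → PMF D}
    {Qbar : PMF (A × B × C)} (h : FiniteHorizonImplementable ρ Γ Qbar) :
    InformationConstraint Γ Qbar := by
  obtain ⟨s, -, hs⟩ := h
  have : Nonempty D := (Γ (Qbar.support_nonempty.choose).2.1).support_nonempty.to_type
  rw [informationConstraint_iff]
  have hlim : Tendsto (fun T : ℕ => fun a : A × B × C => (s T).averageLaw ρ Γ T a.1 a.2.1 a.2.2)
      atTop (𝓝 fun a => (Qbar a).toReal) := tendsto_pi_nhds.2 fun a => hs a.1 a.2.1 a.2.2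
  refine ge_of_tendsto (((continuous_informationSlack Γ).tendsto _).comp hlim) ?_
  filter_upwards [eventually_gt_atTop 0] with T hT
  exact (s T).informationSlack_averageLaw_nonneg ρ Γ hT

end StageLaw

/-! ### One-shot covering and packing -/

section OneShotCoding

open scoped Classical

/-- Greedy covering: a few points `c m` cover most of the mass. -/
lemma exists_covering {U V : Type*} [Fintype U] [Fintype V] (pU : U → ℝ) (pV : V → ℝ)
    (J : U → V → ℝ) (S : U → V → Prop) (L δ : ℝ) (hL : 1 ≤ L) (hU : ∀ u, 0 ≤ pU u)
    (hV : ∀ v, 0 ≤ pV v) (hJ : ∀ u v, 0 ≤ J u v) (hU1 : ∑ u, pU u = 1) (hV1 : ∑ v, pV v = 1)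
    (hJU : ∀ u, ∑ v, J u v = pU u) (hS : ∀ u v, S u v → J u v ≤ L * (pU u * pV v))
    (hδ : ∑ u, ∑ v, (if S u v then 0 else J u v) ≤ δ) (K : ℕ) :
    ∃ c : ℕ → V, ∑ u, (if ∃ m < K, S u (c m) then 0 else pU u) ≤ δ + Real.exp (-(K / L)) := by
  have hL0 : 0 < L := by linarith
  have hVne : Nonempty V := by
    by_contra h
    rw [not_nonempty_iff] at h
    simp at hV1
  have hδ0 : 0 ≤ δ := le_trans (Finset.sum_nonneg fun u _ => Finset.sum_nonneg fun v _ => by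
    split_ifs <;> simp [hJ]) hδ
  -- The induction carries a contraction: each new point multiplies the excess over `δ` of the
  -- uncovered mass by at most `1 - 1 / L`.
  suffices h : ∃ c : ℕ → V, ∑ u, (if ∃ m < K, S u (c m) then 0 else pU u) ≤
      δ + (1 - 1 / L) ^ K by
    obtain ⟨c, hc⟩ := h
    refine ⟨c, hc.trans (add_le_add le_rfl ?_)⟩
    have h1 : 1 - 1 / L ≤ Real.exp (-(1 / L)) := by
      have := Real.add_one_le_exp (-(1 / L)); linarith
    have h0 : 0 ≤ 1 - 1 / L := by
      have : 1 / L ≤ 1 := by rw [div_le_one hL0]; exact hL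
      linarith
    calc (1 - 1 / L) ^ K ≤ Real.exp (-(1 / L)) ^ K := pow_le_pow_left₀ h0 h1 K
      _ = Real.exp (-(K / L)) := by rw [← Real.exp_nat_mul]; congr 1; ring
  induction K with
  | zero => exact ⟨fun _ => Classical.arbitrary V, by simp [hU1, hδ0]⟩
  | succ K ih =>
    obtain ⟨c, hc⟩ := ih
    set un : U → ℝ := fun u => if ∃ m < K, S u (c m) then 0 else pU u with hun
    have hun0 : ∀ u, 0 ≤ un u := fun u => by simp only [hun]; split_ifs <;> simp [hU]
    have hunle : ∀ u, un u ≤ pU u := fun u => by simp only [hun]; split_ifs <;> simp [hU]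
    -- the average gain of a new point
    have hgain : ∑ u, un u - δ ≤ L * ∑ v, pV v * ∑ u, (if S u v then un u else 0) := by
      have h1 : ∀ u, un u - ∑ v, (if S u v then 0 else J u v) ≤
          L * ∑ v, pV v * (if S u v then un u else 0) := by
        intro u
        by_cases hcov : ∃ m < K, S u (c m)
        · have : un u = 0 := by simp only [hun]; rw [if_pos hcov]
          rw [this]
          simp only [ite_self, mul_zero, Finset.sum_const_zero, zero_sub, Left.neg_nonpos_iff]
          exact Finset.sum_nonneg fun v _ => by split_ifs <;> simp [hJ]
        · have : un u = pU u := by simp only [hun]; rw [if_neg hcov]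
          rw [this, ← hJU u, ← Finset.sum_sub_distrib, hJU u, Finset.mul_sum]
          refine Finset.sum_le_sum fun v _ => ?_
          split_ifs with hs
          · have := hS u v hs
            linarith
          · simp
      have h2 := Finset.sum_le_sum fun u (_ : u ∈ Finset.univ) => h1 u
      have h3 : ∑ u, ∑ v, pV v * (if S u v then un u else 0) =
          ∑ v, pV v * ∑ u, (if S u v then un u else 0) := by
        rw [Finset.sum_comm]
        simp_rw [Finset.mul_sum]
      rw [Finset.sum_sub_distrib, ← Finset.mul_sum, h3] at h2
      linarith
    -- Some point gains at least the average, taken with respect to `pV`.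
    obtain ⟨v, hv⟩ : ∃ v, ∑ u, un u - δ ≤ L * ∑ u, (if S u v then un u else 0) := by
      by_contra! hcon
      have h3 : ∑ v, pV v * (L * ∑ u, (if S u v then un u else 0)) <
          ∑ v, pV v * (∑ u, un u - δ) := by
        obtain ⟨v₀, hv₀⟩ : ∃ v, 0 < pV v := by
          by_contra! h
          have := Finset.sum_nonpos fun v (_ : v ∈ Finset.univ) => h v
          linarith
        exact Finset.sum_lt_sum (fun v _ => mul_le_mul_of_nonneg_left (hcon v).le (hV v))
          ⟨v₀, Finset.mem_univ _, mul_lt_mul_of_pos_left (hcon v₀) hv₀⟩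
      rw [← Finset.sum_mul, hV1, one_mul] at h3
      rw [Finset.mul_sum] at hgain
      refine absurd (hgain.trans (le_of_eq ?_)) (not_le.2 h3)
      exact Finset.sum_congr rfl fun v _ => by ring
    refine ⟨fun m => if m < K then c m else v, ?_⟩
    have h4 : ∀ u, (if ∃ m < K + 1, S u (if m < K then c m else v) then 0 else pU u) =
        un u - (if S u v then un u else 0) := by
      intro u
      have h5 : (∃ m < K + 1, S u (if m < K then c m else v)) ↔
          (∃ m < K, S u (c m)) ∨ S u v := by
        constructor
        · rintro ⟨m, hm, hs⟩
          by_cases hmK : m < K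
          · rw [if_pos hmK] at hs; exact Or.inl ⟨m, hmK, hs⟩
          · rw [if_neg hmK] at hs; exact Or.inr hs
        · rintro (⟨m, hm, hs⟩ | hs)
          · exact ⟨m, by omega, by rwa [if_pos hm]⟩
          · exact ⟨K, by omega, by simpa using hs⟩
      simp only [h5, hun]
      by_cases h6 : ∃ m < K, S u (c m) <;> by_cases h7 : S u v <;> simp [h6, h7]
    simp_rw [h4]
    rw [Finset.sum_sub_distrib]
    have h8 : (∑ u, un u - δ) / L ≤ ∑ u, (if S u v then un u else 0) := by
      rw [div_le_iff₀ hL0]; linarith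
    have h9 : (1 - 1 / L) * (∑ u, un u - δ) ≤ (1 - 1 / L) * (1 - 1 / L) ^ K := by
      refine mul_le_mul_of_nonneg_left (by linarith) ?_
      have : 1 / L ≤ 1 := by rw [div_le_one hL0]; exact hL
      linarith
    rw [pow_succ']
    have h10 : (1 - 1 / L) * (∑ u, un u - δ) = ∑ u, un u - δ - (∑ u, un u - δ) / L := by ring
    linarith

/-- Feinstein's lemma: a maximal code with small maximal error. -/
lemma exists_channelCode {X Y : Type*} [Fintype X] [Fintype Y] (p : X → ℝ) (W : X → Y → ℝ)
    (r : Y → ℝ) (S : X → Y → Prop) (L δ ε : ℝ) (hL : 0 < L) (hp : ∀ x, 0 ≤ p x)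
    (hp1 : ∑ x, p x = 1) (hW : ∀ x y, 0 ≤ W x y) (hW1 : ∀ x, ∑ y, W x y = 1)
    (hr : ∀ y, ∑ x, p x * W x y = r y) (hS : ∀ x y, S x y → L * r y ≤ W x y)
    (hδ : ∑ x, p x * ∑ y, (if S x y then 0 else W x y) ≤ δ) (K : ℕ) (hK : δ + K / L ≤ ε) :
    ∃ (φ : ℕ → X) (ψ : Y → ℕ), ∀ m < K,
      1 - ε ≤ ∑ y, (if ψ y = m ∧ S (φ m) y then W (φ m) y else 0) := by
  have hXne : Nonempty X := by
    by_contra h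
    rw [not_nonempty_iff] at h
    simp at hp1
  -- The added clause, that an output in use is compatible with its codeword, bounds the `r`-mass of
  -- the outputs in use by `k / L`. A value of `ψ` that is at least `k` marks a free output.
  suffices h : ∀ k ≤ K, ∃ (φ : ℕ → X) (ψ : Y → ℕ), (∀ y, ψ y < k → S (φ (ψ y)) y) ∧ ∀ m < k,
      1 - ε ≤ ∑ y, (if ψ y = m ∧ S (φ m) y then W (φ m) y else 0) by
    obtain ⟨φ, ψ, -, h⟩ := h K le_rfl
    exact ⟨φ, ψ, h⟩
  intro k
  induction k with
  | zero => exact fun _ => ⟨fun _ => Classical.arbitrary X, fun _ => 0, by simp, by simp⟩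
  | succ k ih =>
    intro hk
    obtain ⟨φ, ψ, hψ, hφ⟩ := ih (by omega)
    -- If no input could be added, then averaging over `p` would split the total mass 1 into the
    -- incompatible part, at most `δ`, the outputs in use, at most `k / L`, and the rest, less than
    -- `1 - ε`: too little.
    obtain ⟨x, hx⟩ : ∃ x, 1 - ε ≤ ∑ y, (if k ≤ ψ y ∧ S x y then W x y else 0) := by
      by_contra! hcon
      have h1 : ∑ x, p x * ∑ y, (if k ≤ ψ y ∧ S x y then W x y else 0) < ∑ x, p x * (1 - ε) := by
        obtain ⟨x₀, hx₀⟩ : ∃ x, 0 < p x := by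
          by_contra! h
          have := Finset.sum_nonpos fun x (_ : x ∈ Finset.univ) => h x
          linarith
        exact Finset.sum_lt_sum (fun x _ => mul_le_mul_of_nonneg_left (hcon x).le (hp x))
          ⟨x₀, Finset.mem_univ _, mul_lt_mul_of_pos_left (hcon x₀) hx₀⟩
      rw [← Finset.sum_mul, hp1, one_mul] at h1
      -- the mass of the outputs that are already used
      have h2 : ∑ y, (if ψ y < k then r y else 0) ≤ k / L := by
        have h3 : ∀ y, (if ψ y < k then r y else 0) ≤
            ∑ m ∈ Finset.range k, (if ψ y = m then W (φ m) y / L else 0) := by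
          intro y
          split_ifs with hy
          · rw [Finset.sum_ite_eq, if_pos (Finset.mem_range.2 hy), le_div_iff₀ hL]
            linarith [hS _ _ (hψ y hy)]
          · exact Finset.sum_nonneg fun m _ => by
              split_ifs
              · exact div_nonneg (hW _ _) hL.le
              · exact le_rfl
        refine (Finset.sum_le_sum fun y _ => h3 y).trans ?_
        rw [Finset.sum_comm]
        calc _ ≤ ∑ m ∈ Finset.range k, 1 / L := by
              refine Finset.sum_le_sum fun m _ => ?_
              rw [← hW1 (φ m), Finset.sum_div]
              refine Finset.sum_le_sum fun y _ => ?_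
              split_ifs
              · exact le_rfl
              · exact div_nonneg (hW _ _) hL.le
          _ = k / L := by simp; ring
      have h4 : 1 ≤ δ + ∑ x, p x * ∑ y, (if k ≤ ψ y ∧ S x y then W x y else 0) +
          ∑ y, (if ψ y < k then r y else 0) := by
        have h5 : ∑ y, (if ψ y < k then r y else 0) =
            ∑ x, p x * ∑ y, (if ψ y < k then W x y else 0) := by
          simp_rw [Finset.mul_sum]
          rw [Finset.sum_comm]
          refine Finset.sum_congr rfl fun y _ => ?_
          split_ifs
          · exact (hr y).symm
          · simp
        have h6 : (1 : ℝ) = ∑ x, p x * ∑ y, W x y := by simp [hW1, hp1]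
        rw [h5]
        nth_rw 1 [h6]
        refine le_trans ?_ (add_le_add (add_le_add hδ le_rfl) le_rfl)
        rw [← Finset.sum_add_distrib, ← Finset.sum_add_distrib]
        refine Finset.sum_le_sum fun x _ => ?_
        rw [← mul_add, ← mul_add, ← Finset.sum_add_distrib, ← Finset.sum_add_distrib]
        refine mul_le_mul_of_nonneg_left (Finset.sum_le_sum fun y _ => ?_) (hp x)
        have := hW x y
        rcases lt_or_ge (ψ y) k with hy | hy <;> by_cases hs : S x y <;>
          simp [hs, hy, not_le.2, not_lt.2, this]
      have h7 : (k : ℝ) / L ≤ K / L := by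
        have : (k : ℝ) ≤ K := by exact_mod_cast (by omega : k ≤ K)
        gcongr
      linarith
    -- The new codeword takes all free outputs compatible with it; the value `k + 1` keeps the
    -- others free at the next stage.
    refine ⟨fun m => if m < k then φ m else x,
      fun y => if ψ y < k then ψ y else if S x y then k else k + 1, ?_, ?_⟩
    · intro y
      by_cases hy : ψ y < k
      · simp [hy, hψ y hy]
      · by_cases hs : S x y <;> simp [hy, hs]
    · intro m hm
      rcases Nat.lt_succ_iff_lt_or_eq.1 hm with hm | rfl
      · refine (hφ m hm).trans (le_of_eq (Finset.sum_congr rfl fun y _ => ?_))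
        simp only [if_pos hm]
        have : ((if ψ y < k then ψ y else if S x y then k else k + 1) = m) ↔ ψ y = m := by
          by_cases hy : ψ y < k
          · simp [hy]
          · by_cases hs : S x y <;> simp only [hy, hs, if_true, if_false] <;> omega
        simp only [this]
      · refine hx.trans (le_of_eq (Finset.sum_congr rfl fun y _ => ?_))
        simp only [lt_irrefl, if_false]
        have : ((if ψ y < m then ψ y else if S x y then m else m + 1) = m ∧ S x y) ↔
            (m ≤ ψ y ∧ S x y) := by
          rcases lt_or_ge (ψ y) m with hy | hy
          · simp only [hy, if_true, not_le.2 hy, false_and, iff_false]; omega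
          · by_cases hs : S x y <;> simp [hy, not_lt.2 hy, hs]
        simp only [this]

end OneShotCoding

/-! ### Chernoff's bound and typical sequences -/

section Concentration

open scoped Classical

variable {ι E : Type*} [Fintype ι] [DecidableEq ι] [Fintype E]

/-- Chernoff's bound for product weights. -/
lemma sum_prod_weight_deviation_le (w : ι → E → ℝ) (hw : ∀ i e, 0 ≤ w i e)
    (hw1 : ∀ i, ∑ e, w i e = 1) (g : ι → E → ℝ) (hg : ∀ i e, |g i e| ≤ 1)
    (hg0 : ∀ i, ∑ e, w i e * g i e = 0) (t : ℝ) (ht0 : 0 ≤ t) (ht : t ≤ 2) :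
    ∑ y : ι → E, (if Fintype.card ι * t < ∑ i, g i (y i) then ∏ i, w i (y i) else 0) ≤
      Real.exp (-(Fintype.card ι * t ^ 2 / 4)) := by
  set n : ℝ := (Fintype.card ι : ℝ) with hn
  -- The minimizer of the exponent `s ^ 2 - s * t`. The assumption `t ≤ 2` keeps `|s * g i e| ≤ 1`,
  -- where `exp u ≤ 1 + u + u ^ 2` holds.
  set s := t / 2 with hs
  have hexp : ∀ i e, Real.exp (s * g i e) ≤ 1 + s * g i e + s ^ 2 := by
    intro i e
    have hb : |s * g i e| ≤ 1 := by
      rw [abs_mul, abs_of_nonneg (by positivity)]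
      calc s * |g i e| ≤ 1 * 1 := mul_le_mul (by linarith) (hg i e) (abs_nonneg _) (by norm_num)
        _ = 1 := by norm_num
    have h1 := Real.abs_exp_sub_one_sub_id_le hb
    have h2 := (abs_le.1 h1).2
    have h3 : (s * g i e) ^ 2 ≤ s ^ 2 := by
      rw [mul_pow]
      have : g i e ^ 2 ≤ 1 := by
        rw [← sq_abs]; exact pow_le_one₀ (abs_nonneg _) (hg i e)
      nlinarith [sq_nonneg s]
    linarith
  have hmgf : ∀ i, ∑ e, w i e * Real.exp (s * g i e) ≤ Real.exp (s ^ 2) := by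
    intro i
    calc _ ≤ ∑ e, (w i e + s * (w i e * g i e) + s ^ 2 * w i e) := by
          refine Finset.sum_le_sum fun e _ => ?_
          have := mul_le_mul_of_nonneg_left (hexp i e) (hw i e)
          linarith
      _ = 1 + s ^ 2 := by
          rw [Finset.sum_add_distrib, Finset.sum_add_distrib, ← Finset.mul_sum, ← Finset.mul_sum,
            hw1, hg0]; ring
      _ ≤ _ := by linarith [Real.add_one_le_exp (s ^ 2)]
  calc _ ≤ ∑ y : ι → E, Real.exp (-(s * (n * t))) * ∏ i, (w i (y i) * Real.exp (s * g i (y i))) :=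
      by
        refine Finset.sum_le_sum fun y _ => ?_
        have hP : 0 ≤ ∏ i, w i (y i) := Finset.prod_nonneg fun i _ => hw i _
        rw [Finset.prod_mul_distrib, ← Real.exp_sum, ← Finset.mul_sum]
        split_ifs with h
        · have h1 : 1 ≤ Real.exp (-(s * (n * t))) * Real.exp (s * ∑ i, g i (y i)) := by
            rw [← Real.exp_add]
            apply Real.one_le_exp
            have := mul_le_mul_of_nonneg_left h.le (show 0 ≤ s by positivity)
            linarith
          nlinarith
        · positivity
    _ = Real.exp (-(s * (n * t))) * ∏ i, ∑ e, w i e * Real.exp (s * g i e) := by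
        rw [← Finset.mul_sum, Finset.prod_univ_sum, Fintype.piFinset_univ]
    _ ≤ Real.exp (-(s * (n * t))) * ∏ _i : ι, Real.exp (s ^ 2) := by
        refine mul_le_mul_of_nonneg_left (Finset.prod_le_prod (fun i _ => ?_) fun i _ => hmgf i)
          (Real.exp_pos _).le
        exact Finset.sum_nonneg fun e _ => mul_nonneg (hw _ _) (Real.exp_pos _).le
    _ = Real.exp (-(n * t ^ 2 / 4)) := by
        rw [Finset.prod_const, Finset.card_univ, ← Real.exp_nat_mul, ← Real.exp_add]
        congr 1
        rw [← hn, hs]; ring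

/-- The number of occurrences of `a` in a finite sequence. -/
noncomputable def occurrences {F : Type*} (z : ι → F) (a : F) : ℝ :=
  ∑ i, if z i = a then 1 else 0

/-- Chernoff's bound for the centred indicators of the symbols, and a union bound over the symbols.
-/
lemma sum_prod_weight_occurrences_le {F : Type*} [Fintype F] (w : ι → E → ℝ)
    (hw : ∀ i e, 0 ≤ w i e) (hw1 : ∀ i, ∑ e, w i e = 1) (f : ι → E → F) (t : ℝ) (ht0 : 0 ≤ t)
    (ht : t ≤ 2) :
    ∑ y : ι → E, (if ∀ a, occurrences (fun i => f i (y i)) a ≤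
        ∑ i, ∑ e, (if f i e = a then w i e else 0) + Fintype.card ι * t then 0
        else ∏ i, w i (y i)) ≤
      Fintype.card F * Real.exp (-(Fintype.card ι * t ^ 2 / 4)) := by
  let g : F → ι → E → ℝ := fun a i e =>
    (if f i e = a then 1 else 0) - ∑ e', (if f i e' = a then w i e' else 0)
  have hm : ∀ a i, 0 ≤ ∑ e', (if f i e' = a then w i e' else 0) ∧
      ∑ e', (if f i e' = a then w i e' else 0) ≤ 1 := fun a i =>
    ⟨Finset.sum_nonneg fun e _ => by split_ifs <;> simp [hw], by
      rw [← hw1 i]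
      exact Finset.sum_le_sum fun e _ => by split_ifs <;> simp [hw]⟩
  have h1 : ∀ a, ∑ y : ι → E, (if Fintype.card ι * t < ∑ i, g a i (y i) then ∏ i, w i (y i)
      else 0) ≤ Real.exp (-(Fintype.card ι * t ^ 2 / 4)) := fun a =>
    sum_prod_weight_deviation_le w hw hw1 (g a) (fun i e => by
      have := hm a i
      simp only [g]
      rw [abs_le]
      split_ifs <;> constructor <;> linarith) (fun i => by
      simp only [g, mul_sub, Finset.sum_sub_distrib, mul_ite, mul_one, mul_zero, ← Finset.sum_mul,
        hw1, one_mul, sub_self]) t ht0 ht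
  calc _ ≤ ∑ y : ι → E, ∑ a, (if Fintype.card ι * t < ∑ i, g a i (y i) then ∏ i, w i (y i)
      else 0) := by
        refine Finset.sum_le_sum fun y _ => ?_
        have hP : 0 ≤ ∏ i, w i (y i) := Finset.prod_nonneg fun i _ => hw i _
        have hnn : ∀ a ∈ Finset.univ, 0 ≤ (if Fintype.card ι * t < ∑ i, g a i (y i) then
            ∏ i, w i (y i) else 0) := fun a _ => by split_ifs <;> simp [hP]
        split_ifs with h
        · exact Finset.sum_nonneg hnn
        · push Not at h
          obtain ⟨a, ha⟩ := h
          refine le_trans ?_ (Finset.single_le_sum hnn (Finset.mem_univ a))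
          rw [if_pos]
          simp only [g, Finset.sum_sub_distrib]
          rw [occurrences] at ha
          linarith
    _ ≤ _ := by
        rw [Finset.sum_comm]
        refine (Finset.sum_le_sum fun a _ => h1 a).trans ?_
        simp

end Concentration

section Typicality

open scoped Classical

variable {E F : Type*} [Fintype F] {n : ℕ}

/-- Sequences whose entries are in the support of `Q`, none being more frequent than it should. -/
def Typical (Q : F → ℝ) (t : ℝ) (z : Fin n → F) : Prop :=
  (∀ a, occurrences z a ≤ n * (Q a + t)) ∧ ∀ i, Q (z i) ≠ 0

lemma sum_occurrences_mul (z : Fin n → F) (f : F → ℝ) :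
    ∑ a, occurrences z a * f a = ∑ i, f (z i) := by
  simp only [occurrences, Finset.sum_mul, ite_mul, one_mul, zero_mul]
  rw [Finset.sum_comm]
  simp

/-- One-sided frequency bounds suffice: the frequencies and `Q` have the same total, so no symbol
can be rare unless others are too frequent. This costs the factor `Fintype.card F`. -/
lemma Typical.abs_sum_sub_le {Q : F → ℝ} (hQ1 : ∑ a, Q a = 1) {t : ℝ} (ht : 0 ≤ t)
    {z : Fin n → F} (h : Typical Q t z) (f : F → ℝ) :
    |∑ i, f (z i) - n * ∑ a, Q a * f a| ≤ n * (t * (Fintype.card F * ∑ a, |f a|)) := by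
  have hocc : ∑ a, occurrences z a = n := by
    have := sum_occurrences_mul z fun _ => 1
    simpa using this
  have hdev : ∀ a, |occurrences z a - n * Q a| ≤ Fintype.card F * (n * t) := by
    intro a
    have hcard : (1 : ℝ) ≤ Fintype.card F := by
      exact_mod_cast Fintype.card_pos_iff.2 ⟨a⟩
    have hnt : 0 ≤ (n : ℝ) * t := by positivity
    rw [abs_le]
    constructor
    · have h1 : ∑ b, (n * t - (occurrences z b - n * Q b)) = Fintype.card F * (n * t) := by
        simp [Finset.sum_sub_distrib, hocc, ← Finset.mul_sum, hQ1]
      have h2 := Finset.single_le_sum (f := fun b => n * t - (occurrences z b - n * Q b))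
        (fun b _ => by have := h.1 b; linarith) (Finset.mem_univ a)
      rw [h1] at h2
      linarith
    · have := h.1 a
      nlinarith
  rw [← sum_occurrences_mul, Finset.mul_sum, ← Finset.sum_sub_distrib]
  refine (Finset.abs_sum_le_sum_abs _ _).trans ?_
  rw [Finset.mul_sum, Finset.mul_sum, Finset.mul_sum]
  refine Finset.sum_le_sum fun a _ => ?_
  rw [← mul_assoc, ← sub_mul, abs_mul]
  refine (mul_le_mul_of_nonneg_right (hdev a) (abs_nonneg _)).trans (le_of_eq (by ring))

/-- The margin `s` is for means that are themselves only close to `n * Q`, as when the law of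
coordinate `i` depends on the `i`-th entry of a given typical sequence. -/
lemma sum_prod_weight_not_typical_le [Fintype E] (w : Fin n → E → ℝ) (hw : ∀ i e, 0 ≤ w i e)
    (hw1 : ∀ i, ∑ e, w i e = 1) (f : Fin n → E → F) (Q : F → ℝ) (s t : ℝ) (ht0 : 0 ≤ t)
    (ht : t ≤ 2) (hmean : ∀ a, ∑ i, ∑ e, (if f i e = a then w i e else 0) ≤ n * (Q a + s))
    (hsupp : ∀ i e, w i e ≠ 0 → Q (f i e) ≠ 0) :
    ∑ y : Fin n → E, (if Typical Q (s + t) (fun i => f i (y i)) then 0 else ∏ i, w i (y i)) ≤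
      Fintype.card F * Real.exp (-(n * t ^ 2 / 4)) := by
  have h := sum_prod_weight_occurrences_le w hw hw1 f t ht0 ht
  rw [Fintype.card_fin] at h
  refine le_trans (Finset.sum_le_sum fun y _ => ?_) h
  have hP : 0 ≤ ∏ i, w i (y i) := Finset.prod_nonneg fun i _ => hw i _
  by_cases hy : ∏ i, w i (y i) = 0
  · simp [hy]
  · have hy := Finset.prod_ne_zero_iff.1 hy
    split_ifs with h1 h2 h2
    · exact le_rfl
    · exact hP
    · refine absurd ⟨fun a => (h2 a).trans ?_, fun i => hsupp i _ (hy i (Finset.mem_univ i))⟩ h1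
      have := hmean a
      linarith
    · exact le_rfl

end Typicality

/-! ### Information densities and block codes -/

section Densities

open scoped Classical

variable {A B C D : Type*} [Fintype A] [Fintype B] [Fintype C] [Fintype D]

/-- `log (Q(x₀, x₂) / (Q(x₀) Q(x₂)))` -/
noncomputable def stateActionDensity (p : A × B × C → ℝ) (z : A × C) : ℝ :=
  Real.log (marginal p (fun a => (a.1, a.2.2)) z) - Real.log (marginal p (fun a => a.1) z.1) -
    Real.log (marginal p (fun a => a.2.2) z.2)

/-- `log (Γ(y | x₁) / Q(y | x₀, x₂))` -/
noncomputable def channelDensity (Γ : B → PMF D) (p : A × B × C → ℝ) (v : A × B × C × D) : ℝ :=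
  Real.log (Γ v.2.1 v.2.2.2).toReal -
    Real.log (marginal (jointWeight Γ p) (fun v => ((v.1, v.2.2.2), v.2.2.1))
      ((v.1, v.2.2.2), v.2.2.1)) + Real.log (marginal p (fun a => (a.1, a.2.2)) (v.1, v.2.2.1))

/-- The two informations as means of densities: on typical sequences the sums of the densities are
close to `n` times these means, which gives the exponents of packing and covering. -/
lemma informationSlack_eq_sum_density (Γ : B → PMF D) (p : A × B × C → ℝ) :
    informationSlack Γ p = ∑ v, jointWeight Γ p v * channelDensity Γ p v -
      ∑ z, marginal p (fun a => (a.1, a.2.2)) z * stateActionDensity p z := by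
  have h1 : ∑ v, jointWeight Γ p v * Real.log (Γ v.2.1 v.2.2.2).toReal =
      -∑ a, p a * channelEntropy Γ a.2.1 := by
    simp only [Fintype.sum_prod_type, jointWeight, channelEntropy, Real.negMulLog,
      Finset.mul_sum, ← Finset.sum_neg_distrib]
    refine Finset.sum_congr rfl fun a _ => Finset.sum_congr rfl fun b _ =>
      Finset.sum_congr rfl fun c _ => Finset.sum_congr rfl fun d _ => by ring
  have h2 : ∑ v, jointWeight Γ p v *
      Real.log (marginal p (fun a => (a.1, a.2.2)) (v.1, v.2.2.1)) =
      ∑ a, p a * Real.log (marginal p (fun a => (a.1, a.2.2)) (a.1, a.2.2)) := by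
    have := sum_marginal_mul (jointWeight Γ p) (fun v => (v.1, v.2.1, v.2.2.1)) fun a =>
      Real.log (marginal p (fun a => (a.1, a.2.2)) (a.1, a.2.2))
    rw [marginal_jointWeight] at this
    exact this.symm
  have h3 : ∑ v, jointWeight Γ p v *
      Real.log (marginal (jointWeight Γ p) (fun v => v.2.2.1) v.2.2.1) =
      ∑ a, p a * Real.log (marginal p (fun a => a.2.2) a.2.2) := by
    have h := weightEntropy_jointWeight_comp Γ p (fun a => a.2.2)
    simpa [weightEntropy] using h
  rw [sum_marginal_mul]
  simp only [informationSlack, condWeightEntropy, weightEntropy, channelDensity,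
    stateActionDensity, mul_add, mul_sub, Finset.sum_add_distrib, Finset.sum_sub_distrib, h1, h2,
        h3]
  ring

end Densities

section BlockCode

open scoped Classical

variable {A B C D : Type*} [Fintype A] [Fintype D]

/-- A block code of length `n`: the encoder `e` of the states, the codebook `c` of
decision-maker 2, the encoder `φ` and the decoder `ψ` for the channel, when the states are known
to the decoder. On a set `G` of probability at least `1 - ε` the decoder is wrong with probability
at most `ε` and no triple is more frequent than it should. -/
def HasBlockCode (ρ : A → ℝ) (Γ : B → PMF D) (p : A × B × C → ℝ) (ε : ℝ) (n : ℕ) : Prop :=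
  ∃ (e : (Fin n → A) → ℕ) (c : ℕ → Fin n → C) (φ : (Fin n → A) → ℕ → Fin n → B)
    (ψ : (Fin n → A) → (Fin n → D) → ℕ) (G : Set (Fin n → A)),
    ∑ x, (if x ∈ G then 0 else ∏ j, ρ (x j)) ≤ ε ∧
    (∀ x ∈ G, ∀ x', ∑ y, (if ψ x y = e x' then 0 else
      ∏ j, (Γ (φ x (e x') j) (y j)).toReal) ≤ ε) ∧
    ∀ x ∈ G, ∀ m a, occurrences (fun j => (x j, φ x m j, c (e x) j)) a ≤ n * (p a + ε)

/-- The encoder picks a covering index, or `0` when there is none. The occurrence bound of a block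
code must hold for all `m`, also for messages of a longer next block that exceed `K`; those are sent
as message `0`. -/
lemma HasBlockCode.of_covering {ρ : A → ℝ} {Γ : B → PMF D} {p : A × B × C → ℝ} {ε : ℝ} {n K : ℕ}
    (hK : 0 < K) (S : (Fin n → A) → (Fin n → C) → Prop) (c : ℕ → Fin n → C)
    (hc : ∑ x : Fin n → A, (if ∃ m < K, S x (c m) then 0 else ∏ j, ρ (x j)) ≤ ε)
    (hcode : ∀ x z, S x z → ∃ (φ : ℕ → Fin n → B) (ψ : (Fin n → D) → ℕ),
      (∀ m < K, ∑ y, (if ψ y = m then 0 else ∏ j, (Γ (φ m j) (y j)).toReal) ≤ ε) ∧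
      ∀ m < K, ∀ a, occurrences (fun j => (x j, φ m j, z j)) a ≤ n * (p a + ε))
    [Nonempty B] : HasBlockCode ρ Γ p ε n := by
  let e : (Fin n → A) → ℕ := fun x => if h : ∃ m < K, S x (c m) then h.choose else 0
  have he : ∀ x, e x < K := fun x => by
    by_cases h : ∃ m < K, S x (c m)
    · simp only [e, dif_pos h]; exact h.choose_spec.1
    · simp only [e, dif_neg h]; exact hK
  have heS : ∀ x, (∃ m < K, S x (c m)) → S x (c (e x)) := fun x h => by
    simp only [e, dif_pos h]; exact h.choose_spec.2
  have : ∀ x, ∃ (φ : ℕ → Fin n → B) (ψ : (Fin n → D) → ℕ), (∃ m < K, S x (c m)) →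
      (∀ m < K, ∑ y, (if ψ y = m then 0 else ∏ j, (Γ (φ m j) (y j)).toReal) ≤ ε) ∧
      ∀ m < K, ∀ a, occurrences (fun j => (x j, φ m j, c (e x) j)) a ≤ n * (p a + ε) := by
    intro x
    by_cases h : ∃ m < K, S x (c m)
    · obtain ⟨φ, ψ, h1⟩ := hcode x _ (heS x h)
      exact ⟨φ, ψ, fun _ => h1⟩
    · exact ⟨fun _ _ => Classical.arbitrary B, fun _ => 0, fun h' => absurd h' h⟩
  choose φ ψ h using this
  refine ⟨e, c, fun x m => if m < K then φ x m else φ x 0, ψ, {x | ∃ m < K, S x (c m)},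
      by convert hc; simp, ?_, ?_⟩
  · intro x hx x'
    simp only [if_pos (he x')]
    exact (h x hx).1 _ (he x')
  · intro x hx m a
    by_cases hm : m < K
    · simp only [if_pos hm]
      exact (h x hx).2 m hm a
    · simp only [if_neg hm]
      exact (h x hx).2 0 hK a

lemma HasBlockCode.mono {ρ : A → ℝ} {Γ : B → PMF D} {p p' : A × B × C → ℝ} {ε ε' : ℝ} {n : ℕ}
    (h : HasBlockCode ρ Γ p ε n) (hε : ε ≤ ε') (hp : ∀ a, p a + ε ≤ p' a + ε') :
    HasBlockCode ρ Γ p' ε' n := by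
  obtain ⟨e, c, φ, ψ, G, h1, h2, h3⟩ := h
  exact ⟨e, c, φ, ψ, G, h1.trans hε, fun x hx x' => (h2 x hx x').trans hε, fun x hx m a =>
    (h3 x hx m a).trans (mul_le_mul_of_nonneg_left (hp a) (Nat.cast_nonneg n))⟩

end BlockCode

/-! ### Channel codes for known states and actions -/

section ConditionalCode

open scoped Classical

variable {A B C D : Type*} [Fintype A] [Fintype B] [Fintype C] [Fintype D]

/-- `Q(x₁ | x₀, x₂)` -/
noncomputable def inputKernel (p : A × B × C → ℝ) (z : A × C) (b : B) : ℝ :=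
  p (z.1, b, z.2) / marginal p (fun a => (a.1, a.2.2)) z

lemma marginal_states_actions (p : A × B × C → ℝ) (z : A × C) :
    marginal p (fun a => (a.1, a.2.2)) z = ∑ b, p (z.1, b, z.2) := by
  obtain ⟨a, c⟩ := z
  simp only [marginal, Fintype.sum_prod_type, Prod.mk.injEq]
  rw [Finset.sum_eq_single a (by simp +contextual) (by simp)]
  refine Finset.sum_congr rfl fun b _ => ?_
  rw [Finset.sum_eq_single c (by simp +contextual) (by simp)]
  simp

lemma marginal_jointWeight_output (Γ : B → PMF D) (p : A × B × C → ℝ) (a : A) (c : C) (d : D) :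
    marginal (jointWeight Γ p) (fun v => ((v.1, v.2.2.2), v.2.2.1)) ((a, d), c) =
      ∑ b, p (a, b, c) * (Γ b d).toReal := by
  simp only [marginal, Fintype.sum_prod_type, Prod.mk.injEq, jointWeight]
  rw [Finset.sum_eq_single a (by simp +contextual) (by simp)]
  refine Finset.sum_congr rfl fun b _ => ?_
  rw [Finset.sum_eq_single c (by simp +contextual) (by simp),
    Finset.sum_eq_single d (by simp +contextual) (by simp)]
  simp

lemma inputKernel_nonneg {p : A × B × C → ℝ} (hp : ∀ a, 0 ≤ p a) (z : A × C) (b : B) :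
    0 ≤ inputKernel p z b := div_nonneg (hp _) (marginal_nonneg hp _ _)

lemma sum_inputKernel {p : A × B × C → ℝ} {z : A × C}
    (hz : marginal p (fun a => (a.1, a.2.2)) z ≠ 0) : ∑ b, inputKernel p z b = 1 := by
  simp only [inputKernel]
  rw [← Finset.sum_div, ← marginal_states_actions, div_self hz]

/-- Most inputs and outputs are jointly typical with typical states and actions. -/
lemma sum_inputKernel_not_typical_le (Γ : B → PMF D) {p : A × B × C → ℝ} (hp : ∀ a, 0 ≤ p a)
    {n : ℕ} {s t : ℝ} (hs : 0 ≤ s) (ht0 : 0 ≤ t) (ht : t ≤ 2) {x : Fin n → A} {z : Fin n → C}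
    (hxz : Typical (marginal p (fun a => (a.1, a.2.2))) s (fun i => (x i, z i))) :
    ∑ b : Fin n → B, (∏ i, inputKernel p (x i, z i) (b i)) * ∑ y : Fin n → D,
      (if Typical (jointWeight Γ p) (s + t) (fun i => (x i, b i, z i, y i)) then 0 else
        ∏ i, (Γ (b i) (y i)).toReal) ≤
      Fintype.card (A × B × C × D) * Real.exp (-(n * t ^ 2 / 4)) := by
  set QV := marginal p (fun a => (a.1, a.2.2)) with hQV
  -- Given `x` and `z`, the pairs of input and output are independent with these laws.
  let w : Fin n → B × D → ℝ := fun i e => inputKernel p (x i, z i) e.1 * (Γ e.1 e.2).toReal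
  have hw : ∀ i e, 0 ≤ w i e := fun i e =>
    mul_nonneg (inputKernel_nonneg hp _ _) ENNReal.toReal_nonneg
  have hw1 : ∀ i, ∑ e, w i e = 1 := fun i => by
    simp only [w, Fintype.sum_prod_type, ← Finset.mul_sum, PMF.sum_toReal, mul_one]
    exact sum_inputKernel (hxz.2 i)
  have h := sum_prod_weight_not_typical_le w hw hw1 (fun i e => (x i, e.1, z i, e.2))
    (jointWeight Γ p) s t ht0 ht ?_ ?_
  · refine le_trans (le_of_eq ?_) h
    rw [← Equiv.sum_comp (Equiv.arrowProdEquivProdArrow (Fin n) (fun _ => B) (fun _ => D)).symm,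
      Fintype.sum_prod_type]
    refine Finset.sum_congr rfl fun b _ => ?_
    rw [Finset.mul_sum]
    refine Finset.sum_congr rfl fun y _ => ?_
    simp only [Equiv.arrowProdEquivProdArrow, Equiv.coe_fn_symm_mk, w]
    rw [Finset.prod_mul_distrib, mul_ite, mul_zero]
    congr
  -- The mean number of occurrences of `(a, b, c, d)` is that of `(a, c)` times a conditional
  -- probability, so the typicality margin `s` of `(x, z)` carries over.
  · rintro ⟨a, b, c, d⟩
    have h1 : ∀ i, ∑ e : B × D, (if (x i, e.1, z i, e.2) = (a, b, c, d) then w i e else 0) =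
        (if (x i, z i) = (a, c) then 1 else 0) * (inputKernel p (a, c) b * (Γ b d).toReal) := by
      intro i
      simp only [Fintype.sum_prod_type, Prod.mk.injEq, w]
      rw [Finset.sum_eq_single b (by simp +contextual) (by simp),
        Finset.sum_eq_single d (by simp +contextual) (by simp)]
      by_cases h1 : x i = a <;> by_cases h2 : z i = c <;> simp [h1, h2]
    have h2 := hxz.1 (a, c)
    rw [occurrences] at h2
    have hk0 := inputKernel_nonneg hp (a, c) b
    have hΓ0 : 0 ≤ (Γ b d).toReal := ENNReal.toReal_nonneg
    have hΓ1 : (Γ b d).toReal ≤ 1 :=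
      ENNReal.toReal_le_of_le_ofReal zero_le_one (by simpa using (Γ b).coe_le_one d)
    have hk1 : inputKernel p (a, c) b ≤ 1 := by
      refine div_le_one_of_le₀ ?_ (marginal_nonneg hp _ _)
      exact le_marginal hp (fun a : A × B × C => (a.1, a.2.2)) (a, b, c)
    have hk2 : QV (a, c) * inputKernel p (a, c) b = p (a, b, c) := by
      rw [inputKernel]
      by_cases h0 : QV (a, c) = 0
      · have := le_marginal hp (fun a : A × B × C => (a.1, a.2.2)) (a, b, c)
        rw [h0, zero_mul]
        exact le_antisymm (hp _) (this.trans h0.le)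
      · rw [← hQV, mul_div_cancel₀ _ h0]
    have h3 : inputKernel p (a, c) b * (Γ b d).toReal ≤ 1 := mul_le_one₀ hk1 hΓ0 hΓ1
    calc _ = (∑ i, if (x i, z i) = (a, c) then 1 else 0) *
          (inputKernel p (a, c) b * (Γ b d).toReal) := by
          rw [Finset.sum_mul]
          exact Finset.sum_congr rfl fun i _ => by convert h1 i
      _ ≤ n * (QV (a, c) + s) * (inputKernel p (a, c) b * (Γ b d).toReal) :=
          mul_le_mul_of_nonneg_right (le_of_eq_of_le
            (Finset.sum_congr rfl fun i _ => by congr) h2) (mul_nonneg hk0 hΓ0)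
      _ = n * (QV (a, c) * inputKernel p (a, c) b * (Γ b d).toReal +
          s * (inputKernel p (a, c) b * (Γ b d).toReal)) := by ring
      _ ≤ n * (jointWeight Γ p (a, b, c, d) + s) := by
          rw [hk2]
          refine mul_le_mul_of_nonneg_left (add_le_add le_rfl ?_) (Nat.cast_nonneg n)
          exact mul_le_of_le_one_right hs h3
  · intro i e he
    simp only [w, inputKernel] at he
    simp only [jointWeight]
    exact mul_ne_zero (fun h0 => he (by rw [h0]; simp)) (right_ne_zero_of_mul he)

/-- Forgetting the output adds up the margins of its values, whence the factor `Fintype.card D`. -/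
lemma Typical.occurrences_triple_le {A B C D : Type*} [Fintype D] (Γ : B → PMF D)
    {p : A × B × C → ℝ} {n : ℕ} {s : ℝ}
    {x : Fin n → A} {b : Fin n → B} {z : Fin n → C} {y : Fin n → D}
    (h : Typical (jointWeight Γ p) s (fun i => (x i, b i, z i, y i))) (a : A × B × C) :
    occurrences (fun i => (x i, b i, z i)) a ≤ n * (p a + Fintype.card D * s) := by
  have h1 : occurrences (fun i => (x i, b i, z i)) a =
      ∑ d, occurrences (fun i => (x i, b i, z i, y i)) (a.1, a.2.1, a.2.2, d) := by
    simp only [occurrences]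
    rw [Finset.sum_comm]
    refine Finset.sum_congr rfl fun i _ => ?_
    obtain ⟨a, b', c⟩ := a
    simp only [Prod.mk.injEq]
    rw [Finset.sum_eq_single (y i) (by simp +contextual [eq_comm]) (by simp)]
    simp
  rw [h1]
  refine (Finset.sum_le_sum fun d _ => h.1 _).trans (le_of_eq ?_)
  rw [← Finset.mul_sum, Finset.sum_add_distrib]
  simp only [jointWeight, ← Finset.mul_sum, PMF.sum_toReal]
  simp

/-- A channel code whose codewords are jointly typical with given states and actions. -/
lemma exists_conditionalCode (Γ : B → PMF D) {p : A × B × C → ℝ} (hp : ∀ a, 0 ≤ p a)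
    (hp1 : ∑ a, p a = 1) {n K : ℕ} {s t ε : ℝ} (hs : 0 ≤ s) (ht0 : 0 ≤ t) (ht : t ≤ 2)
    (hε : ε < 1) {x : Fin n → A} {z : Fin n → C}
    (hxz : Typical (marginal p (fun a => (a.1, a.2.2))) s (fun i => (x i, z i)))
    (hK : Fintype.card (A × B × C × D) * Real.exp (-(n * t ^ 2 / 4)) +
      K / Real.exp (n * (∑ v, jointWeight Γ p v * channelDensity Γ p v - (s + t) *
        (Fintype.card (A × B × C × D) * ∑ v, |channelDensity Γ p v|))) ≤ ε) :
    ∃ (φ : ℕ → Fin n → B) (ψ : (Fin n → D) → ℕ),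
      (∀ m < K, ∑ y, (if ψ y = m then 0 else ∏ j, (Γ (φ m j) (y j)).toReal) ≤ ε) ∧
      ∀ m < K, ∀ a, occurrences (fun j => (x j, φ m j, z j)) a ≤
        n * (p a + Fintype.card D * (s + t)) := by
  have hj1 : ∑ v, jointWeight Γ p v = 1 := by
    rw [← sum_marginal (jointWeight Γ p) (fun v => (v.1, v.2.1, v.2.2.1)), marginal_jointWeight,
        hp1]
  have hr : ∀ y : Fin n → D, ∑ b : Fin n → B, (∏ i, inputKernel p (x i, z i) (b i)) *
      ∏ i, (Γ (b i) (y i)).toReal =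
        ∏ i, ∑ b, inputKernel p (x i, z i) b * (Γ b (y i)).toReal := fun y => by
    rw [Finset.prod_univ_sum, Fintype.piFinset_univ]
    simp_rw [Finset.prod_mul_distrib]
  have hS : ∀ (b : Fin n → B) (y : Fin n → D),
      Typical (jointWeight Γ p) (s + t) (fun i => (x i, b i, z i, y i)) →
      Real.exp (n * (∑ v, jointWeight Γ p v * channelDensity Γ p v - (s + t) *
        (Fintype.card (A × B × C × D) * ∑ v, |channelDensity Γ p v|))) *
        ∏ i, ∑ b, inputKernel p (x i, z i) b * (Γ b (y i)).toReal ≤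
      ∏ i, (Γ (b i) (y i)).toReal := by
    intro b y hby
    have hdev := (abs_le.1 (hby.abs_sum_sub_le hj1 (by positivity) (channelDensity Γ p))).1
    -- The likelihood ratio of the channel to its output law given `(x, z)` is the exponential of
    -- the summed density, which typicality bounds below.
    have hprod : (∏ i, (Γ (b i) (y i)).toReal) =
        Real.exp (∑ i, channelDensity Γ p (x i, b i, z i, y i)) *
          ∏ i, ∑ b, inputKernel p (x i, z i) b * (Γ b (y i)).toReal := by
      rw [Real.exp_sum, ← Finset.prod_mul_distrib]
      refine Finset.prod_congr rfl fun i _ => ?_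
      have hne := hby.2 i
      have hpos : 0 < jointWeight Γ p (x i, b i, z i, y i) :=
        (jointWeight_nonneg Γ hp _).lt_of_ne' hne
      have hΓ : 0 < (Γ (b i) (y i)).toReal :=
        ENNReal.toReal_nonneg.lt_of_ne' (right_ne_zero_of_mul hne)
      have hY := marginal_pos (jointWeight_nonneg Γ hp) (fun v => ((v.1, v.2.2.2), v.2.2.1)) hpos
      have hV : 0 < marginal p (fun a => (a.1, a.2.2)) (x i, z i) :=
        (marginal_nonneg hp _ _).lt_of_ne' (hxz.2 i)
      simp only at hY
      have hr : ∑ b, inputKernel p (x i, z i) b * (Γ b (y i)).toReal =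
          marginal (jointWeight Γ p) (fun v => ((v.1, v.2.2.2), v.2.2.1)) ((x i, y i), z i) /
            marginal p (fun a => (a.1, a.2.2)) (x i, z i) := by
        rw [marginal_jointWeight_output, Finset.sum_div]
        refine Finset.sum_congr rfl fun b _ => ?_
        rw [inputKernel]; ring
      rw [hr, channelDensity, Real.exp_add, Real.exp_sub, Real.exp_log hΓ, Real.exp_log hY,
        Real.exp_log hV]
      field_simp
    rw [hprod]
    refine mul_le_mul_of_nonneg_right (Real.exp_le_exp.2 ?_) ?_
    · rw [mul_sub]; linarith
    · exact Finset.prod_nonneg fun i _ => Finset.sum_nonneg fun b _ =>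
        mul_nonneg (inputKernel_nonneg hp _ _) ENNReal.toReal_nonneg
  obtain ⟨φ, ψ, h⟩ := exists_channelCode
    (fun b : Fin n → B => ∏ i, inputKernel p (x i, z i) (b i))
    (fun b y => ∏ i, (Γ (b i) (y i)).toReal)
    (fun y : Fin n → D => ∏ i, ∑ b, inputKernel p (x i, z i) b * (Γ b (y i)).toReal)
    (fun b y => Typical (jointWeight Γ p) (s + t) (fun i => (x i, b i, z i, y i)))
    _ _ ε (Real.exp_pos _) (fun b => Finset.prod_nonneg fun i _ => inputKernel_nonneg hp _ _)
    (sum_prod_weight_eq_one fun i => sum_inputKernel (hxz.2 i))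
    (fun b y => Finset.prod_nonneg fun i _ => ENNReal.toReal_nonneg)
    (fun b => sum_prod_weight_eq_one (w := fun i d => (Γ (b i) d).toReal) fun i =>
      PMF.sum_toReal _) hr hS (sum_inputKernel_not_typical_le Γ hp hs ht0 ht hxz) K hK
  refine ⟨φ, ψ, fun m hm => ?_, fun m hm a => ?_⟩
  · have h1 := h m hm
    have h2 := sum_prod_weight_eq_one (w := fun i d => (Γ (φ m i) d).toReal) fun i =>
      PMF.sum_toReal _
    have h3 : ∑ y, (if ψ y = m then 0 else ∏ j, (Γ (φ m j) (y j)).toReal) +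
        ∑ y, (if ψ y = m ∧ Typical (jointWeight Γ p) (s + t) (fun i => (x i, φ m i, z i, y i))
          then ∏ j, (Γ (φ m j) (y j)).toReal else 0) ≤ 1 := by
      rw [← h2, ← Finset.sum_add_distrib]
      refine Finset.sum_le_sum fun y _ => ?_
      have : 0 ≤ ∏ j, (Γ (φ m j) (y j)).toReal :=
        Finset.prod_nonneg fun i _ => ENNReal.toReal_nonneg
      by_cases h4 : ψ y = m
      · simp only [h4, if_true, true_and, zero_add]
        split_ifs
        · exact le_rfl
        · exact this
      · simp [h4]
    linarith
  -- A codeword meets a typical output with probability at least `1 - ε > 0`, so one such output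
  -- exists, and the codeword is then typical with the states and actions.
  · have h1 := h m hm
    obtain ⟨y, hy⟩ : ∃ y : Fin n → D,
        Typical (jointWeight Γ p) (s + t) (fun i => (x i, φ m i, z i, y i)) := by
      by_contra! hcon
      simp only [hcon, and_false, if_false, Finset.sum_const_zero] at h1
      linarith
    exact hy.occurrences_triple_le Γ a

end ConditionalCode

/-! ### Zero mutual information, and the slack of the product of the marginals -/

section MutualInformation

open scoped Classical

variable {A B C D : Type*} [Fintype A] [Fintype B] [Fintype C] [Fintype D]

lemma weightEntropy_const {Ω E : Type*} [Fintype Ω] {q : Ω → ℝ} (hq1 : ∑ ω, q ω = 1) (e : E) :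
    weightEntropy q (fun _ => e) = 0 := by
  simp [weightEntropy, marginal, hq1]

lemma sum_stateActionDensity (p : A × B × C → ℝ) :
    ∑ z, marginal p (fun a => (a.1, a.2.2)) z * stateActionDensity p z =
      weightEntropy p (fun a => a.1) + weightEntropy p (fun a => a.2.2) -
        weightEntropy p (fun a => (a.1, a.2.2)) := by
  rw [sum_marginal_mul]
  simp only [stateActionDensity, weightEntropy, mul_sub, Finset.sum_sub_distrib]
  ring

/-- The bound `log u ≤ u - 1` at `u = a * c / j`, with equality only at `u = 1`. The added `- j + a
* c` sums to zero when `a` and `c` run over the marginals of `j`. -/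
lemma density_term_nonneg {j a c : ℝ} (hj : 0 ≤ j) (ha : 0 ≤ a) (hc : 0 ≤ c)
    (h : j ≠ 0 → a ≠ 0 ∧ c ≠ 0) :
    0 ≤ j * (Real.log j - Real.log a - Real.log c) - j + a * c ∧
      (j * (Real.log j - Real.log a - Real.log c) - j + a * c = 0 → j = a * c) := by
  rcases hj.eq_or_lt with h0 | h0
  · rw [← h0]
    simp only [zero_mul, sub_zero, zero_add]
    exact ⟨mul_nonneg ha hc, fun h => h.symm⟩
  · obtain ⟨ha', hc'⟩ := h h0.ne'
    have ha0 := ha.lt_of_ne' ha'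
    have hc0 := hc.lt_of_ne' hc'
    have hx : 0 < a * c / j := by positivity
    have hlog : Real.log (a * c / j) = Real.log a + Real.log c - Real.log j := by
      rw [Real.log_div (by positivity) h0.ne', Real.log_mul ha' hc']
    have hxj : j * (a * c / j) = a * c := by field_simp
    constructor
    · have := mul_le_mul_of_nonneg_left (Real.log_le_sub_one_of_pos hx) h0.le
      rw [hlog] at this
      nlinarith
    · intro heq
      by_contra hne
      have hx1 : a * c / j ≠ 1 := by
        rw [Ne, div_eq_one_iff_eq h0.ne']
        exact fun h => hne h.symm
      have := mul_lt_mul_of_pos_left (Real.log_lt_sub_one_of_pos hx hx1) h0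
      rw [hlog] at this
      nlinarith

lemma sum_stateActionDensity_nonneg_and_indep {p : A × B × C → ℝ} (hp : ∀ a, 0 ≤ p a)
    (hp1 : ∑ a, p a = 1) :
    0 ≤ ∑ z, marginal p (fun a => (a.1, a.2.2)) z * stateActionDensity p z ∧
      (∑ z, marginal p (fun a => (a.1, a.2.2)) z * stateActionDensity p z = 0 →
        ∀ z, marginal p (fun a => (a.1, a.2.2)) z =
          marginal p (fun a => a.1) z.1 * marginal p (fun a => a.2.2) z.2) := by
  set QV := marginal p (fun a => (a.1, a.2.2)) with hQV
  set QA := marginal p (fun a => a.1) with hQA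
  set QC := marginal p (fun a => a.2.2) with hQC
  have h1 : ∑ z : A × C, QA z.1 * QC z.2 = 1 := by
    rw [Fintype.sum_prod_type]
    simp only
    rw [← Finset.sum_mul_sum, hQA, hQC, sum_marginal, sum_marginal, hp1, one_mul]
  have h2 : ∑ z, QV z = 1 := by rw [hQV, sum_marginal, hp1]
  have hsum : ∑ z, QV z * stateActionDensity p z =
      ∑ z, (QV z * stateActionDensity p z - QV z + QA z.1 * QC z.2) := by
    rw [Finset.sum_add_distrib, Finset.sum_sub_distrib, h1, h2]; ring
  have hterm := fun z : A × C => density_term_nonneg (marginal_nonneg hp _ z : 0 ≤ QV z)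
    (marginal_nonneg hp _ z.1 : 0 ≤ QA z.1) (marginal_nonneg hp _ z.2 : 0 ≤ QC z.2) (by
      intro hne
      have hA : QA z.1 = marginal QV (fun z => z.1) z.1 := by rw [hQV, marginal_comp]
      have hC : QC z.2 = marginal QV (fun z => z.2) z.2 := by rw [hQV, marginal_comp]
      have hpos : 0 < QV z := (marginal_nonneg hp _ z).lt_of_ne' hne
      change QA z.1 ≠ 0 ∧ QC z.2 ≠ 0
      rw [hA, hC]
      exact ⟨(marginal_pos (fun z => marginal_nonneg hp _ z) (fun z : A × C => z.1) hpos).ne',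
        (marginal_pos (fun z => marginal_nonneg hp _ z) (fun z : A × C => z.2) hpos).ne'⟩)
  rw [hsum]
  refine ⟨Finset.sum_nonneg fun z _ => (hterm z).1, fun h0 z => ?_⟩
  exact (hterm z).2 ((Finset.sum_eq_zero_iff_of_nonneg fun z _ => (hterm z).1).1 h0 z
    (Finset.mem_univ z))

lemma sum_negMulLog_mul {E F : Type*} [Fintype E] [Fintype F] {f : E → ℝ} {g : F → ℝ}
    (hf : ∑ e, f e = 1) (hg : ∑ e, g e = 1) :
    ∑ z : E × F, Real.negMulLog (f z.1 * g z.2) =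
      ∑ e, Real.negMulLog (f e) + ∑ e, Real.negMulLog (g e) := by
  simp only [Fintype.sum_prod_type, Real.negMulLog_mul, Finset.sum_add_distrib, ← Finset.sum_mul,
    ← Finset.mul_sum, hf, hg, one_mul]

/-- The product of the marginals. -/
noncomputable def productWeight (p : A × B × C → ℝ) (a : A × B × C) : ℝ :=
  marginal p (fun a => a.1) a.1 * (marginal p (fun a => a.2.1) a.2.1 *
    marginal p (fun a => a.2.2) a.2.2)

lemma productWeight_nonneg {p : A × B × C → ℝ} (hp : ∀ a, 0 ≤ p a) (a : A × B × C) :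
    0 ≤ productWeight p a :=
  mul_nonneg (marginal_nonneg hp _ _) (mul_nonneg (marginal_nonneg hp _ _) (marginal_nonneg hp _ _))

lemma marginal_productWeight_state {p : A × B × C → ℝ} (hp1 : ∑ a, p a = 1) :
    marginal (productWeight p) (fun a => a.1) = marginal p (fun a => a.1) := by
  funext a
  conv_lhs => rw [marginal]
  simp only [productWeight, Fintype.sum_prod_type]
  rw [Finset.sum_eq_single a (by simp +contextual) (by simp)]
  simp only [if_true, ← Finset.mul_sum, sum_marginal, hp1, mul_one]

/-- With independent `X₀`, `X₁`, `X₂`, the output is independent of states and actions, so the slack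
reduces to `H(Y) - H(Y|X₁) = I(X₁;Y)`. -/
lemma informationSlack_productWeight (Γ : B → PMF D) {p : A × B × C → ℝ} (hp1 : ∑ a, p a = 1) :
    informationSlack Γ (productWeight p) =
      weightEntropy (jointWeight Γ p) (fun v => v.2.2.2) - ∑ a, p a * channelEntropy Γ a.2.1 := by
  have hj1 : ∑ v, jointWeight Γ p v = 1 := by
    rw [← sum_marginal (jointWeight Γ p) (fun v => (v.1, v.2.1, v.2.2.1)), marginal_jointWeight,
        hp1]
  have hA : ∑ a, marginal p (fun a => a.1) a = 1 := by rw [sum_marginal, hp1]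
  have hC : ∑ a, marginal p (fun a => a.2.2) a = 1 := by rw [sum_marginal, hp1]
  have hB : ∑ a, marginal p (fun a => a.2.1) a = 1 := by rw [sum_marginal, hp1]
  have hY : ∑ d, marginal (jointWeight Γ p) (fun v => v.2.2.2) d = 1 := by rw [sum_marginal, hj1]
  have hYd : ∀ d, ∑ b, marginal p (fun a => a.2.1) b * (Γ b d).toReal =
      marginal (jointWeight Γ p) (fun v => v.2.2.2) d := by
    intro d
    rw [sum_marginal_mul]
    simp only [marginal, jointWeight, Fintype.sum_prod_type]
    refine Finset.sum_congr rfl fun a _ => Finset.sum_congr rfl fun b _ =>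
      Finset.sum_congr rfl fun c _ => ?_
    rw [Finset.sum_eq_single d (by simp +contextual) (by simp)]
    simp
  have m1 : ∀ z : (A × D) × C,
      marginal (jointWeight Γ (productWeight p)) (fun v => ((v.1, v.2.2.2), v.2.2.1)) z =
        (marginal p (fun a => a.1) z.1.1 * marginal (jointWeight Γ p) (fun v => v.2.2.2) z.1.2) *
          marginal p (fun a => a.2.2) z.2 := by
    rintro ⟨⟨a, d⟩, c⟩
    rw [marginal_jointWeight_output]
    simp only [productWeight, ← hYd, Finset.mul_sum, Finset.sum_mul]
    exact Finset.sum_congr rfl fun b _ => by ring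
  have m2 : ∀ c, marginal (jointWeight Γ (productWeight p)) (fun v => v.2.2.1) c =
      marginal p (fun a => a.2.2) c := by
    intro c
    rw [← marginal_comp (jointWeight Γ (productWeight p)) (fun v => (v.1, v.2.1, v.2.2.1))
      (fun a => a.2.2), marginal_jointWeight]
    conv_lhs => rw [marginal]
    simp only [productWeight, Fintype.sum_prod_type]
    simp only [Finset.sum_ite_eq', Finset.mem_univ, if_true, ← Finset.mul_sum, ← Finset.sum_mul,
      hA, hB, one_mul]
  have m3 : ∑ a, productWeight p a * channelEntropy Γ a.2.1 =
      ∑ a, p a * channelEntropy Γ a.2.1 := by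
    rw [← sum_marginal_mul p (fun a => a.2.1)]
    simp only [productWeight, Fintype.sum_prod_type]
    have : ∀ a b c, marginal p (fun a => a.1) a * (marginal p (fun a => a.2.1) b *
        marginal p (fun a => a.2.2) c) * channelEntropy Γ b = marginal p (fun a => a.1) a *
          (marginal p (fun a => a.2.1) b * channelEntropy Γ b * marginal p (fun a => a.2.2) c) :=
      fun a b c => by ring
    simp only [this, ← Finset.mul_sum, ← Finset.sum_mul, hA, hC, one_mul, mul_one]
  have hAY : ∑ z : A × D, marginal p (fun a => a.1) z.1 *
      marginal (jointWeight Γ p) (fun v => v.2.2.2) z.2 = 1 := by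
    rw [Fintype.sum_prod_type]
    simp only
    rw [← Finset.sum_mul_sum, hA, hY, one_mul]
  rw [informationSlack_eq_negMulLog, marginal_productWeight_state hp1, m3,
    weightEntropy_eq_sum_negMulLog]
  simp only [m1, m2]
  rw [sum_negMulLog_mul hAY hC, sum_negMulLog_mul hA hY]
  ring

/-- The left side is `I(X₁;Y|X₀,X₂) = H(Y|X₀,X₂) - H(Y|X₁)`; dropping the condition on `(X₀,X₂)`
gives `I(X₁;Y)`. -/
lemma informationSlack_productWeight_ge (Γ : B → PMF D) {p : A × B × C → ℝ} (hp : ∀ a, 0 ≤ p a)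
    (hp1 : ∑ a, p a = 1) :
    informationSlack Γ p + ∑ z, marginal p (fun a => (a.1, a.2.2)) z * stateActionDensity p z ≤
      informationSlack Γ (productWeight p) := by
  have hj1 : ∑ v, jointWeight Γ p v = 1 := by
    rw [← sum_marginal (jointWeight Γ p) (fun v => (v.1, v.2.1, v.2.2.1)), marginal_jointWeight,
        hp1]
  have h := condWeightEntropy_le_of_determines (jointWeight_nonneg Γ hp) (fun v => v.2.2.2)
    (fun v => (v.1, v.2.2.1)) (fun _ => ()) (fun _ _ _ => rfl)
  have e1 : weightEntropy (jointWeight Γ p) (fun v => (v.2.2.2, ())) =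
      weightEntropy (jointWeight Γ p) (fun v => v.2.2.2) :=
    weightEntropy_congr _ fun v w => by simp
  have e2 : weightEntropy (jointWeight Γ p) (fun v => (v.2.2.2, v.1, v.2.2.1)) =
      weightEntropy (jointWeight Γ p) (fun v => ((v.1, v.2.2.2), v.2.2.1)) :=
    weightEntropy_congr _ fun v w => by simp only [Prod.mk.injEq]; tauto
  have e3 := weightEntropy_jointWeight_comp Γ p (fun a => (a.1, a.2.2))
  have e4 := weightEntropy_jointWeight_comp Γ p (fun a => a.2.2)
  rw [condWeightEntropy, condWeightEntropy, weightEntropy_const hj1, e1, e2, e3] at h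
  rw [informationSlack_productWeight Γ hp1, sum_stateActionDensity, informationSlack,
    condWeightEntropy, e4]
  linarith

end MutualInformation

/-! ### Existence of block codes -/

section BlockCodeExistence

open scoped Classical

variable {A B C D : Type*} [Fintype A] [Fintype B] [Fintype C] [Fintype D]

/-- Most pairs of sequences of states and actions of decision-maker 2 are typical. -/
lemma sum_pair_not_typical_le {p : A × B × C → ℝ} (hp : ∀ a, 0 ≤ p a) (hp1 : ∑ a, p a = 1)
    {n : ℕ} {t : ℝ} (ht0 : 0 ≤ t) (ht : t ≤ 2) :
    ∑ x : Fin n → A, ∑ z : Fin n → C,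
      (if Typical (marginal p (fun a => (a.1, a.2.2))) t (fun i => (x i, z i)) then 0 else
        ∏ i, marginal p (fun a => (a.1, a.2.2)) (x i, z i)) ≤
      Fintype.card (A × C) * Real.exp (-(n * t ^ 2 / 4)) := by
  set QV := marginal p (fun a => (a.1, a.2.2)) with hQV
  have h := sum_prod_weight_not_typical_le (n := n) (fun _ z => QV z)
    (fun _ z => marginal_nonneg hp _ z) (fun _ => by rw [hQV, sum_marginal, hp1]) (fun _ z => z)
    QV 0 t ht0 ht (fun a => by
      rw [Finset.sum_const, Finset.card_univ, Fintype.card_fin, nsmul_eq_mul, add_zero]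
      refine le_of_eq (congrArg ((n : ℝ) * ·) ((Finset.sum_eq_single a (fun b _ h => ?_)
        fun h => absurd (Finset.mem_univ a) h).trans (if_pos rfl)))
      exact if_neg h) (fun _ _ h => h)
  rw [zero_add] at h
  refine le_trans (le_of_eq ?_) h
  rw [← Equiv.sum_comp (Equiv.arrowProdEquivProdArrow (Fin n) (fun _ => A) (fun _ => C)).symm,
    Fintype.sum_prod_type]
  rfl

lemma Typical.prod_le {p : A × B × C → ℝ} (hp : ∀ a, 0 ≤ p a) (hp1 : ∑ a, p a = 1)
    {n : ℕ} {t : ℝ} (ht0 : 0 ≤ t) {x : Fin n → A} {z : Fin n → C}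
    (hxz : Typical (marginal p (fun a => (a.1, a.2.2))) t (fun i => (x i, z i))) :
    ∏ i, marginal p (fun a => (a.1, a.2.2)) (x i, z i) ≤
      Real.exp (n * (∑ v, marginal p (fun a => (a.1, a.2.2)) v * stateActionDensity p v +
        t * (Fintype.card (A × C) * ∑ v, |stateActionDensity p v|))) *
      ((∏ i, marginal p (fun a => a.1) (x i)) * ∏ i, marginal p (fun a => a.2.2) (z i)) := by
  set QV := marginal p (fun a => (a.1, a.2.2)) with hQV
  have hdev := (abs_le.1 (hxz.abs_sum_sub_le (by rw [hQV, sum_marginal, hp1]) ht0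
    (stateActionDensity p))).2
  have hprod : ∏ i, QV (x i, z i) = Real.exp (∑ i, stateActionDensity p (x i, z i)) *
      ((∏ i, marginal p (fun a => a.1) (x i)) * ∏ i, marginal p (fun a => a.2.2) (z i)) := by
    rw [Real.exp_sum, ← Finset.prod_mul_distrib, ← Finset.prod_mul_distrib]
    refine Finset.prod_congr rfl fun i _ => ?_
    have hV : 0 < QV (x i, z i) := (marginal_nonneg hp _ _).lt_of_ne' (hxz.2 i)
    have hA : 0 < marginal p (fun a => a.1) (x i) := by
      have := marginal_pos (fun z => marginal_nonneg hp _ z) (fun z : A × C => z.1) hV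
      rwa [marginal_comp] at this
    have hC : 0 < marginal p (fun a => a.2.2) (z i) := by
      have := marginal_pos (fun z => marginal_nonneg hp _ z) (fun z : A × C => z.2) hV
      rwa [marginal_comp] at this
    rw [stateActionDensity, Real.exp_sub, Real.exp_sub, ← hQV, Real.exp_log hV, Real.exp_log hA,
      Real.exp_log hC]
    field_simp
  rw [hprod]
  refine mul_le_mul_of_nonneg_right (Real.exp_le_exp.2 ?_) ?_
  · rw [mul_add]; linarith
  · exact mul_nonneg (Finset.prod_nonneg fun i _ => marginal_nonneg hp _ _)
      (Finset.prod_nonneg fun i _ => marginal_nonneg hp _ _)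

lemma tendsto_exp_neg_nat_mul {c : ℝ} (hc : 0 < c) :
    Tendsto (fun n : ℕ => Real.exp (-(n * c))) atTop (𝓝 0) :=
  Real.tendsto_exp_neg_atTop_nhds_zero.comp
    (tendsto_natCast_atTop_atTop.atTop_mul_const hc)

lemma eventually_hasBlockCode_of_slack_pos (Γ : B → PMF D) {p : A × B × C → ℝ}
    (hp : ∀ a, 0 ≤ p a) (hp1 : ∑ a, p a = 1) (hslack : 0 < informationSlack Γ p)
    {ε : ℝ} (hε : 0 < ε) :
    ∀ᶠ n : ℕ in atTop, HasBlockCode (marginal p (fun a => a.1)) Γ p ε n := by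
  -- `exists_conditionalCode` requires `ε < 1`; for larger errors a code with error `1 / 2` serves.
  wlog hε1 : ε < 1 generalizing ε
  · filter_upwards [this (ε := 1 / 2) (by norm_num) (by norm_num)] with n hn
    exact hn.mono (by linarith) fun a => by linarith
  have hB : Nonempty B := by
    by_contra h
    rw [not_nonempty_iff] at h
    simp at hp1
  rw [informationSlack_eq_sum_density] at hslack
  have hI1 := (sum_stateActionDensity_nonneg_and_indep hp hp1).1
  set QV := marginal p (fun a => (a.1, a.2.2)) with hQV
  set I₁ := ∑ z, QV z * stateActionDensity p z with hI₁
  set I₂ := ∑ v, jointWeight Γ p v * channelDensity Γ p v with hI₂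
  set κ₁ := Fintype.card (A × C) * ∑ v, |stateActionDensity p v| with hκ₁
  set κ₂ := Fintype.card (A × B × C × D) * ∑ v, |channelDensity Γ p v| with hκ₂
  have hκ₁0 : 0 ≤ κ₁ := by positivity
  have hκ₂0 : 0 ≤ κ₂ := by positivity
  -- The rate `R` lies at distance `2 * Δ` from both informations: one `Δ` absorbs the typicality
  -- margins, the other gives the exponential decay.
  set Δ := (I₂ - I₁) / 4 with hΔ
  have hΔ0 : 0 < Δ := by rw [hΔ]; linarith
  set R := (I₁ + I₂) / 2 with hR
  obtain ⟨t, ht0, ht2, ht3, ht4, ht5⟩ : ∃ t : ℝ, 0 < t ∧ t ≤ 2 ∧ t * κ₁ ≤ Δ ∧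
      (t + t) * κ₂ ≤ Δ ∧ Fintype.card D * (t + t) ≤ ε := by
    have hev : ∀ k : ℝ, ∀ c : ℝ, 0 < c → ∀ᶠ t : ℝ in 𝓝[>] 0, t * k ≤ c := fun k c hc => by
      have : Tendsto (fun t : ℝ => t * k) (𝓝[>] 0) (𝓝 (0 * k)) :=
        (continuous_id.mul continuous_const).continuousWithinAt.tendsto
      rw [zero_mul] at this
      exact (this.eventually_lt_const hc).mono fun t h => h.le
    obtain ⟨t, h1, h2, h3, h4, h5⟩ := ((eventually_mem_nhdsWithin (a := (0 : ℝ))).and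
      ((hev 1 2 (by norm_num)).and ((hev κ₁ Δ hΔ0).and ((hev (2 * κ₂) Δ hΔ0).and
        (hev (2 * Fintype.card D) ε hε))))).exists
    exact ⟨t, h1, by linarith, h3, by linarith, by linarith⟩
  have hlim1 : ∀ᶠ n : ℕ in atTop, Fintype.card (A × C) * Real.exp (-(n * (t ^ 2 / 4))) +
      Real.exp (-Real.exp (n * Δ)) ≤ ε := by
    have h1 := (tendsto_exp_neg_nat_mul (c := t ^ 2 / 4) (by positivity)).const_mul
      (Fintype.card (A × C) : ℝ)
    have h2 : Tendsto (fun n : ℕ => Real.exp (-Real.exp (n * Δ))) atTop (𝓝 0) :=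
      Real.tendsto_exp_neg_atTop_nhds_zero.comp (Real.tendsto_exp_atTop.comp
        (tendsto_natCast_atTop_atTop.atTop_mul_const hΔ0))
    have h3 := h1.add h2
    rw [mul_zero, add_zero] at h3
    exact (h3.eventually_lt_const hε).mono fun n h => h.le
  have hlim2 : ∀ᶠ n : ℕ in atTop, Fintype.card (A × B × C × D) *
      Real.exp (-(n * (t ^ 2 / 4))) + 2 * Real.exp (-(n * Δ)) ≤ ε := by
    have h1 := (tendsto_exp_neg_nat_mul (c := t ^ 2 / 4) (by positivity)).const_mul
      (Fintype.card (A × B × C × D) : ℝ)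
    have h2 := (tendsto_exp_neg_nat_mul hΔ0).const_mul 2
    have h3 := h1.add h2
    rw [mul_zero, mul_zero, add_zero] at h3
    exact (h3.eventually_lt_const hε).mono fun n h => h.le
  filter_upwards [hlim1, hlim2] with n hn1 hn2
  set K := ⌈Real.exp (n * R)⌉₊ with hK
  have hKge : Real.exp (n * R) ≤ K := Nat.le_ceil _
  -- Rounding up at most doubles, because `R ≥ 0`.
  have hKle : (K : ℝ) ≤ 2 * Real.exp (n * R) := by
    have h1 := (Nat.ceil_lt_add_one (Real.exp_pos (n * R)).le).le
    have h2 : 1 ≤ Real.exp (n * R) := Real.one_le_exp (by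
      have : 0 ≤ R := by rw [hR]; linarith
      positivity)
    rw [← hK] at h1
    linarith
  have hn0 : (0 : ℝ) ≤ n := Nat.cast_nonneg n
  obtain ⟨c, hc⟩ := exists_covering (fun x : Fin n → A => ∏ i, marginal p (fun a => a.1) (x i))
    (fun z : Fin n → C => ∏ i, marginal p (fun a => a.2.2) (z i))
    (fun x z => ∏ i, QV (x i, z i)) (fun x z => Typical QV t (fun i => (x i, z i)))
    (Real.exp (n * (I₁ + t * κ₁))) _ (Real.one_le_exp (by positivity))
    (fun x => Finset.prod_nonneg fun i _ => marginal_nonneg hp _ _)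
    (fun x => Finset.prod_nonneg fun i _ => marginal_nonneg hp _ _)
    (fun x z => Finset.prod_nonneg fun i _ => marginal_nonneg hp _ _)
    (sum_prod_weight_eq_one (w := fun _ a => marginal p (fun a => a.1) a) fun _ => by
      rw [sum_marginal, hp1])
    (sum_prod_weight_eq_one (w := fun _ a => marginal p (fun a => a.2.2) a) fun _ => by
      rw [sum_marginal, hp1])
    (fun x => by
      have := Finset.prod_univ_sum (fun _ : Fin n => (Finset.univ : Finset C))
        (fun i c => QV (x i, c))
      rw [Fintype.piFinset_univ] at this
      rw [← this]
      refine Finset.prod_congr rfl fun i _ => ?_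
      rw [← marginal_comp p (fun a => (a.1, a.2.2)) (fun z => z.1), ← hQV]
      simp only [marginal, Fintype.sum_prod_type]
      rw [Finset.sum_eq_single (x i) (by simp +contextual) (by simp)]
      simp [hQV])
    (fun x z hxz => hxz.prod_le hp hp1 ht0.le) (sum_pair_not_typical_le hp hp1 ht0.le ht2) K
  refine HasBlockCode.of_covering (K := K) (Nat.ceil_pos.2 (Real.exp_pos _))
    (fun x z => Typical QV t (fun i => (x i, z i))) c (le_trans (by convert hc) ?_)
        fun x z hxz => ?_
  · refine le_trans ?_ hn1
    rw [mul_div_assoc]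
    refine add_le_add le_rfl (Real.exp_le_exp.2 (neg_le_neg ?_))
    rw [le_div_iff₀ (Real.exp_pos _), ← Real.exp_add]
    refine le_trans (Real.exp_le_exp.2 ?_) hKge
    rw [← mul_add]
    refine mul_le_mul_of_nonneg_left ?_ hn0
    rw [hR]; linarith
  · obtain ⟨φ, ψ, h1, h2⟩ := exists_conditionalCode Γ hp hp1 (K := K) (ε := ε) ht0.le ht0.le ht2 hε1
      hxz (by
        refine le_trans ?_ hn2
        rw [mul_div_assoc]
        refine add_le_add le_rfl ?_
        rw [div_le_iff₀ (Real.exp_pos _), mul_assoc, ← Real.exp_add]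
        refine hKle.trans (mul_le_mul_of_nonneg_left (Real.exp_le_exp.2 ?_) (by norm_num))
        rw [← sub_eq_neg_add, ← mul_sub]
        refine mul_le_mul_of_nonneg_left ?_ hn0
        rw [hR]; linarith)
    exact ⟨φ, ψ, h1, fun m hm a => (h2 m hm a).trans (by gcongr)⟩

lemma eventually_hasBlockCode_of_indep (Γ : B → PMF D) {p : A × B × C → ℝ}
    (hp : ∀ a, 0 ≤ p a) (hp1 : ∑ a, p a = 1)
    (hind : ∀ z, marginal p (fun a => (a.1, a.2.2)) z =
      marginal p (fun a => a.1) z.1 * marginal p (fun a => a.2.2) z.2)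
    {ε : ℝ} (hε : 0 < ε) :
    ∀ᶠ n : ℕ in atTop, HasBlockCode (marginal p (fun a => a.1)) Γ p ε n := by
  have hB : Nonempty B := by
    by_contra h
    rw [not_nonempty_iff] at h
    simp at hp1
  set QV := marginal p (fun a => (a.1, a.2.2)) with hQV
  obtain ⟨t, ht0, ht2, ht5⟩ : ∃ t : ℝ, 0 < t ∧ t ≤ 2 ∧ Fintype.card D * (t + t) ≤ ε := by
    refine ⟨min 2 (ε / (2 * (Fintype.card D + 1))), by positivity, min_le_left _ _, ?_⟩
    have h1 := min_le_right 2 (ε / (2 * ((Fintype.card D : ℝ) + 1)))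
    rw [le_div_iff₀ (by positivity)] at h1
    have h2 : 0 ≤ min 2 (ε / (2 * ((Fintype.card D : ℝ) + 1))) := by positivity
    linarith
  have hlim : ∀ k : ℝ, ∀ c : ℝ, 0 < c →
      ∀ᶠ n : ℕ in atTop, k * Real.exp (-(n * (t ^ 2 / 4))) < c := fun k c hc => by
    have h1 := (tendsto_exp_neg_nat_mul (c := t ^ 2 / 4) (by positivity)).const_mul k
    rw [mul_zero] at h1
    exact h1.eventually_lt_const hc
  filter_upwards [hlim (Fintype.card (A × C)) ε hε,
    hlim (Fintype.card (A × B × C × D)) 1 one_pos] with n hn1 hn2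
  rw [← mul_div_assoc] at hn1 hn2
  -- By independence the joint weight is a product, so a random action sequence is typical with most
  -- states on average; one fixed sequence does at least as well.
  obtain ⟨c, hc⟩ : ∃ c : Fin n → C, ∑ x : Fin n → A, (if Typical QV t (fun i => (x i, c i)) then 0
      else ∏ i, marginal p (fun a => a.1) (x i)) ≤ ε := by
    by_contra! hcon
    have h1 := sum_pair_not_typical_le hp hp1 (n := n) ht0.le ht2
    rw [← hQV, Finset.sum_comm] at h1
    have h2 : ∑ c : Fin n → C, (∏ i, marginal p (fun a => a.2.2) (c i)) * ε ≤
        ∑ c : Fin n → C, (∏ i, marginal p (fun a => a.2.2) (c i)) *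
          ∑ x : Fin n → A, (if Typical QV t (fun i => (x i, c i)) then 0
            else ∏ i, marginal p (fun a => a.1) (x i)) :=
      Finset.sum_le_sum fun c _ => mul_le_mul_of_nonneg_left (hcon c).le
        (Finset.prod_nonneg fun i _ => marginal_nonneg hp _ _)
    rw [← Finset.sum_mul, sum_prod_weight_eq_one (w := fun _ a => marginal p (fun a => a.2.2) a)
      fun _ => by rw [sum_marginal, hp1], one_mul] at h2
    have h3 : ∑ c : Fin n → C, (∏ i, marginal p (fun a => a.2.2) (c i)) *
          ∑ x : Fin n → A, (if Typical QV t (fun i => (x i, c i)) then 0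
            else ∏ i, marginal p (fun a => a.1) (x i)) =
        ∑ c : Fin n → C, ∑ x : Fin n → A, (if Typical QV t (fun i => (x i, c i)) then 0
            else ∏ i, QV (x i, c i)) := by
      simp only [Finset.mul_sum, mul_ite, mul_zero, hind, Finset.prod_mul_distrib]
      refine Finset.sum_congr rfl fun c _ => Finset.sum_congr rfl fun x _ => ?_
      rw [mul_comm]
    linarith
  refine HasBlockCode.of_covering (K := 1) one_pos (fun x z => Typical QV t (fun i => (x i, z i)))
    (fun _ => c) ?_ fun x z hxz => ?_
  · refine le_trans (le_of_eq (Finset.sum_congr rfl fun x _ => ?_)) hc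
    have : (∃ m < 1, Typical QV t (fun i => (x i, c i))) ↔ Typical QV t (fun i => (x i, c i)) :=
      ⟨fun ⟨_, _, h⟩ => h, fun h => ⟨0, one_pos, h⟩⟩
    simp only [this]
  -- There is only the message `0`, so the decoder is constant, and one input sequence typical with
  -- `(x, z)` suffices.
  · have h1 := sum_inputKernel_not_typical_le Γ hp ht0.le ht0.le ht2 hxz
    obtain ⟨b, y, hby⟩ : ∃ (b : Fin n → B) (y : Fin n → D),
        Typical (jointWeight Γ p) (t + t) (fun i => (x i, b i, z i, y i)) := by
      by_contra! hcon
      simp only [hcon, if_false] at h1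
      have h2 : ∀ b : Fin n → B, ∑ y : Fin n → D, ∏ i, (Γ (b i) (y i)).toReal = 1 := fun b =>
        sum_prod_weight_eq_one (w := fun i d => (Γ (b i) d).toReal) fun i => PMF.sum_toReal _
      simp only [h2, mul_one] at h1
      rw [sum_prod_weight_eq_one (w := fun i b => inputKernel p (x i, z i) b)
        fun i => sum_inputKernel (hxz.2 i)] at h1
      linarith
    refine ⟨fun _ => b, fun _ => 0, fun m hm => ?_, fun m _ a =>
      (hby.occurrences_triple_le Γ a).trans (by gcongr)⟩
    have : m = 0 := by omega
    simp [this, hε.le]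

/-- Block codes exist whenever the slack is nonnegative. -/
lemma eventually_hasBlockCode (Γ : B → PMF D) {p : A × B × C → ℝ}
    (hp : ∀ a, 0 ≤ p a) (hp1 : ∑ a, p a = 1) (hslack : 0 ≤ informationSlack Γ p)
    {ε : ℝ} (hε : 0 < ε) :
    ∀ᶠ n : ℕ in atTop, HasBlockCode (marginal p (fun a => a.1)) Γ p ε n := by
  obtain ⟨hI, hind⟩ := sum_stateActionDensity_nonneg_and_indep hp hp1
  rcases hI.eq_or_lt with h0 | h0
  · exact eventually_hasBlockCode_of_indep Γ hp hp1 (hind h0.symm) hε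
  · have hpos : 0 < informationSlack Γ (productWeight p) := by
      have := informationSlack_productWeight_ge Γ hp hp1
      linarith
    -- Mixing raises each probability by at most `l ≤ ε / 2`; the other half of `ε` is left to the
    -- code.
    set l := min (ε / 2) (1 / 2) with hl
    have hl0 : 0 < l := by positivity
    have hl1 : l ≤ 1 / 2 := min_le_right _ _
    have hl2 : l ≤ ε / 2 := min_le_left _ _
    have hprod1 : ∑ a, productWeight p a = 1 := by
      rw [← sum_marginal (productWeight p) (fun a => a.1), marginal_productWeight_state hp1,
        sum_marginal, hp1]
    let w : Bool → ℝ := fun i => if i then l else 1 - l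
    let P : Bool → A × B × C → ℝ := fun i => if i then productWeight p else p
    have hw : ∀ i, 0 ≤ w i := by
      rintro (_ | _) <;> simp only [w] <;> norm_num <;> linarith
    have hw1 : ∑ i, w i = 1 := by simp [w]
    have hP : ∀ i a, 0 ≤ P i a := by
      rintro (_ | _) a
      · exact hp a
      · exact productWeight_nonneg hp a
    have hPρ : ∀ i, marginal (P i) (fun a => a.1) = marginal p (fun a => a.1) := by
      rintro (_ | _)
      · rfl
      · exact marginal_productWeight_state hp1
    have hle := sum_mul_informationSlack_le Γ w hw hw1 P hP _ hPρ
    set p' : A × B × C → ℝ := fun a => ∑ i, w i * P i a with hp'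
    have hp'eq : ∀ a, p' a = l * productWeight p a + (1 - l) * p a := fun a => by
      simp [hp', w, P]
    have hslack' : 0 < informationSlack Γ p' := by
      refine lt_of_lt_of_le ?_ hle
      simp only [Fintype.sum_bool, w, P, if_true]
      have h1 : 0 ≤ (1 - l) * informationSlack Γ p := mul_nonneg (by linarith) hslack
      have h2 := mul_pos hl0 hpos
      simpa using by linarith
    have hp'0 : ∀ a, 0 ≤ p' a := fun a => Finset.sum_nonneg fun i _ => mul_nonneg (hw i) (hP i a)
    have hp'1 : ∑ a, p' a = 1 := by
      simp only [hp'eq, Finset.sum_add_distrib, ← Finset.mul_sum, hprod1, hp1]; ring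
    have hmarg : marginal p' (fun a => a.1) = marginal p (fun a => a.1) := by
      funext a
      rw [hp', marginal_sum]
      simp_rw [marginal_const_mul, hPρ, ← Finset.sum_mul, hw1, one_mul]
    have h := eventually_hasBlockCode_of_slack_pos Γ hp'0 hp'1 hslack' (half_pos hε)
    rw [hmarg] at h
    filter_upwards [h] with n hn
    refine hn.mono (by linarith) fun a => ?_
    have h1 : productWeight p a ≤ 1 := by
      rw [← hprod1]
      exact Finset.single_le_sum (fun a _ => productWeight_nonneg hp a) (Finset.mem_univ a)
    rw [hp'eq]
    have := mul_le_mul_of_nonneg_left h1 hl0.le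
    have := mul_nonneg hl0.le (hp a)
    linarith

end BlockCodeExistence

/-! ### Measurability, and one-sided bounds on stage laws -/

section Measurability

open scoped Classical

/-- The set is the preimage of a subset of a finite discrete space, so no measurable structure on
the actions of decision-maker 2 is needed. -/
lemma measurableSet_of_finite_dependence {E : Type*} [Fintype E] [MeasurableSpace E]
    [DiscreteMeasurableSpace E] (n : ℕ) (S : Set (ℕ → E))
    (hS : ∀ y y' : ℕ → E, (∀ j < n, y j = y' j) → y ∈ S → y' ∈ S) : MeasurableSet S := by
  let r : (ℕ → E) → Fin n → E := fun y j => y j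
  have hr : Measurable r := by fun_prop
  have h : S = r ⁻¹' (r '' S) := by
    refine Set.Subset.antisymm (Set.subset_preimage_image r S) ?_
    rintro y ⟨y', hy', hyy'⟩
    exact hS y' y (fun j hj => congrFun hyy' ⟨j, hj⟩) hy'
  rw [h]
  exact hr (Set.toFinite _).measurableSet

/-- Superadditivity needs no measurability of `f`. Since only upper bounds on stage laws are used,
measurability in the state sequence never has to be checked. -/
lemma sum_lintegral_le_lintegral_sum {Ω ι : Type*} [MeasurableSpace Ω] (μ : Measure Ω)
    (s : Finset ι) (f : ι → Ω → ℝ≥0∞) : ∑ i ∈ s, ∫⁻ x, f i x ∂μ ≤ ∫⁻ x, ∑ i ∈ s, f i x ∂μ := by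
  induction s using Finset.induction_on with
  | empty => simp
  | insert i s hi ih =>
    simp only [Finset.sum_insert hi]
    exact (add_le_add le_rfl ih).trans (le_lintegral_add _ _)

variable {A B C D : Type*} [Fintype D] [MeasurableSpace A] [MeasurableSpace B]
  [MeasurableSpace D] [DiscreteMeasurableSpace D]

lemma StrategyPair.sum_stageLaw_le_lintegral (s : StrategyPair A B C D) (ρ : PMF A)
    (Γ : B → PMF D) (i : ℕ) (a : A × B × C) :
    ∑ d, s.stageLaw ρ Γ i (a.1, a.2.1, a.2.2, d) ≤
      ∫⁻ x, s.observationLaw Γ x {y | (x i, s.action₁ x i, s.action₂ x y i) = a}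
        ∂(Measure.infinitePi fun _ : ℕ => ρ.toMeasure) := by
  refine (sum_lintegral_le_lintegral_sum _ _ _).trans (lintegral_mono fun x => ?_)
  rw [← measure_biUnion_finset]
  · refine measure_mono fun y hy => ?_
    simp only [Set.mem_iUnion, Set.mem_ofPred_eq, Finset.mem_univ, exists_true_left] at hy
    obtain ⟨d, hd⟩ := hy
    simp only [Prod.mk.injEq] at hd
    simp [hd]
  · intro d _ d' _ hdd'
    rw [Function.onFun, Set.disjoint_left]
    intro y h1 h2
    simp only [Set.mem_ofPred_eq, Prod.mk.injEq] at h1 h2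
    exact hdd' (h1.2.2.2.symm.trans h2.2.2.2)
  · intro d _
    refine measurableSet_of_finite_dependence (i + 1) _ fun y y' hyy' hy => ?_
    have h := s.action₂_congr i (x := x) (x' := x) (fun _ _ => rfl)
      fun j hj => hyy' j (hj.trans (Nat.lt_succ_self i))
    simp only [Set.mem_ofPred_eq, ← h, ← hyy' i (Nat.lt_succ_self i)] at hy ⊢
    exact hy

end Measurability

/-! ### Block schemes: strategies and the performance of one block -/

/-- A sequence of block codes of lengths `len b`, used one after the other. -/
structure BlockScheme (A B C D : Type*) where
  /-- the length of block `b` -/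
  len : ℕ → ℕ
  len_pos : ∀ b, 0 < len b
  /-- the message about the states of block `b` -/
  enc : ∀ b, (Fin (len b) → A) → ℕ
  /-- the actions of decision-maker 2 in block `b` -/
  book : ∀ b, ℕ → Fin (len b) → C
  /-- the actions of decision-maker 1 in block `b`, given the states and the next message -/
  input : ∀ b, (Fin (len b) → A) → ℕ → Fin (len b) → B
  /-- the decoder of the next message -/
  dec : ∀ b, (Fin (len b) → A) → (Fin (len b) → D) → ℕ

namespace BlockScheme

variable {A B C D : Type*} (S : BlockScheme A B C D)

/-- The first stage of block `b`. -/
def start (b : ℕ) : ℕ := ∑ k ∈ Finset.range b, S.len k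

lemma start_zero : S.start 0 = 0 := rfl

lemma start_succ (b : ℕ) : S.start (b + 1) = S.start b + S.len b := Finset.sum_range_succ _ _

lemma strictMono_start : StrictMono S.start :=
  strictMono_nat_of_lt_succ fun b => by rw [start_succ]; exact Nat.lt_add_of_pos_right (S.len_pos b)

lemma le_start (b : ℕ) : b ≤ S.start b := S.strictMono_start.le_apply

/-- The block of stage `i`. -/
def blockOf (i : ℕ) : ℕ := Nat.findGreatest (fun b => S.start b ≤ i) i

lemma start_blockOf_le (i : ℕ) : S.start (S.blockOf i) ≤ i :=
  Nat.findGreatest_spec (P := fun b => S.start b ≤ i) (Nat.zero_le i) (Nat.zero_le i)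

lemma le_blockOf {b i : ℕ} (h : S.start b ≤ i) : b ≤ S.blockOf i :=
  Nat.le_findGreatest ((S.le_start b).trans h) h

lemma lt_start_blockOf_succ (i : ℕ) : i < S.start (S.blockOf i + 1) := by
  by_contra h
  exact absurd (S.le_blockOf (not_lt.1 h)) (by omega)

lemma blockOf_start_add (b j : ℕ) (hj : j < S.len b) : S.blockOf (S.start b + j) = b := by
  refine le_antisymm ?_ (S.le_blockOf (Nat.le_add_right _ _))
  by_contra h
  have h1 : S.start (b + 1) ≤ S.start (S.blockOf (S.start b + j)) :=
    S.strictMono_start.monotone (by omega)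
  have h2 := S.start_blockOf_le (S.start b + j)
  rw [start_succ] at h1
  omega

/-- The entries of a sequence in block `b`. -/
def window {E : Type*} (b : ℕ) (x : ℕ → E) (j : Fin (S.len b)) : E := x (S.start b + j)

lemma window_congr {E : Type*} {b : ℕ} {x x' : ℕ → E}
    (h : ∀ i < S.start (b + 1), x i = x' i) : S.window b x = S.window b x' := by
  funext j
  exact h _ (by rw [start_succ]; exact Nat.add_lt_add_left j.isLt _)

lemma measurable_window {E : Type*} [MeasurableSpace E] (b : ℕ) :
    Measurable (S.window (E := E) b) := by
  unfold window
  fun_prop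

variable [Nonempty A] [Nonempty B] [Nonempty C] [Nonempty D]

/-- The strategies given by a sequence of block codes, when decision-maker 1 knows `θ x₀` instead
of the sequence of states `x₀`. -/
noncomputable def strategy [Fintype A] [MeasurableSpace A] [DiscreteMeasurableSpace A]
    [MeasurableSpace B] (θ : (ℕ → A) → ℕ → A) (hθ : Measurable θ) : StrategyPair A B C D where
  σ i x _ := extendSeq (S.input (S.blockOf i) (S.window (S.blockOf i) (θ x))
    (S.enc (S.blockOf i + 1) (S.window (S.blockOf i + 1) (θ x)))) (i - S.start (S.blockOf i))
  -- The previous block is decoded from its states and observations alone, so errors do not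
  -- propagate. In block `0` the index `S.blockOf i - 1` is `0` and the action is meaningless;
  -- `blockLoss` writes this block off.
  τ i x y _ := extendSeq (S.book (S.blockOf i) (S.dec (S.blockOf i - 1)
    (S.window (S.blockOf i - 1) (extendSeq x)) (S.window (S.blockOf i - 1) (extendSeq y))))
    (i - S.start (S.blockOf i))
  measurable_σ i h := by
    have h1 : Measurable fun x : ℕ → A => (S.window (S.blockOf i) (θ x),
        S.window (S.blockOf i + 1) (θ x)) :=
      ((S.measurable_window _).comp hθ).prodMk ((S.measurable_window _).comp hθ)
    exact (measurable_of_finite fun w : (Fin (S.len (S.blockOf i)) → A) ×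
      (Fin (S.len (S.blockOf i + 1)) → A) => (extendSeq (S.input (S.blockOf i) w.1
        (S.enc (S.blockOf i + 1) w.2)) (i - S.start (S.blockOf i)) : B)).comp h1

section Actions

variable [Fintype A] [MeasurableSpace A] [DiscreteMeasurableSpace A] [MeasurableSpace B]
  (θ : (ℕ → A) → ℕ → A) (hθ : Measurable θ)

lemma action₁_strategy (x : ℕ → A) (b : ℕ) (j : Fin (S.len b)) :
    (S.strategy θ hθ).action₁ x (S.start b + j) =
      S.input b (S.window b (θ x)) (S.enc (b + 1) (S.window (b + 1) (θ x))) j := by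
  rw [StrategyPair.action₁]
  simp only [strategy]
  rw [S.blockOf_start_add b j j.isLt, Nat.add_sub_cancel_left, extendSeq_apply _ j.isLt]

lemma action₂_strategy (x : ℕ → A) (y : ℕ → D) (b : ℕ) (j : Fin (S.len (b + 1))) :
    (S.strategy θ hθ).action₂ x y (S.start (b + 1) + j) =
      S.book (b + 1) (S.dec b (S.window b x) (S.window b y)) j := by
  rw [StrategyPair.action₂]
  simp only [strategy]
  rw [S.blockOf_start_add (b + 1) j j.isLt, Nat.add_sub_cancel_left, extendSeq_apply _ j.isLt,
    Nat.add_sub_cancel]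
  rw [S.window_congr (x := extendSeq fun k : Fin (S.start (b + 1) + j) => x k) (x' := x)
      (fun i hi => extendSeq_apply _ (by omega)),
    S.window_congr (x := extendSeq fun k : Fin (S.start (b + 1) + j) => y k) (x' := y)
      (fun i hi => extendSeq_apply _ (by omega))]

end Actions

end BlockScheme

namespace BlockScheme

open scoped Classical

variable {A B C D : Type*} (S : BlockScheme A B C D)

lemma injective_start_add (b : ℕ) : Function.Injective fun j : Fin (S.len b) => S.start b + j :=
  fun j j' h => Fin.ext (by simpa using h)

lemma measure_window_not_mem_le [Fintype A] [MeasurableSpace A] [DiscreteMeasurableSpace A]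
    (ρ : PMF A) {b : ℕ} {G : Set (Fin (S.len b) → A)} {ε : ℝ}
    (hG : ∑ w, (if w ∈ G then 0 else ∏ j, (ρ (w j)).toReal) ≤ ε) :
    Measure.infinitePi (fun _ : ℕ => ρ.toMeasure) {x | S.window b x ∉ G} ≤ ENNReal.ofReal ε := by
  have h := infinitePi_window (fun _ => ρ) (S.injective_start_add b) Gᶜ
  have h1 : {x : ℕ → A | S.window b x ∉ G} =
      {x | (fun j : Fin (S.len b) => x (S.start b + j)) ∈ Gᶜ} := rfl
  rw [h1, h]
  refine le_trans (le_of_eq ?_) (ENNReal.ofReal_le_ofReal hG)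
  rw [ENNReal.ofReal_sum_of_nonneg fun w _ => by
    split_ifs
    · exact le_rfl
    · exact Finset.prod_nonneg fun j _ => ENNReal.toReal_nonneg]
  refine Finset.sum_congr rfl fun w _ => ?_
  by_cases hw : w ∈ G
  · simp [hw]
  · simp only [hw, Set.mem_compl_iff, not_false_iff, if_true, if_false]
    rw [← ENNReal.toReal_prod, ENNReal.ofReal_toReal]
    exact ENNReal.prod_ne_top fun j _ => ρ.apply_ne_top _

variable [Nonempty A] [Nonempty B] [Nonempty C] [Nonempty D] [Fintype A] [Fintype D]
  [MeasurableSpace A] [DiscreteMeasurableSpace A] [MeasurableSpace B]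
  [MeasurableSpace D] [DiscreteMeasurableSpace D]

lemma observationLaw_decoding_error_le {θ : (ℕ → A) → ℕ → A} (hθ : Measurable θ) (Γ : B → PMF D)
    (x : ℕ → A) {b : ℕ} (hx : ∀ i < S.start (b + 2), θ x i = x i) {ε : ℝ}
    (hdec : ∑ y, (if S.dec b (S.window b x) y = S.enc (b + 1) (S.window (b + 1) x) then 0 else
      ∏ j, (Γ (S.input b (S.window b x) (S.enc (b + 1) (S.window (b + 1) x)) j) (y j)).toReal) ≤
          ε) :
    (S.strategy θ hθ).observationLaw Γ x {y | S.dec b (S.window b x) (S.window b y) ≠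
      S.enc (b + 1) (S.window (b + 1) x)} ≤ ENNReal.ofReal ε := by
  have h := infinitePi_window (fun i => Γ ((S.strategy θ hθ).action₁ x i))
    (S.injective_start_add b)
    {w | S.dec b (S.window b x) w ≠ S.enc (b + 1) (S.window (b + 1) x)}
  have h1 : {y : ℕ → D | S.dec b (S.window b x) (S.window b y) ≠
      S.enc (b + 1) (S.window (b + 1) x)} = {y | (fun j : Fin (S.len b) => y (S.start b + j)) ∈
        {w | S.dec b (S.window b x) w ≠ S.enc (b + 1) (S.window (b + 1) x)}} := rfl
  rw [h1, StrategyPair.observationLaw, h]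
  refine le_trans (le_of_eq ?_) (ENNReal.ofReal_le_ofReal hdec)
  rw [ENNReal.ofReal_sum_of_nonneg fun w _ => by
    split_ifs
    · exact le_rfl
    · exact Finset.prod_nonneg fun j _ => ENNReal.toReal_nonneg]
  refine Finset.sum_congr rfl fun w _ => ?_
  have hw1 : S.window b (θ x) = S.window b x := S.window_congr fun i hi =>
    hx i (hi.trans_le (S.strictMono_start.monotone (by omega)))
  have hw2 : S.window (b + 1) (θ x) = S.window (b + 1) x := S.window_congr fun i hi => hx i hi
  simp only [S.action₁_strategy, hw1, hw2, Set.mem_ofPred_eq]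
  by_cases hw : S.dec b (S.window b x) w = S.enc (b + 1) (S.window (b + 1) x)
  · simp [hw]
  · simp only [hw, ne_eq, not_false_iff, if_true, if_false]
    rw [← ENNReal.toReal_prod, ENNReal.ofReal_toReal]
    exact ENNReal.prod_ne_top fun j _ => PMF.apply_ne_top _ _

/-- In a block that follows a compatible block, triples have almost the right frequency. -/
lemma sum_stageLaw_block_le {θ : (ℕ → A) → ℕ → A} (hθ : Measurable θ) (ρ : PMF A) (Γ : B → PMF D)
    {p : A × B × C → ℝ} (hp : ∀ a, 0 ≤ p a) {ε : ℝ} (hε : 0 ≤ ε) {b : ℕ}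
    (hx : ∀ x, ∀ i < S.start (b + 2), θ x i = x i)
    (G : Set (Fin (S.len b) → A)) (G' : Set (Fin (S.len (b + 1)) → A))
    (hG : ∑ w, (if w ∈ G then 0 else ∏ j, (ρ (w j)).toReal) ≤ ε)
    (hG' : ∑ w, (if w ∈ G' then 0 else ∏ j, (ρ (w j)).toReal) ≤ ε)
    (hdec : ∀ w ∈ G, ∀ w', ∑ y, (if S.dec b w y = S.enc (b + 1) w' then 0 else
      ∏ j, (Γ (S.input b w (S.enc (b + 1) w') j) (y j)).toReal) ≤ ε)
    (hocc : ∀ w ∈ G', ∀ m a, occurrences (fun j => (w j, S.input (b + 1) w m j,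
      S.book (b + 1) (S.enc (b + 1) w) j)) a ≤ S.len (b + 1) * (p a + ε)) (a : A × B × C) :
    ∑ j : Fin (S.len (b + 1)), ∑ d, (S.strategy θ hθ).stageLaw ρ Γ (S.start (b + 1) + j)
      (a.1, a.2.1, a.2.2, d) ≤ ENNReal.ofReal (S.len (b + 1) * (p a + 4 * ε)) := by
  set s := S.strategy θ hθ with hs
  set μ := Measure.infinitePi (fun _ : ℕ => ρ.toMeasure) with hμ
  set N : Set (ℕ → A) := {x | S.window b x ∉ G} with hN
  set N' : Set (ℕ → A) := {x | S.window (b + 1) x ∉ G'} with hN'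
  have hNm : MeasurableSet N := S.measurable_window b (Set.toFinite Gᶜ).measurableSet
  have hNm' : MeasurableSet N' := S.measurable_window (b + 1) (Set.toFinite G'ᶜ).measurableSet
  -- The `4 * ε` of the conclusion: two here, from the frequency bound and the decoding error, and
  -- one for each exceptional set of states, `N` and `N'`.
  set c₁ : ℝ≥0∞ := ENNReal.ofReal (S.len (b + 1) * (p a + ε)) + S.len (b + 1)
      * ENNReal.ofReal ε with hc₁
  have hpoint : ∀ x, ∑ j : Fin (S.len (b + 1)), s.observationLaw Γ x {y | (x (S.start (b + 1) + j),
      s.action₁ x (S.start (b + 1) + j), s.action₂ x y (S.start (b + 1) + j)) = a} ≤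
      c₁ + (S.len (b + 1) * N.indicator 1 x + S.len (b + 1) * N'.indicator 1 x) := by
    intro x
    set w := S.window b x with hw
    set w' := S.window (b + 1) x with hw'
    set m := S.enc (b + 1) w' with hm
    -- The message sent during block `b + 1` may rest on altered states of block `b + 2`; this is
    -- harmless, since `hocc` holds for every message.
    set m' := S.enc (b + 2) (S.window (b + 2) (θ x)) with hm'
    set err := s.observationLaw Γ x {y | S.dec b w (S.window b y) ≠ m} with herr
    have : IsProbabilityMeasure (s.observationLaw Γ x) := by
      unfold StrategyPair.observationLaw; infer_instance
    have herr_le : err ≤ ENNReal.ofReal ε + N.indicator 1 x := by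
      by_cases hxN : x ∈ N
      · rw [Set.indicator_of_mem hxN]
        exact prob_le_one.trans (by simp)
      · refine le_add_right (S.observationLaw_decoding_error_le hθ Γ x (hx x) ?_)
        exact hdec _ (not_not.1 hxN) _
    -- Unless decoding failed, the triple played is the intended one.
    have hstage : ∀ j : Fin (S.len (b + 1)), s.observationLaw Γ x {y | (x (S.start (b + 1) + j),
        s.action₁ x (S.start (b + 1) + j), s.action₂ x y (S.start (b + 1) + j)) = a} ≤
        (if (w' j, S.input (b + 1) w' m' j, S.book (b + 1) m j) = a then 1 else 0) + err := by
      intro j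
      have h1 : s.action₁ x (S.start (b + 1) + j) = S.input (b + 1) w' m' j := by
        rw [hs, S.action₁_strategy, S.window_congr (hx x)]
      by_cases hcase : (w' j, S.input (b + 1) w' m' j, S.book (b + 1) m j) = a
      · rw [if_pos hcase]
        exact prob_le_one.trans (by simp)
      · rw [if_neg hcase, zero_add]
        refine measure_mono fun y hy => ?_
        intro hdec'
        refine hcase ?_
        rw [← hy, h1, hs, S.action₂_strategy, ← hw, hdec']
        rfl
    have hfreq : ∑ j : Fin (S.len (b + 1)),
        (if (w' j, S.input (b + 1) w' m' j, S.book (b + 1) m j) = a then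
        (1 : ℝ≥0∞) else 0) ≤ ENNReal.ofReal (S.len (b + 1) * (p a + ε)) + S.len (b + 1)
            * N'.indicator 1 x := by
      by_cases hxN : x ∈ N'
      · rw [Set.indicator_of_mem hxN]
        refine le_add_left ((Finset.sum_le_sum fun j _ => (?_ : _ ≤ (1 : ℝ≥0∞))).trans ?_)
        · split_ifs <;> simp
        · simp
      · refine le_add_right (le_trans (le_of_eq ?_)
          (ENNReal.ofReal_le_ofReal (hocc w' (not_not.1 hxN) m' a)))
        rw [occurrences, ENNReal.ofReal_sum_of_nonneg fun j _ => by split_ifs <;> simp]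
        refine Finset.sum_congr rfl fun j _ => ?_
        split_ifs <;> simp
    calc _ ≤ ∑ j : Fin (S.len (b + 1)),
        ((if (w' j, S.input (b + 1) w' m' j, S.book (b + 1) m j) = a then
          (1 : ℝ≥0∞) else 0) + err) := Finset.sum_le_sum fun j _ => hstage j
      _ ≤ (ENNReal.ofReal (S.len (b + 1) * (p a + ε)) + S.len (b + 1) * N'.indicator 1 x) +
          S.len (b + 1) * (ENNReal.ofReal ε + N.indicator 1 x) := by
          rw [Finset.sum_add_distrib]
          refine add_le_add hfreq ?_
          rw [Finset.sum_const, Finset.card_univ, Fintype.card_fin, nsmul_eq_mul]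
          exact mul_le_mul_right herr_le _
      _ = _ := by rw [hc₁]; ring
  calc _ ≤ ∑ j : Fin (S.len (b + 1)), ∫⁻ x, s.observationLaw Γ x {y | (x (S.start (b + 1) + j),
      s.action₁ x (S.start (b + 1) + j), s.action₂ x y (S.start (b + 1) + j)) = a} ∂μ :=
        Finset.sum_le_sum fun j _ => s.sum_stageLaw_le_lintegral ρ Γ _ a
    _ ≤ ∫⁻ x, c₁ + (S.len (b + 1) * N.indicator 1 x + S.len (b + 1) * N'.indicator 1 x) ∂μ :=
        (sum_lintegral_le_lintegral_sum _ _ _).trans (lintegral_mono hpoint)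
    _ = c₁ + (S.len (b + 1) * μ N + S.len (b + 1) * μ N') := by
        have hmN : Measurable (N.indicator (1 : (ℕ → A) → ℝ≥0∞)) := measurable_one.indicator hNm
        have hmN' : Measurable (N'.indicator (1 : (ℕ → A) → ℝ≥0∞)) := measurable_one.indicator hNm'
        rw [lintegral_add_left measurable_const, lintegral_const, measure_univ, mul_one,
          lintegral_add_left (hmN.const_mul _), lintegral_const_mul _ hmN,
          lintegral_const_mul _ hmN', lintegral_indicator_one hNm, lintegral_indicator_one hNm']
    _ ≤ c₁ + (S.len (b + 1) * ENNReal.ofReal ε + S.len (b + 1) * ENNReal.ofReal ε) := by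
        gcongr
        · exact S.measure_window_not_mem_le ρ hG
        · exact S.measure_window_not_mem_le ρ hG'
    _ = ENNReal.ofReal (S.len (b + 1) * (p a + 4 * ε)) := by
        have hnε : (S.len (b + 1) : ℝ≥0∞) * ENNReal.ofReal ε = ENNReal.ofReal (S.len (b + 1) * ε)
            := by
          rw [ENNReal.ofReal_mul (Nat.cast_nonneg _), ENNReal.ofReal_natCast]
        have hpa := hp a
        rw [hc₁, hnε, ← ENNReal.ofReal_add (by positivity) (by positivity),
          ← ENNReal.ofReal_add (by positivity) (by positivity),
          ← ENNReal.ofReal_add (by positivity) (by positivity)]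
        congr 1
        ring

end BlockScheme

/-! ### Block lengths and the total loss -/

section Schedule

/-- The lengths of the blocks: long enough to tend to infinity, and rarely changing. -/
def blockLength (b : ℕ) : ℕ := Nat.log 2 (b + 1) + 1

lemma blockLength_pos (b : ℕ) : 0 < blockLength b := Nat.succ_pos _

lemma monotone_blockLength : Monotone blockLength := fun _ _ h =>
  Nat.succ_le_succ (Nat.log_mono_right (Nat.succ_le_succ h))

lemma tendsto_blockLength : Tendsto blockLength atTop atTop := by
  refine tendsto_atTop_atTop.2 fun k => ⟨2 ^ k, fun b hb => ?_⟩
  exact (Nat.le_log_of_pow_le (by norm_num) (hb.trans (Nat.le_succ b))).trans (Nat.le_succ _)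

lemma two_pow_blockLength_le {b : ℕ} (hb : 0 < b) : 2 ^ blockLength b ≤ 4 * b := by
  rw [blockLength, pow_succ]
  have := Nat.pow_log_le_self 2 (Nat.succ_ne_zero b)
  simp only [Nat.succ_eq_add_one] at this
  omega

lemma tendsto_blockLength_sq_div :
    Tendsto (fun b : ℕ => (blockLength b : ℝ) ^ 2 / b) atTop (𝓝 0) := by
  have h := ((tendsto_pow_const_div_const_pow_of_one_lt 2 (one_lt_two (α := ℝ))).comp
    tendsto_blockLength).const_mul 4
  rw [mul_zero] at h
  refine squeeze_zero' (Eventually.of_forall fun b => by positivity) ?_ h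
  filter_upwards [eventually_gt_atTop 0] with b hb
  have hb0 : (0 : ℝ) < b := by exact_mod_cast hb
  have h2 : (2 : ℝ) ^ blockLength b ≤ 4 * b := by exact_mod_cast two_pow_blockLength_le hb
  simp only [Function.comp]
  rw [mul_div_assoc', div_le_div_iff₀ hb0 (by positivity)]
  nlinarith [sq_nonneg (blockLength b : ℝ)]

/-- The loss in block `b`: the errors of the code, and the changes of code. -/
noncomputable def blockLoss (δ : ℕ → ℝ) (b : ℕ) : ℝ :=
  4 * δ (blockLength b) + ((blockLength b : ℝ) - blockLength (b - 1)) + if b = 0 then 1 else 0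

/-- The loss in the blocks before block `k`, and in an incomplete block `k`. -/
noncomputable def totalLoss (δ : ℕ → ℝ) (k : ℕ) : ℝ :=
  ∑ b ∈ Finset.range k, blockLength b * blockLoss δ b + blockLength k

lemma blockLoss_nonneg {δ : ℕ → ℝ} (hδ : ∀ n, 0 ≤ δ n) (b : ℕ) : 0 ≤ blockLoss δ b := by
  have h : (blockLength (b - 1) : ℝ) ≤ blockLength b := by
    exact_mod_cast monotone_blockLength (Nat.sub_le b 1)
  have := hδ (blockLength b)
  unfold blockLoss
  split_ifs <;> linarith

lemma totalLoss_nonneg {δ : ℕ → ℝ} (hδ : ∀ n, 0 ≤ δ n) (k : ℕ) : 0 ≤ totalLoss δ k :=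
  add_nonneg (Finset.sum_nonneg fun b _ => mul_nonneg (Nat.cast_nonneg _) (blockLoss_nonneg hδ b))
    (Nat.cast_nonneg _)

/-- Up to the code errors, the loss telescopes: `L_b (L_b - L_{b-1}) ≤ L_b² - L_{b-1}²` for
increasing lengths. The incomplete block adds at most one more square. -/
lemma totalLoss_le (δ : ℕ → ℝ) (k : ℕ) :
    totalLoss δ k ≤ 4 * ∑ b ∈ Finset.range k, blockLength b * δ (blockLength b) +
      3 * (blockLength k : ℝ) ^ 2 := by
  have h1 : ∀ k : ℕ, ∑ b ∈ Finset.range k, (blockLength b : ℝ) *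
      (((blockLength b : ℝ) - blockLength (b - 1)) + if b = 0 then 1 else 0) ≤
        (blockLength (k - 1) : ℝ) ^ 2 := by
    intro k
    induction k with
    | zero => simp
    | succ k ih =>
      rw [Finset.sum_range_succ, Nat.add_sub_cancel]
      rcases Nat.eq_zero_or_pos k with rfl | hk
      · simp [blockLength]
      · rw [if_neg hk.ne']
        have h : (blockLength (k - 1) : ℝ) ≤ blockLength k := by
          exact_mod_cast monotone_blockLength (Nat.sub_le k 1)
        have h0 : (0 : ℝ) ≤ blockLength (k - 1) := Nat.cast_nonneg _
        nlinarith
  have h2 : (blockLength (k - 1) : ℝ) ≤ blockLength k := by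
    exact_mod_cast monotone_blockLength (Nat.sub_le k 1)
  have h3 : (1 : ℝ) ≤ blockLength k := by exact_mod_cast blockLength_pos k
  have h4 : (blockLength (k - 1) : ℝ) ^ 2 ≤ (blockLength k : ℝ) ^ 2 := by gcongr
  have h5 : (blockLength k : ℝ) ≤ (blockLength k : ℝ) ^ 2 := by nlinarith
  have h6 := h1 k
  have h7 : ∑ b ∈ Finset.range k, blockLength b * blockLoss δ b =
      4 * ∑ b ∈ Finset.range k, blockLength b * δ (blockLength b) +
        ∑ b ∈ Finset.range k, (blockLength b : ℝ) *
          (((blockLength b : ℝ) - blockLength (b - 1)) + if b = 0 then 1 else 0) := by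
    rw [Finset.mul_sum, ← Finset.sum_add_distrib]
    refine Finset.sum_congr rfl fun b _ => ?_
    rw [blockLoss]; ring
  rw [totalLoss, h7]
  have h8 : 0 ≤ (blockLength k : ℝ) ^ 2 := sq_nonneg _
  linarith

/-- The code errors vanish by a weighted Cesàro argument; the quadratic term is `o(k)` since the
lengths are logarithmic, and `k` blocks contain at least `k` stages. -/
lemma tendsto_totalLoss_div {δ : ℕ → ℝ} (hδ0 : ∀ n, 0 ≤ δ n) (hδ : Tendsto δ atTop (𝓝 0)) :
    Tendsto (fun k => totalLoss δ k / ((∑ b ∈ Finset.range k, blockLength b : ℕ) : ℝ))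
      atTop (𝓝 0) := by
  have hge : ∀ k : ℕ, k ≤ ∑ b ∈ Finset.range k, blockLength b := fun k => by
    simpa using Finset.sum_le_sum fun b (_ : b ∈ Finset.range k) =>
      (Nat.succ_le_of_lt (blockLength_pos b) : 1 ≤ blockLength b)
  have h1 : (fun b => blockLength b * δ (blockLength b)) =o[atTop]
      fun b => (blockLength b : ℝ) := by
    rw [Asymptotics.isLittleO_iff_tendsto fun b hb => by rw [hb, zero_mul]]
    refine (hδ.comp tendsto_blockLength).congr fun b => ?_
    have : (blockLength b : ℝ) ≠ 0 := by exact_mod_cast (blockLength_pos b).ne'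
    simp only [Function.comp]
    field_simp
  have h2 := h1.sum_range (fun b => Nat.cast_nonneg _) (by
    refine tendsto_atTop_mono (fun k => ?_) tendsto_natCast_atTop_atTop
    exact_mod_cast hge k)
  have h3 := h2.tendsto_div_nhds_zero
  have h4 := (h3.const_mul 4).add (tendsto_blockLength_sq_div.const_mul 3)
  rw [mul_zero, mul_zero, add_zero] at h4
  refine squeeze_zero' (Eventually.of_forall fun k =>
    div_nonneg (totalLoss_nonneg hδ0 k) (Nat.cast_nonneg _)) ?_ h4
  filter_upwards [eventually_gt_atTop 0] with k hk
  have hk0 : (0 : ℝ) < k := by exact_mod_cast hk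
  have hge' : (k : ℝ) ≤ ((∑ b ∈ Finset.range k, blockLength b : ℕ) : ℝ) := by exact_mod_cast hge k
  refine (div_le_div_of_nonneg_right (totalLoss_le δ k) (Nat.cast_nonneg _)).trans ?_
  rw [add_div, mul_div_assoc, mul_div_assoc, Nat.cast_sum]
  refine add_le_add le_rfl (mul_le_mul_of_nonneg_left ?_ (by norm_num))
  rw [← Nat.cast_sum]
  exact div_le_div_of_nonneg_left (by positivity) hk0 hge'

end Schedule

/-! ### One sequence of codes with vanishing error -/

section CodeSequence

variable {A B C D : Type*} [Fintype A] [Fintype D]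

lemma hasBlockCode_one [Nonempty B] [Nonempty C] (ρ : A → ℝ) (Γ : B → PMF D) {p : A × B × C → ℝ}
    (hp : ∀ a, 0 ≤ p a) (n : ℕ) :
    HasBlockCode ρ Γ p 1 n := by
  classical
  refine ⟨fun _ => 0, fun _ _ => Classical.arbitrary C, fun _ _ _ => Classical.arbitrary B,
    fun _ _ => 0, Set.univ, by simp, fun x _ x' => by simp, fun x _ m a => ?_⟩
  calc occurrences _ a ≤ ∑ _i : Fin n, (1 : ℝ) :=
        Finset.sum_le_sum fun i _ => by split_ifs <;> norm_num
    _ = n := by simp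
    _ ≤ n * (p a + 1) := le_mul_of_one_le_right (Nat.cast_nonneg n) (by linarith [hp a])

/-- Diagonal choice: length `n` uses the smallest available error `1 / (k + 1)` with `k ≤ n`. The
value `k = 0` is always available, since error `1` asks for nothing. -/
lemma exists_blockCode_sequence [Nonempty B] [Nonempty C] {ρ : A → ℝ} (Γ : B → PMF D)
    {p : A × B × C → ℝ} (hp : ∀ a, 0 ≤ p a)
    (h : ∀ ε > 0, ∀ᶠ n : ℕ in atTop, HasBlockCode ρ Γ p ε n) :
    ∃ δ : ℕ → ℝ, (∀ n, 0 ≤ δ n) ∧ Tendsto δ atTop (𝓝 0) ∧ ∀ n, HasBlockCode ρ Γ p (δ n) n := by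
  classical
  let k : ℕ → ℕ := fun n => Nat.findGreatest (fun k => HasBlockCode ρ Γ p (1 / ((k : ℝ) + 1)) n) n
  have hk : Tendsto k atTop atTop := by
    refine tendsto_atTop.2 fun K => ?_
    filter_upwards [h (1 / ((K : ℝ) + 1)) (by positivity), eventually_ge_atTop K] with n hn hKn
    exact Nat.le_findGreatest hKn hn
  refine ⟨fun n => 1 / ((k n : ℝ) + 1), fun n => by positivity,
    tendsto_one_div_add_atTop_nhds_zero_nat.comp hk, fun n => ?_⟩
  exact Nat.findGreatest_spec (P := fun k => HasBlockCode ρ Γ p (1 / ((k : ℝ) + 1)) n)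
    (Nat.zero_le n) (by simpa using hasBlockCode_one ρ Γ hp n)

end CodeSequence

/-! ### Averaged laws: from one-sided to two-sided bounds -/

section AverageLaw

variable {A B C D : Type*} [Fintype A] [Fintype B] [Fintype C] [Fintype D]
  [MeasurableSpace A] [DiscreteMeasurableSpace A] [MeasurableSpace B] [DiscreteMeasurableSpace B]
  [MeasurableSpace D] [DiscreteMeasurableSpace D]

lemma StrategyPair.stageLaw_ne_top {A B C D : Type*} [MeasurableSpace A] [MeasurableSpace B]
    [MeasurableSpace D] (s : StrategyPair A B C D) (ρ : PMF A) (Γ : B → PMF D) (i : ℕ)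
    (v : A × B × C × D) : s.stageLaw ρ Γ i v ≠ ∞ := by
  refine ne_top_of_le_ne_top ENNReal.one_ne_top ?_
  calc s.stageLaw ρ Γ i v ≤ ∫⁻ _, 1 ∂(Measure.infinitePi fun _ : ℕ => ρ.toMeasure) :=
        lintegral_mono fun x => by
          unfold observationLaw
          exact prob_le_one
    _ = 1 := by simp

lemma StrategyPair.sum_toReal_stageLaw [Nonempty A] [Nonempty D] (s : StrategyPair A B C D)
    (ρ : PMF A) (Γ : B → PMF D) (i : ℕ) : ∑ v, (s.stageLaw ρ Γ i v).toReal = 1 := by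
  have h := fun v => s.toReal_stageLaw ρ Γ (T := i + 1) ⟨i, Nat.lt_succ_self i⟩ v
  simp only at h
  simp only [h]
  rw [sum_marginal, ← sum_marginal _ (fun ω => (ω.1, ω.2.1)), marginal_historyWeight,
    Fintype.sum_prod_type]
  simp only [s.sum_initialLaw]
  exact sum_prod_weight_eq_one (w := fun _ a => (ρ a).toReal) fun _ => PMF.sum_toReal ρ

/-- The distribution of the state and the actions at stage `i`. -/
noncomputable def StrategyPair.tripleLaw {A B C D : Type*} [Fintype D] [MeasurableSpace A]
    [MeasurableSpace B] [MeasurableSpace D] (s : StrategyPair A B C D) (ρ : PMF A)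
    (Γ : B → PMF D) (i : ℕ) (a : A × B × C) : ℝ :=
  ∑ d, (s.stageLaw ρ Γ i (a.1, a.2.1, a.2.2, d)).toReal

lemma StrategyPair.tripleLaw_nonneg {A B C D : Type*} [Fintype D] [MeasurableSpace A]
    [MeasurableSpace B] [MeasurableSpace D] (s : StrategyPair A B C D) (ρ : PMF A)
    (Γ : B → PMF D) (i : ℕ) (a : A × B × C) : 0 ≤ s.tripleLaw ρ Γ i a :=
  Finset.sum_nonneg fun _ _ => ENNReal.toReal_nonneg

lemma StrategyPair.sum_tripleLaw [Nonempty A] [Nonempty D] (s : StrategyPair A B C D)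
    (ρ : PMF A) (Γ : B → PMF D) (i : ℕ) : ∑ a, s.tripleLaw ρ Γ i a = 1 := by
  rw [← s.sum_toReal_stageLaw ρ Γ i]
  simp only [tripleLaw, Fintype.sum_prod_type]

lemma StrategyPair.tripleLaw_le_one [Nonempty A] [Nonempty D] (s : StrategyPair A B C D)
    (ρ : PMF A) (Γ : B → PMF D) (i : ℕ) (a : A × B × C) : s.tripleLaw ρ Γ i a ≤ 1 := by
  rw [← s.sum_tripleLaw ρ Γ i]
  exact Finset.single_le_sum (fun a _ => s.tripleLaw_nonneg ρ Γ i a) (Finset.mem_univ a)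

/-- One-sided bounds on all averaged probabilities are two-sided bounds. -/
lemma StrategyPair.abs_averageLaw_sub_le [Nonempty A] [Nonempty D] (s : StrategyPair A B C D)
    (ρ : PMF A) (Γ : B → PMF D) {p : A × B × C → ℝ} (hp1 : ∑ a, p a = 1) {T : ℕ} (hT : 0 < T)
    {r : ℝ} (hr : 0 ≤ r)
    (h : ∀ a, ∑ i ∈ Finset.range T, s.tripleLaw ρ Γ i a ≤ T * (p a + r)) (a : A × B × C) :
    |s.averageLaw ρ Γ T a.1 a.2.1 a.2.2 - p a| ≤ Fintype.card (A × B × C) * r := by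
  have hT0 : (0 : ℝ) < T := by exact_mod_cast hT
  have hupper : ∀ a, s.averageLaw ρ Γ T a.1 a.2.1 a.2.2 ≤ p a + r := by
    intro a
    have := h a
    change 1 / (T : ℝ) * ∑ i ∈ Finset.range T, s.tripleLaw ρ Γ i a ≤ p a + r
    rw [one_div_mul_eq_div, div_le_iff₀ hT0]
    linarith
  have hsum : ∑ a : A × B × C, s.averageLaw ρ Γ T a.1 a.2.1 a.2.2 = 1 := by
    change ∑ a, 1 / (T : ℝ) * ∑ i ∈ Finset.range T, s.tripleLaw ρ Γ i a = 1
    rw [← Finset.mul_sum, Finset.sum_comm]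
    simp only [s.sum_tripleLaw]
    simp [hT0.ne']
  have hcard : (1 : ℝ) ≤ Fintype.card (A × B × C) := by exact_mod_cast Fintype.card_pos_iff.2 ⟨a⟩
  rw [abs_le]
  constructor
  -- The gaps `p a + r - averageLaw` are nonnegative and sum to `card * r`, since both laws have
  -- mass one; each is therefore at most that sum.
  · have h1 := Finset.single_le_sum
      (f := fun a : A × B × C => p a + r - s.averageLaw ρ Γ T a.1 a.2.1 a.2.2)
      (fun a _ => by have := hupper a; linarith) (Finset.mem_univ a)
    rw [Finset.sum_sub_distrib, Finset.sum_add_distrib, hp1, hsum] at h1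
    simp only [Finset.sum_const, Finset.card_univ, nsmul_eq_mul] at h1
    linarith
  · have := hupper a
    nlinarith

end AverageLaw

/-! ### Achievability -/

section Achievability

/-- The performance of a sequence of block codes, one block at a time. -/
def BlockScheme.IsGood {A B C D : Type*} [Fintype A] [Fintype D] [MeasurableSpace A]
    [DiscreteMeasurableSpace A] [MeasurableSpace B] [MeasurableSpace D]
    (S : BlockScheme A B C D) (ρ : PMF A) (Γ : B → PMF D)
    (p : A × B × C → ℝ) (η : ℕ → ℝ) : Prop :=
  ∀ (θ : (ℕ → A) → ℕ → A) (b : ℕ), (∀ x, ∀ i < S.start (b + 1), θ x i = x i) →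
    ∀ [Nonempty A] [Nonempty B] [Nonempty C] [Nonempty D] (hθ : Measurable θ) (a : A × B × C),
      ∑ j ∈ Finset.range (S.len b), (S.strategy θ hθ).tripleLaw ρ Γ (S.start b + j) a ≤
        S.len b * (p a + η b)

lemma BlockScheme.IsGood.sum_tripleLaw_le {A B C D : Type*} [Fintype A] [Fintype D]
    [MeasurableSpace A] [DiscreteMeasurableSpace A] [MeasurableSpace B] [MeasurableSpace D]
    [Nonempty A] [Nonempty B] [Nonempty C] [Nonempty D]
    {S : BlockScheme A B C D} {ρ : PMF A} {Γ : B → PMF D} {p : A × B × C → ℝ} {η : ℕ → ℝ}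
    (hS : S.IsGood ρ Γ p η) {θ : (ℕ → A) → ℕ → A} (hθ : Measurable θ) (a : A × B × C) :
    ∀ k, (∀ x, ∀ i < S.start k, θ x i = x i) →
      ∑ i ∈ Finset.range (S.start k), (S.strategy θ hθ).tripleLaw ρ Γ i a ≤
        S.start k * p a + ∑ b ∈ Finset.range k, S.len b * η b
  | 0, _ => by simp [S.start_zero]
  | k + 1, hx => by
    have ih := hS.sum_tripleLaw_le hθ a k fun x i hi =>
      hx x i (hi.trans (S.strictMono_start (Nat.lt_succ_self k)))
    have hk := hS θ k hx hθ a
    rw [S.start_succ, Finset.sum_range_add, Finset.sum_range_succ]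
    push_cast
    linarith

variable {A B C D : Type*} [Fintype A] [Fintype B] [Fintype C] [Fintype D]
  [MeasurableSpace A] [DiscreteMeasurableSpace A] [MeasurableSpace B] [DiscreteMeasurableSpace B]
  [MeasurableSpace D] [DiscreteMeasurableSpace D]

open scoped Classical in
-- Consecutive blocks of equal length share one code, so the decoder fits the message. Where the
-- length increases they do not match, but the loss is then at least `1` and the bound is trivial.
lemma BlockScheme.exists_isGood {ρ : PMF A} {Γ : B → PMF D} {p : A × B × C → ℝ}
    (hp : ∀ a, 0 ≤ p a) {δ : ℕ → ℝ} (hδ : ∀ n, 0 ≤ δ n)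
    (h : ∀ n, HasBlockCode (fun a => (ρ a).toReal) Γ p (δ n) n) :
    ∃ S : BlockScheme A B C D, S.len = blockLength ∧ S.IsGood ρ Γ p (blockLoss δ) := by
  choose E Z Φ Ψ G h1 h2 h3 using h
  let S : BlockScheme A B C D :=
    { len := blockLength
      len_pos := blockLength_pos
      enc := fun b => E (blockLength b)
      book := fun b => Z (blockLength b)
      input := fun b => Φ (blockLength b)
      dec := fun b => Ψ (blockLength b) }
  refine ⟨S, rfl, fun θ b hx _ _ _ _ hθ a => ?_⟩
  have htrivial : ∀ b, 1 ≤ blockLoss δ b → ∑ j ∈ Finset.range (S.len b),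
      (S.strategy θ hθ).tripleLaw ρ Γ (S.start b + j) a ≤ S.len b * (p a + blockLoss δ b) := by
    intro b hb
    calc _ ≤ ∑ _j ∈ Finset.range (S.len b), (1 : ℝ) :=
          Finset.sum_le_sum fun j _ => StrategyPair.tripleLaw_le_one _ ρ Γ _ a
      _ = S.len b := by simp
      _ ≤ _ := le_mul_of_one_le_right (Nat.cast_nonneg _) (by linarith [hp a])
  rcases b with _ | b
  · exact htrivial 0 (by simp [blockLoss, hδ])
  rcases (monotone_blockLength (Nat.le_succ b)).eq_or_lt with heq | hlt
  · have hdec : ∀ n n', n = n' → ∀ w ∈ G n, ∀ w' : Fin n' → A,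
        ∑ y, (if Ψ n w y = E n' w' then 0 else
          ∏ j, (Γ (Φ n w (E n' w') j) (y j)).toReal) ≤ δ n' := by
      rintro n _ rfl
      exact h2 n
    have hG : ∀ n n', n = n' →
        ∑ w, (if w ∈ G n then 0 else ∏ j, (ρ (w j)).toReal) ≤ δ n' := by
      rintro n _ rfl
      exact h1 n
    have hkey := S.sum_stageLaw_block_le hθ ρ Γ hp (hδ (blockLength (b + 1))) hx
      (G (blockLength b)) (G (blockLength (b + 1))) (hG _ _ heq) (h1 _) (hdec _ _ heq)
      (h3 (blockLength (b + 1))) a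
    have hloss : blockLoss δ (b + 1) = 4 * δ (blockLength (b + 1)) := by
      have : blockLength b = blockLength (b + 1) := heq
      simp [blockLoss, this]
    rw [hloss]
    have hne : ∀ i v, (S.strategy θ hθ).stageLaw ρ Γ i v ≠ ∞ :=
      StrategyPair.stageLaw_ne_top _ ρ Γ
    have hreal := ENNReal.toReal_mono ENNReal.ofReal_ne_top hkey
    rw [ENNReal.toReal_ofReal (mul_nonneg (Nat.cast_nonneg _)
        (add_nonneg (hp a) (mul_nonneg (by norm_num) (hδ _)))),
      ENNReal.toReal_sum fun j _ => ENNReal.sum_ne_top.2 fun d _ => hne _ _] at hreal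
    rw [Finset.sum_range]
    refine le_trans (le_of_eq (Finset.sum_congr rfl fun j _ => ?_)) hreal
    rw [ENNReal.toReal_sum fun d _ => hne _ _]
    rfl
  · refine htrivial (b + 1) ?_
    have h4 : ((blockLength b : ℝ) + 1) ≤ blockLength (b + 1) := by exact_mod_cast hlt
    have h5 := hδ (blockLength (b + 1))
    simp only [blockLoss, Nat.add_sub_cancel, Nat.succ_ne_zero, if_false]
    linarith

/-- The strategies given by good block codes approach the target uniformly in the information of
decision-maker 1 beyond the horizon. -/
lemma exists_blockScheme_averageLaw [Nonempty A] [Nonempty B] [Nonempty C] [Nonempty D]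
    {ρ : PMF A} {Γ : B → PMF D} {p : A × B × C → ℝ} (hp : ∀ a, 0 ≤ p a) (hp1 : ∑ a, p a = 1)
    (hρ : marginal p (fun a => a.1) = fun a => (ρ a).toReal) (hslack : 0 ≤ informationSlack Γ p) :
    ∃ (S : BlockScheme A B C D) (r : ℕ → ℝ), Tendsto r atTop (𝓝 0) ∧
      ∀ T, 0 < T → ∀ (θ : (ℕ → A) → ℕ → A) (hθ : Measurable θ), (∀ x, ∀ i < T, θ x i = x i) →
        ∀ a, |(S.strategy θ hθ).averageLaw ρ Γ T a.1 a.2.1 a.2.2 - p a| ≤ r T := by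
  obtain ⟨δ, hδ0, hδ, hcode⟩ := exists_blockCode_sequence Γ hp
    fun ε hε => eventually_hasBlockCode Γ hp hp1 hslack hε
  rw [hρ] at hcode
  obtain ⟨S, hlen, hS⟩ := BlockScheme.exists_isGood hp hδ0 hcode
  let r : ℕ → ℝ := fun T => totalLoss δ (S.blockOf T) / S.start (S.blockOf T)
  have hblock : Tendsto S.blockOf atTop atTop :=
    tendsto_atTop_atTop.2 fun b => ⟨S.start b, fun _ => S.le_blockOf⟩
  have hr : Tendsto r atTop (𝓝 0) := by
    have := (tendsto_totalLoss_div hδ0 hδ).comp hblock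
    rw [← hlen] at this
    exact this
  refine ⟨S, fun T => Fintype.card (A × B × C) * r T, by simpa using hr.const_mul _,
    fun T hT θ hθ hx a => ?_⟩
  have hr0 : 0 ≤ r T := div_nonneg (totalLoss_nonneg hδ0 _) (Nat.cast_nonneg _)
  -- Block `0` has length `1`, so every `T > 0` lies beyond it and the denominator of `r T` is
  -- positive.
  have hβ : S.blockOf T ≠ 0 := by
    refine (Nat.lt_of_lt_of_le Nat.zero_lt_one (S.le_blockOf ?_)).ne'
    rw [S.start_succ, S.start_zero, zero_add, hlen]
    simpa [blockLength] using Nat.succ_le_of_lt hT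
  refine StrategyPair.abs_averageLaw_sub_le _ ρ Γ hp1 hT hr0 (fun a => ?_) a
  set β := S.blockOf T with hβdef
  have hβT : S.start β ≤ T := S.start_blockOf_le T
  have hTβ : T < S.start (β + 1) := S.lt_start_blockOf_succ T
  have hpos : 0 < S.start β := (Nat.pos_of_ne_zero hβ).trans_le (S.le_start β)
  have hpos' : (0 : ℝ) < S.start β := by exact_mod_cast hpos
  have hβT' : (S.start β : ℝ) ≤ T := by exact_mod_cast hβT
  have hmain := hS.sum_tripleLaw_le hθ a β fun x i hi => hx x i (hi.trans_le hβT)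
  have htail : ∑ i ∈ Finset.range (T - S.start β),
      (S.strategy θ hθ).tripleLaw ρ Γ (S.start β + i) a ≤ blockLength β := by
    calc _ ≤ ∑ _i ∈ Finset.range (T - S.start β), (1 : ℝ) :=
          Finset.sum_le_sum fun j _ => StrategyPair.tripleLaw_le_one _ ρ Γ _ a
      _ = ((T - S.start β : ℕ) : ℝ) := by simp
      _ ≤ _ := by
          rw [S.start_succ, hlen] at hTβ
          exact_mod_cast (by omega : T - S.start β ≤ blockLength β)
  have hsplit : T = S.start β + (T - S.start β) := by omega
  have hloss : S.start β * r T = totalLoss δ β := mul_div_cancel₀ _ hpos'.ne'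
  rw [totalLoss] at hloss
  rw [hlen] at hmain
  calc ∑ i ∈ Finset.range T, (S.strategy θ hθ).tripleLaw ρ Γ i a
      = ∑ i ∈ Finset.range (S.start β), (S.strategy θ hθ).tripleLaw ρ Γ i a +
        ∑ i ∈ Finset.range (T - S.start β),
          (S.strategy θ hθ).tripleLaw ρ Γ (S.start β + i) a := by
        rw [← Finset.sum_range_add, ← hsplit]
    _ ≤ S.start β * (p a + r T) := by linarith
    _ ≤ T * (p a + r T) := mul_le_mul_of_nonneg_right hβT' (add_nonneg (hp a) hr0)

lemma informationConstraint_implementable {ρ : PMF A} {Γ : B → PMF D} {Qbar : PMF (A × B × C)}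
    (hQbar : ∀ a, ∑ b, ∑ c, Qbar (a, b, c) = ρ a) (h : InformationConstraint Γ Qbar) :
    Implementable ρ Γ Qbar ∧ FiniteHorizonImplementable ρ Γ Qbar := by
  obtain ⟨v⟩ := Qbar.support_nonempty.to_type
  have : Nonempty A := ⟨v.1⟩
  have : Nonempty B := ⟨v.2.1⟩
  have : Nonempty C := ⟨v.2.2⟩
  have : Nonempty D := (Γ v.2.1).support_nonempty.to_type
  have hρ : marginal (fun a => (Qbar a).toReal) (fun a => a.1) = fun a => (ρ a).toReal := by
    funext a
    rw [← hQbar a, marginal, Fintype.sum_prod_type, ENNReal.toReal_sum fun b _ =>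
      ENNReal.sum_ne_top.2 fun c _ => Qbar.apply_ne_top _]
    simp only [ENNReal.toReal_sum fun c _ => Qbar.apply_ne_top _]
    rw [Finset.sum_eq_single a (fun a' _ ha' => by simp [ha']) (by simp)]
    simp [Fintype.sum_prod_type]
  obtain ⟨S, r, hr, hS⟩ := exists_blockScheme_averageLaw (fun _ => ENNReal.toReal_nonneg)
    (PMF.sum_toReal Qbar) hρ ((informationConstraint_iff Γ Qbar).1 h)
  constructor
  · refine ⟨S.strategy id measurable_id, fun a b c => ?_⟩
    rw [tendsto_iff_norm_sub_tendsto_zero]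
    refine squeeze_zero' (Eventually.of_forall fun _ => norm_nonneg _) ?_ hr
    filter_upwards [eventually_gt_atTop 0] with T hT
    exact hS T hT id measurable_id (fun _ _ _ => rfl) (a, b, c)
  -- States beyond the horizon are replaced by a fixed state. The true states are used in all blocks
  -- completed by stage `T`, and the incomplete one is already counted as lost.
  · let θ : ℕ → (ℕ → A) → ℕ → A := fun T x i => if i < T then x i else Classical.arbitrary A
    have hθ : ∀ T, Measurable (θ T) := fun T => measurable_pi_iff.2 fun i => by
      by_cases hi : i < T
      · simpa [θ, hi] using measurable_pi_apply i
      · simp [θ, hi]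
    refine ⟨fun T => S.strategy (θ T) (hθ T), fun T i _ x x' hxx' => ?_, fun a b c => ?_⟩
    · have : θ T x = θ T x' := by
        funext k
        by_cases hk : k < T
        · simp [θ, hk, hxx' k hk]
        · simp [θ, hk]
      funext y
      simp only [BlockScheme.strategy, this]
    · rw [tendsto_iff_norm_sub_tendsto_zero]
      refine squeeze_zero' (Eventually.of_forall fun _ => norm_nonneg _) ?_ hr
      filter_upwards [eventually_gt_atTop 0] with T hT
      exact hS T hT (θ T) (hθ T) (fun x i hi => by simp [θ, hi]) (a, b, c)

end Achievability

theorem theorem1 {X₀ X₁ X₂ Y : Type*} [Fintype X₀] [Fintype X₁] [Fintype X₂] [Fintype Y]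
    [MeasurableSpace X₀] [DiscreteMeasurableSpace X₀]
    [MeasurableSpace X₁] [DiscreteMeasurableSpace X₁]
    [MeasurableSpace Y] [DiscreteMeasurableSpace Y]
    (ρ : PMF X₀) (Γ : X₁ → PMF Y) (Qbar : PMF (X₀ × X₁ × X₂))
    (hQbar : ∀ x₀, ∑ x₁, ∑ x₂, Qbar (x₀, x₁, x₂) = ρ x₀) :
    (Implementable ρ Γ Qbar ↔ InformationConstraint Γ Qbar) ∧
      (FiniteHorizonImplementable ρ Γ Qbar ↔ InformationConstraint Γ Qbar) :=
  ⟨⟨Implementable.informationConstraint,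
    fun h => (informationConstraint_implementable hQbar h).1⟩,
   ⟨FiniteHorizonImplementable.informationConstraint,
    fun h => (informationConstraint_implementable hQbar h).2⟩⟩
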